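/- **Setting.** Let $0<\varepsilon<1/16$. The input is a finite simple graph $G=(V,E)$ on $n$ vertices with weights $w(v)>0$. For $C\subseteq V$ put $w(C)=\sum_{v\in C}w(v)$, and let $OPT$ be the minimum of $w(C)$ over all vertex covers $C$ of $G$. For $S\subseteq V$, $E[S]$ is the set of edges with both endpoints in $S$. A vertex is active until it is frozen, and frozen forever after; an edge is frozen if at least one of its endpoints is frozen, and active otherwise. **Centralized algorithm** on an induced subgraph $G[S]$ with weights $w'$. Start with all vertices of $S$ active, with an arbitrary fractional matching $x_{e,0}>0$ ($e\in E[S]$), that is, $\sum_{e\ni v}x_{e,0}\le w'(v)$ for all $v\in S$, and with arbitrary thresholds $\mathcal T_{v,t}\in[1-4\varepsilon,1-2\varepsilon]$. While at least one edge is active, iterate $t=0,1,\dots$: freeze (simultaneously) each active $v$ with $\sum_{e\ni v}x_{e,t}\ge\mathcal T_{v,t}\,w'(v)$; then set $x_{e,t+1}=x_{e,t}/(1-\varepsilon)$ for active edges and $x_{e,t+1}=x_{e,t}$ for frozen edges. Return the frozen vertices. **MPC simulation.** At any time let $d(v)$ be the number of nonfrozen neighbours of $v$, and $d=\frac1n\sum_{v\text{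 nonfrozen}}d(v)$. While $d>\log^{30}n$, perform a phase, where $d$, $d(v)$ and the following sets and residual weights are those of the beginning of the phase: 1. $V^{high}=\{v\text{ nonfrozen}: d(v)\ge d^{0.95}\}$, $V^{inactive}=\{v\text{ nonfrozen}: d(v)<d^{0.95}\}$; $w'(v)=w(v)-\sum_{e\ni v,\ e\text{ frozen}}x_e$; $x_{e,0}=\min\{w'(u)/d(u),\,w'(v)/d(v)\}$ for $e=(u,v)\in E[V^{high}]$. 2. $m=\lfloor\sqrt d\rfloor$ (number of machines), $I=\lfloor\log m/(10\log 15)\rfloor$. Choose $\mathcal T_{v,t}$ ($v\in V^{high}$, $0\le t<I$) uniformly from $[1-4\varepsilon,1-2\varepsilon]$, and assign each $v\in V^{high}$ to one of the parts $V_1,\dots,V_m$ uniformly at random; all random choices, also those of different phases, are independent. 3. For each $i$ in parallel, for $t=0,\dots,I-1$: freeze (simultaneously) each active $v\in V_i$ with $$2m^{-0.2}\,15^t\,w'(v)+m\sum_{e\ni v,\ e\in E[V_i]}x_{e,t}\ \ge\ \mathcal T_{v,t}\,w'(v);$$ then, for $e\in E[V_i]$, set $x_{e,t+1}=x_{e,t}/(1-\varepsilon)$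 if $e$ is active and $x_{e,t+1}=x_{e,t}$ if it is frozen. 4. For each $e=(u,v)\in E[V^{high}]$ set $x_e=x_{e,0}/(1-\varepsilon)^{t'}$, where $t'<I$ is the earliest iteration in which $u$ or $v$ was frozen, and $t'=I$ if both remain active. Then freeze every active $v\in V^{high}$ with $\sum_{e\ni v,\ e\in E[V^{high}]}x_e\ge w'(v)$. Set $x_e=0$ for each edge $e$ between $V^{inactive}$ and $V^{high}$. After the loop, run the centralized algorithm on the subgraph induced by the nonfrozen vertices, with the residual weights $w'(v)=w(v)-\sum_{e\ni v,\ e\text{ frozen}}x_e$. Return the set $C$ of all vertices frozen in the loop or in this final run. **Theorem.** For every $0<\varepsilon<1/16$ and every $c>0$ there is an $n_0$ such that for every graph $G$ with $n\ge n_0$ vertices and all positive vertex weights $w$, the following holds with probability at least $1-n^{-c}$: the MPC simulation terminates and, whatever admissible initial fractional matching and thresholds are used in the final centralized run, returns a vertex cover $C$ of $G$ with $$w(C)\le(2+30\varepsilon)\,OPT .$$ -/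

import Mathlib

namespace MWVC

noncomputable section

open scoped Classical
open MeasureTheory ProbabilityTheory

variable {V : Type*} [Fintype V]

/-! ### Weighted vertex covers -/

/-- The weight `w(C)` of a set of vertices. -/
def weight (w : V → ℝ) (C : Finset V) : ℝ := ∑ v ∈ C, w v

/-- The set of the weights of all vertex covers of `G`. -/
def coverWeights (G : SimpleGraph V) (w : V → ℝ) : Set ℝ :=
  {r | ∃ C : Finset V, G.IsVertexCover (C : Set V) ∧ r = weight w C}

/-- The weight of a minimum weight vertex cover. -/
def OPT (G : SimpleGraph V) (w : V → ℝ) : ℝ := sInf (coverWeights G w)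

/-- The infimum that defines `OPT` is a minimum. -/
theorem isLeast_OPT (G : SimpleGraph V) (w : V → ℝ) : IsLeast (coverWeights G w) (OPT G w) := by
  have hfin : (coverWeights G w).Finite := by
    refine (Set.finite_range (weight w)).subset ?_
    rintro r ⟨C, -, rfl⟩
    exact ⟨C, rfl⟩
  have hne : (coverWeights G w).Nonempty := ⟨_, Finset.univ, by simp, rfl⟩
  exact ⟨hne.csInf_mem hfin, fun r hr => csInf_le hfin.bddBelow hr⟩

/-! ### Edge weights

Edge weights are functions on unordered pairs; only their values on edges of the graph are used. -/

/-- The neighbours of `v` that lie in `S`. -/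
def nbrs (G : SimpleGraph V) (S : Finset V) (v : V) : Finset V := {u ∈ S | G.Adj v u}

/-- The total weight `∑_{e ∋ v, e ∈ E[S]} x_e` of the edges from `v` into `S` (used for `v ∈ S`). -/
def load (G : SimpleGraph V) (S : Finset V) (x : Sym2 V → ℝ) (v : V) : ℝ :=
  ∑ u ∈ nbrs G S v, x s(v, u)

/-- `e` has an endpoint in `F`; for `F` the set of frozen vertices: the edge `e` is frozen. -/
def Touches (F : Finset V) (e : Sym2 V) : Prop := ∃ v ∈ F, v ∈ e

/-- Both endpoints of `e` lie in `S`. -/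
def Inside (S : Finset V) (e : Sym2 V) : Prop := ∀ v ∈ e, v ∈ S

/-- The set of frozen vertices and the edge weights at some moment of a run. -/
structure RunState (V : Type*) where
  frozen : Finset V
  x : Sym2 V → ℝ

/-! ### The iterations of the primal-dual scheme -/

/-- State at the start of iteration `t` of the primal-dual scheme on the vertices of `S`, started
with all vertices active and the edge weights `x₀`. In iteration `t`, all active vertices `v ∈ S`
with `crit t x v` are frozen simultaneously, where `x` are the current edge weights; then the weight
of every edge that is still active is divided by `1 - ε`, and the other weights are kept. -/
def primalDual (S : Finset V) (ε : ℝ) (x₀ : Sym2 V → ℝ)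
    (crit : ℕ → (Sym2 V → ℝ) → V → Prop) : ℕ → RunState V
  | 0 => ⟨∅, x₀⟩
  | t + 1 =>
    let σ := primalDual S ε x₀ crit t
    let F : Finset V := σ.frozen ∪ {v ∈ S | v ∉ σ.frozen ∧ crit t σ.x v}
    ⟨F, fun e => if Touches F e then σ.x e else σ.x e / (1 - ε)⟩

/-! ### The centralized algorithm on the induced subgraph `G[S]` with vertex weights `w` -/

/-- State at the start of iteration `t`: a vertex is frozen if `∑_{e ∋ v} x_{e,t} ≥ T v t * w v`. -/
def centralRun (G : SimpleGraph V) (S : Finset V) (w : V → ℝ) (ε : ℝ) (x₀ : Sym2 V → ℝ)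
    (T : V → ℕ → ℝ) : ℕ → RunState V :=
  primalDual S ε x₀ fun t x v => T v t * w v ≤ load G S x v

/-- Some edge of `G[S]` is active. -/
def HasActiveEdge (G : SimpleGraph V) (S F : Finset V) : Prop :=
  ∃ u ∈ S, ∃ v ∈ S, G.Adj u v ∧ u ∉ F ∧ v ∉ F

/-- The centralized algorithm stops, at the first time when no edge is active, and returns the set
`C` of the vertices that are frozen by then. -/
def CentralReturns (G : SimpleGraph V) (S : Finset V) (w : V → ℝ) (ε : ℝ) (x₀ : Sym2 V → ℝ)
    (T : V → ℕ → ℝ) (C : Finset V) : Prop :=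
  ∃ N : ℕ, (∀ t < N, HasActiveEdge G S (centralRun G S w ε x₀ T t).frozen) ∧
    ¬ HasActiveEdge G S (centralRun G S w ε x₀ T N).frozen ∧
    C = (centralRun G S w ε x₀ T N).frozen

/-- `x₀` is a valid fractional matching of `G[S]` for the weights `w`, positive on every edge. -/
def ValidInit (G : SimpleGraph V) (S : Finset V) (w : V → ℝ) (x₀ : Sym2 V → ℝ) : Prop :=
  (∀ u ∈ S, ∀ v ∈ S, G.Adj u v → 0 < x₀ s(u, v)) ∧ ∀ v ∈ S, load G S x₀ v ≤ w v

/-- All thresholds lie in `[1 - 4ε, 1 - 2ε]`. -/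
def ValidThresholds (ε : ℝ) (T : V → ℕ → ℝ) : Prop :=
  ∀ v t, T v t ∈ Set.Icc (1 - 4 * ε) (1 - 2 * ε)

/-! ### One phase of the MPC simulation

`σ` is the state at the start of the phase: the frozen vertices, and the edge weights `x^MPC`. -/

/-- The nonfrozen vertices. -/
def alive (σ : RunState V) : Finset V := {v | v ∉ σ.frozen}

/-- The residual degree `d(v)`: the number of nonfrozen neighbours of `v`. -/
def deg (G : SimpleGraph V) (σ : RunState V) (v : V) : ℕ := (nbrs G (alive σ) v).card

/-- `d = (1/n) ∑_{v nonfrozen} d(v)`, where `n` is the number of all vertices of the input. -/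
def avgDeg (G : SimpleGraph V) (σ : RunState V) : ℝ :=
  (∑ v ∈ alive σ, (deg G σ v : ℝ)) / (Fintype.card V : ℝ)

/-- `V^high`. -/
def high (G : SimpleGraph V) (σ : RunState V) : Finset V :=
  {v ∈ alive σ | avgDeg G σ ^ (0.95 : ℝ) ≤ (deg G σ v : ℝ)}

/-- `V^inactive`. -/
def inactive (G : SimpleGraph V) (σ : RunState V) : Finset V :=
  {v ∈ alive σ | (deg G σ v : ℝ) < avgDeg G σ ^ (0.95 : ℝ)}

/-- The residual weight `w'(v) = w(v) - ∑_{e ∋ v, e frozen} x_e`. -/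
def resWeight (G : SimpleGraph V) (w : V → ℝ) (σ : RunState V) (v : V) : ℝ :=
  w v - ∑ u ∈ nbrs G Finset.univ v with Touches σ.frozen s(v, u), σ.x s(v, u)

/-- The initial edge weights `x_{e,0} = min {w'(u)/d(u), w'(v)/d(v)}` for `e = (u,v)`. -/
def initWeight (G : SimpleGraph V) (w : V → ℝ) (σ : RunState V) : Sym2 V → ℝ :=
  Sym2.lift ⟨fun u v => min (resWeight G w σ u / deg G σ u) (resWeight G w σ v / deg G σ v),
    fun _ _ => min_comm _ _⟩

/-- The number of machines, `√d` rounded down (and at least one). -/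
def numMachines (G : SimpleGraph V) (σ : RunState V) : ℕ+ := (⌊√(avgDeg G σ)⌋₊).toPNat'

/-- The number of iterations, `log m / (10 log 15)` rounded down. -/
def numIter (m : ℕ+) : ℕ := ⌊Real.log (m : ℝ) / (10 * Real.log 15)⌋₊

/-- The set `V_i` of the vertices of `V^high` that the partition `p` puts on machine `i`. -/
def part (G : SimpleGraph V) (σ : RunState V) {m : ℕ+} (p : V → Fin m) (i : Fin m) : Finset V :=
  {v ∈ high G σ | p v = i}

/-- State of machine `i` at the start of its iteration `t`: a vertex `v ∈ V_i` is frozen if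
`2 m^{-0.2} 15^t w'(v) + m ∑_{e ∋ v, e ∈ E[V_i]} x_{e,t} ≥ T v t * w'(v)`. -/
def machineRun (G : SimpleGraph V) (w : V → ℝ) (ε : ℝ) (σ : RunState V) {m : ℕ+}
    (p : V → Fin m) (T : V → ℕ → ℝ) (i : Fin m) : ℕ → RunState V :=
  primalDual (part G σ p i) ε (initWeight G w σ) fun t x v =>
    T v t * resWeight G w σ v ≤
      2 * (m : ℝ) ^ (-0.2 : ℝ) * 15 ^ t * resWeight G w σ v + (m : ℝ) * load G (part G σ p i) x v

/-- The vertices that were frozen by their machine before iteration `t`. -/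
def localFrozen (G : SimpleGraph V) (w : V → ℝ) (ε : ℝ) (σ : RunState V) {m : ℕ+}
    (p : V → Fin m) (T : V → ℕ → ℝ) (t : ℕ) : Finset V :=
  {v ∈ high G σ | v ∈ (machineRun G w ε σ p T (p v) t).frozen}

/-- The earliest iteration `t' < I` in which an endpoint of `e` was frozen, or `I` if both endpoints
remain active. -/
def freezeTime (G : SimpleGraph V) (w : V → ℝ) (ε : ℝ) (σ : RunState V) {m : ℕ+}
    (p : V → Fin m) (T : V → ℕ → ℝ) (e : Sym2 V) : ℕ :=
  sInf {t | t = numIter m ∨ t < numIter m ∧ Touches (localFrozen G w ε σ p T (t + 1)) e}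

/-- The weight `x_{e,0} / (1 - ε)^{t'}` of an edge `e` of `E[V^high]` after the local simulation. -/
def phaseWeight (G : SimpleGraph V) (w : V → ℝ) (ε : ℝ) (σ : RunState V) {m : ℕ+}
    (p : V → Fin m) (T : V → ℕ → ℝ) (e : Sym2 V) : ℝ :=
  initWeight G w σ e / (1 - ε) ^ freezeTime G w ε σ p T e

/-- The state after one phase, with partition `p` of `V^high` and thresholds `T`. -/
def phase (G : SimpleGraph V) (w : V → ℝ) (ε : ℝ) (σ : RunState V) {m : ℕ+}
    (p : V → Fin m) (T : V → ℕ → ℝ) : RunState V where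
  frozen :=
    let F := localFrozen G w ε σ p T (numIter m)
    σ.frozen ∪ F ∪ {v ∈ high G σ | v ∉ F ∧
      resWeight G w σ v ≤ load G (high G σ) (phaseWeight G w ε σ p T) v}
  x := fun e =>
    if Inside (high G σ) e then phaseWeight G w ε σ p T e
    else if Touches (high G σ) e ∧ Touches (inactive G σ) e then 0
    else σ.x e

/-! ### The random choices -/

/-- The random choices of one phase: the thresholds, and, for every possible number `m` of machines,
an assignment of the vertices to the machines. -/
abbrev PhaseCoins (V : Type*) := (V → ℕ → ℝ) × ((m : ℕ+) → V → Fin m)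

/-- All random choices: the choices of phase `0, 1, 2, …`. -/
abbrev Coins (V : Type*) := ℕ → PhaseCoins V

/-- The law of the random choices: all thresholds are uniform on `[1 - 4ε, 1 - 2ε]`, all machines
are uniform among the `m` machines, and everything is independent. -/
def coinMeasure (V : Type*) (ε : ℝ) : Measure (Coins V) :=
  Measure.infinitePi fun _ : ℕ =>
    (Measure.infinitePi fun _ : V => Measure.infinitePi fun _ : ℕ =>
        (volume : Measure ℝ)[|Set.Icc (1 - 4 * ε) (1 - 2 * ε)]).prod
      (Measure.infinitePi fun m : ℕ+ => Measure.infinitePi fun _ : V =>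
        uniformOn (Set.univ : Set (Fin m)))

theorem isProbabilityMeasure_coinMeasure (V : Type*) {ε : ℝ} (hε : 0 < ε) :
    IsProbabilityMeasure (coinMeasure V ε) := by
  have h1 : IsProbabilityMeasure ((volume : Measure ℝ)[|Set.Icc (1 - 4 * ε) (1 - 2 * ε)]) := by
    apply cond_isProbabilityMeasure_of_finite
    · rw [Real.volume_Icc, Ne, ENNReal.ofReal_eq_zero]; linarith
    · rw [Real.volume_Icc]; exact ENNReal.ofReal_ne_top
  have h2 : ∀ m : ℕ+, IsProbabilityMeasure (uniformOn (Set.univ : Set (Fin m))) := fun m =>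
    isProbabilityMeasure_uniformOn Set.finite_univ Set.univ_nonempty
  unfold coinMeasure
  infer_instance

/-! ### The MPC simulation -/

/-- The state after `k` phases, for the random choices `ω`. Initially, nothing is frozen. -/
def mpcState (G : SimpleGraph V) (w : V → ℝ) (ε : ℝ) (ω : Coins V) : ℕ → RunState V
  | 0 => ⟨∅, 0⟩
  | k + 1 =>
    let σ := mpcState G w ε ω k
    phase G w ε σ ((ω k).2 (numMachines G σ)) (ω k).1

/-- The condition of the while-loop: `d > log^30 n`. -/
def LoopCond (G : SimpleGraph V) (σ : RunState V) : Prop :=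
  Real.log (Fintype.card V : ℝ) ^ 30 < avgDeg G σ

/-- The while-loop is left, after exactly `K` phases, in the state `σ`. -/
def LoopEndsAt (G : SimpleGraph V) (w : V → ℝ) (ε : ℝ) (ω : Coins V) (K : ℕ) (σ : RunState V) :
    Prop :=
  (∀ k < K, LoopCond G (mpcState G w ε ω k)) ∧ ¬ LoopCond G (mpcState G w ε ω K) ∧
    σ = mpcState G w ε ω K

/-- After the loop has been left in the state `σ`, the centralized algorithm is run on the subgraph
induced by the nonfrozen vertices, with the residual weights, initial edge weights `x₀` and
thresholds `T`; then the set `C` of all frozen vertices is returned. -/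
def FinishReturns (G : SimpleGraph V) (w : V → ℝ) (ε : ℝ) (σ : RunState V) (x₀ : Sym2 V → ℝ)
    (T : V → ℕ → ℝ) (C : Finset V) : Prop :=
  ∃ C' : Finset V, CentralReturns G (alive σ) (resWeight G w σ) ε x₀ T C' ∧ C = σ.frozen ∪ C'

/-- For the random choices `ω`, the MPC simulation terminates and returns a vertex cover of weight
at most `(2 + 30ε) OPT`, whatever initial fractional matching and whatever thresholds are used in
the final run of the centralized algorithm. -/
def Succeeds (G : SimpleGraph V) (w : V → ℝ) (ε : ℝ) (ω : Coins V) : Prop :=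
  ∃ (K : ℕ) (σ : RunState V), LoopEndsAt G w ε ω K σ ∧
    ∀ (x₀ : Sym2 V → ℝ) (T : V → ℕ → ℝ),
      ValidInit G (alive σ) (resWeight G w σ) x₀ → ValidThresholds ε T →
      ∃ C : Finset V, FinishReturns G w ε σ x₀ T C ∧ G.IsVertexCover (C : Set V) ∧
        weight w C ≤ (2 + 30 * ε) * OPT G w

end

end MWVC

/-!
Every phase of the simulation is coupled with a run of the centralized algorithm on `G[V^high]` with
the same initial edge weights and the same thresholds. Write `α = 1 / (1 - ε)`, let `m` be the
number of machines and `δ = m ^ (-0.2)`. The initial weight `x_{e,0}` of an edge is at most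
`w'(v) / d(v)` with `d(v) ≥ d ^ 0.95` and `m ≤ √d`, so that a single edge matters little to a
machine, even after multiplication by `m` and after all iterations, since `15 ^ I ≤ m ^ 0.1`.

The centralized run depends on the thresholds only, so that the random partition is independent of
it, and the load that a machine sees from the *centralized* edge weights is within `δ w'(v)` of its
mean (`partitionLaw_not_samplesWell_le`). A machine sees its own edge weights instead, which differ
only at neighbours that were frozen in different iterations of the two runs. The term
`2 δ 15 ^ t w'(v)` in the rule of the machines biases their estimates upwards, so that vertices are
only ever frozen too early, never too late; and a vertex is frozen too early in iteration `t` only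
if its threshold falls into an interval of length `4 δ 15 ^ t` above its load. Such vertices are
called risky. The threshold of iteration `t` is fresh and uniform on an interval of length `2ε`, so
that at most a proportion of order `δ 15 ^ t / ε` of any neighbourhood is risky
(`thresholdsLaw_not_fewRisky_le`). An edge that is frozen too early loses only a factor `1 - ε` per
iteration, which compensates the `1 / ε`, and the errors grow by a constant factor less than `15` in
each iteration (`sum_pow_sub_one_mul_le`). This closes the induction
(`CoupledRuns.subset_and_risky`).

As machines freeze early, the edge weights of the simulation are dominated by those of the
centralized run and hence form a fractional matching (`CoupledRuns.sum_min_growth_le`); and a vertex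
that was frozen by its machine had a true load of at least `(1 - 5ε) w'(v)`
(`CoupledRuns.le_sum_min_growth`). The two deviation events have probability at most
`exp (-m ^ 0.4 / 4)` for each vertex, machine and iteration, by Chernoff bounds
(`phaseLaw_not_phaseGood_le`); this is superpolynomially small because `d > log ^ 30 n`.

The average degree halves in every phase, deterministically (`avgDeg_phase_le_half`): orient each
surviving edge of `G[V^high]` away from the endpoint `v` that determines its initial weight
`w'(v) / d(v)`; that weight has grown by the factor `α ^ I` while the load of `v` is still below
`w'(v)`, so that `v` has at most `d(v) / α ^ I` outgoing edges. Hence there are at most `n` phases,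
and a union bound applies (`coinMeasure_phaseFails_le`). If all phases succeed, the edge weights of
the loop and of the final run together form a fractional matching of `G` whose constraints are tight
up to the factor `1 - 5ε` at all vertices of the returned cover (`exists_finishReturns`), and weak
duality gives the ratio `2 / (1 - 5ε) ≤ 2 + 30ε` (`weight_le_of_fractional_matching`).
-/

namespace MWVC

open scoped Classical
open MeasureTheory ProbabilityTheory

/-! ### Concentration of sums of independent bounded variables -/

section Concentration

variable {Ω ι : Type*} [MeasurableSpace Ω] {μ : Measure Ω} [IsProbabilityMeasure μ]

/-- Moment generating function of a `[0, b]`-valued variable: the quadratic term is bounded by the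
mean rather than by `b ^ 2`, as in Bernstein's inequality. -/
lemma mgf_le_exp_of_mem_Icc {X : Ω → ℝ} (hX : Measurable X) {b t : ℝ}
    (h0 : ∀ ω, 0 ≤ X ω) (hb : ∀ ω, X ω ≤ b) (ht : |t| * b ≤ 1) :
    mgf X μ t ≤ Real.exp ((t + t ^ 2 * b) * ∫ ω, X ω ∂μ) := by
  have hint : Integrable X μ := by
    refine Integrable.of_bound hX.aestronglyMeasurable b (ae_of_all _ fun ω => ?_)
    rw [Real.norm_eq_abs, abs_of_nonneg (h0 ω)]
    exact hb ω
  have hle : ∀ ω, Real.exp (t * X ω) ≤ 1 + (t + t ^ 2 * b) * X ω := by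
    intro ω
    have h1 : |t * X ω| ≤ 1 := by
      rw [abs_mul, abs_of_nonneg (h0 ω)]
      exact (mul_le_mul_of_nonneg_left (hb ω) (abs_nonneg t)).trans ht
    have h2 := (abs_le.1 (Real.abs_exp_sub_one_sub_id_le h1)).2
    have h3 : (t * X ω) ^ 2 ≤ t ^ 2 * b * X ω := by
      have := mul_le_mul_of_nonneg_left (hb ω) (mul_nonneg (sq_nonneg t) (h0 ω))
      nlinarith
    nlinarith
  have hexp : Integrable (fun ω => Real.exp (t * X ω)) μ :=
    integrable_exp_mul_of_mem_Icc (a := 0) (b := b) hX.aemeasurable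
      (ae_of_all _ fun ω => ⟨h0 ω, hb ω⟩)
  calc mgf X μ t = ∫ ω, Real.exp (t * X ω) ∂μ := rfl
    _ ≤ ∫ ω, (1 + (t + t ^ 2 * b) * X ω) ∂μ :=
        integral_mono hexp ((integrable_const _).add (hint.const_mul _)) hle
    _ = 1 + (t + t ^ 2 * b) * ∫ ω, X ω ∂μ := by
        rw [integral_add (integrable_const _) (hint.const_mul _), integral_const_mul]
        simp
    _ ≤ _ := by
        rw [add_comm]
        exact Real.add_one_le_exp _

variable {X : ι → Ω → ℝ} {s : Finset ι} {b t : ℝ}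

lemma mgf_sum_le_exp (hind : iIndepFun X μ) (hX : ∀ i, Measurable (X i))
    (h0 : ∀ i ∈ s, ∀ ω, 0 ≤ X i ω) (hb : ∀ i ∈ s, ∀ ω, X i ω ≤ b) (ht : |t| * b ≤ 1) :
    mgf (∑ i ∈ s, X i) μ t ≤ Real.exp ((t + t ^ 2 * b) * ∑ i ∈ s, ∫ ω, X i ω ∂μ) := by
  rw [hind.mgf_sum hX, Finset.mul_sum, Real.exp_sum]
  exact Finset.prod_le_prod (fun i _ => mgf_nonneg)
    fun i hi => mgf_le_exp_of_mem_Icc (hX i) (h0 i hi) (hb i hi) ht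

lemma integrable_exp_mul_sum_of_mem_Icc (hX : ∀ i, Measurable (X i))
    (h0 : ∀ i ∈ s, ∀ ω, 0 ≤ X i ω) (hb : ∀ i ∈ s, ∀ ω, X i ω ≤ b) :
    Integrable (fun ω => Real.exp (t * (∑ i ∈ s, X i) ω)) μ := by
  refine integrable_exp_mul_of_mem_Icc (a := 0) (b := ∑ _i ∈ s, b) ?_ (ae_of_all _ fun ω => ?_)
  · rw [Finset.sum_fn]
    exact (Finset.measurable_sum s fun i _ => hX i).aemeasurable
  · rw [Finset.sum_apply]
    exact ⟨Finset.sum_nonneg fun i hi => h0 i hi ω, Finset.sum_le_sum fun i hi => hb i hi ω⟩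

/-- Upper tail with a free parameter `t ≤ 1 / b`; `M` is an upper bound on the mean. -/
lemma chernoff_upper (hind : iIndepFun X μ) (hX : ∀ i, Measurable (X i))
    (h0 : ∀ i ∈ s, ∀ ω, 0 ≤ X i ω) (hb : ∀ i ∈ s, ∀ ω, X i ω ≤ b) (hb0 : 0 ≤ b)
    (ht0 : 0 ≤ t) (ht : t * b ≤ 1) {M : ℝ} (hM : ∑ i ∈ s, ∫ ω, X i ω ∂μ ≤ M) (r : ℝ) :
    μ {ω | r ≤ ∑ i ∈ s, X i ω} ≤ ENNReal.ofReal (Real.exp (-t * r + (t + t ^ 2 * b) * M)) := by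
  have h1 := measure_ge_le_exp_mul_mgf (μ := μ) (X := ∑ i ∈ s, X i) r ht0
    (integrable_exp_mul_sum_of_mem_Icc hX h0 hb)
  have h2 := mgf_sum_le_exp (t := t) hind hX h0 hb (by rwa [abs_of_nonneg ht0])
  simp only [Finset.sum_apply] at h1
  rw [← ofReal_measureReal]
  refine ENNReal.ofReal_le_ofReal (h1.trans ?_)
  rw [Real.exp_add]
  refine mul_le_mul_of_nonneg_left (h2.trans (Real.exp_le_exp.2 ?_)) (Real.exp_pos _).le
  exact mul_le_mul_of_nonneg_left hM (by positivity)

/-- Lower tail with a free parameter `t ≤ 1 / b`. -/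
lemma chernoff_lower (hind : iIndepFun X μ) (hX : ∀ i, Measurable (X i))
    (h0 : ∀ i ∈ s, ∀ ω, 0 ≤ X i ω) (hb : ∀ i ∈ s, ∀ ω, X i ω ≤ b)
    (ht0 : 0 ≤ t) (ht : t * b ≤ 1) (r : ℝ) :
    μ {ω | ∑ i ∈ s, X i ω ≤ r} ≤
      ENNReal.ofReal (Real.exp (t * r + (-t + t ^ 2 * b) * ∑ i ∈ s, ∫ ω, X i ω ∂μ)) := by
  have h1 := measure_le_le_exp_mul_mgf (μ := μ) (X := ∑ i ∈ s, X i) r (neg_nonpos.2 ht0)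
    (integrable_exp_mul_sum_of_mem_Icc hX h0 hb)
  have h2 := mgf_sum_le_exp (t := -t) hind hX h0 hb (by rwa [abs_neg, abs_of_nonneg ht0])
  simp only [Finset.sum_apply, neg_neg, neg_sq] at h1 h2
  rw [← ofReal_measureReal]
  refine ENNReal.ofReal_le_ofReal (h1.trans ?_)
  rw [Real.exp_add]
  exact mul_le_mul_of_nonneg_left h2 (Real.exp_pos _).le

end Concentration

/-! ### Resampling coordinates of a product measure -/

section Resampling

variable {ι : Type*} {X : ι → Type*} [∀ i, MeasurableSpace (X i)] (μ : ∀ i, Measure (X i))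
  [∀ i, IsProbabilityMeasure (μ i)]

/-- Replacing the coordinates in `J` by those of an independent copy preserves a product measure. -/
lemma measurePreserving_resample (J : Set ι) [DecidablePred (· ∈ J)] :
    MeasurePreserving (fun p : (∀ i, X i) × (∀ i, X i) => fun i => if i ∈ J then p.2 i else p.1 i)
      ((Measure.infinitePi μ).prod (Measure.infinitePi μ)) (Measure.infinitePi μ) := by
  have hm : Measurable
      (fun p : (∀ i, X i) × (∀ i, X i) => fun i => if i ∈ J then p.2 i else p.1 i) := by
    refine measurable_pi_lambda _ fun i => ?_
    by_cases hi : i ∈ J <;> simp only [hi, if_true, if_false] <;> fun_prop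
  refine ⟨hm, Measure.eq_infinitePi μ fun s t ht => ?_⟩
  rw [Measure.map_apply hm (.pi s.countable_toSet fun _ _ => ht _)]
  have hset : (fun p : (∀ i, X i) × (∀ i, X i) => fun i => if i ∈ J then p.2 i else p.1 i) ⁻¹'
      (Set.pi (s : Set ι) t) =
      (Set.pi ((s.filter (· ∉ J) : Finset ι) : Set ι) t) ×ˢ
        (Set.pi ((s.filter (· ∈ J) : Finset ι) : Set ι) t) := by
    ext p
    simp only [Set.mem_preimage, Set.mem_pi, Set.mem_prod, Finset.coe_filter]
    constructor
    · intro h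
      exact ⟨fun i hi => by simpa [hi.2] using h i hi.1, fun i hi => by simpa [hi.2] using h i hi.1⟩
    · rintro ⟨h1, h2⟩ i hi
      by_cases hJ : i ∈ J
      · simpa [hJ] using h2 i ⟨hi, hJ⟩
      · simpa [hJ] using h1 i ⟨hi, hJ⟩
  rw [hset, Measure.prod_prod, Measure.infinitePi_pi μ fun i _ => ht i,
    Measure.infinitePi_pi μ fun i _ => ht i, mul_comm]
  exact Finset.prod_filter_mul_prod_filter_not s _ _

/-- An event has probability at most `q` if it does so conditionally on every value of the first of
two independent sources of randomness. -/
lemma measure_le_of_measurePreserving_prod {α β γ : Type*} [MeasurableSpace α] [MeasurableSpace β]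
    [MeasurableSpace γ] {ρ : Measure α} {ν : Measure β} {κ : Measure γ} [IsProbabilityMeasure ρ]
    [SFinite ν] {f : α × β → γ} (hf : MeasurePreserving f (ρ.prod ν) κ) {E : Set γ}
    (hE : MeasurableSet E) {q : ENNReal} (h : ∀ a, ν {b | f (a, b) ∈ E} ≤ q) : κ E ≤ q := by
  rw [← hf.measure_preimage hE.nullMeasurableSet, Measure.prod_apply (hf.measurable hE)]
  calc ∫⁻ a, ν (Prod.mk a ⁻¹' (f ⁻¹' E)) ∂ρ ≤ ∫⁻ _, q ∂ρ := lintegral_mono fun a => h a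
    _ = q := by simp

end Resampling

section Columns

variable {V : Type*} {ν : Measure ℝ} [IsProbabilityMeasure ν]

/-- Replacing one column of a random array by that of an independent copy preserves its law. -/
lemma measurePreserving_resample_column (t : ℕ) :
    MeasurePreserving
      (fun p : (V → ℕ → ℝ) × (V → ℕ → ℝ) => fun v s => if s = t then p.2 v s else p.1 v s)
      ((Measure.infinitePi fun _ : V => Measure.infinitePi fun _ : ℕ => ν).prod
        (Measure.infinitePi fun _ : V => Measure.infinitePi fun _ : ℕ => ν))
      (Measure.infinitePi fun _ : V => Measure.infinitePi fun _ : ℕ => ν) := by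
  have hc : MeasurePreserving (MeasurableEquiv.curry V ℕ ℝ)
      (Measure.infinitePi fun _ : V × ℕ => ν)
      (Measure.infinitePi fun _ : V => Measure.infinitePi fun _ : ℕ => ν) :=
    ⟨(MeasurableEquiv.curry V ℕ ℝ).measurable,
      Measure.infinitePi_map_curry (fun (_ : V) (_ : ℕ) => ν)⟩
  have hs := hc.symm
  have h := hc.comp ((measurePreserving_resample (fun _ : V × ℕ => ν) {i | i.2 = t}).comp
    (hs.prod hs))
  convert! h using 1

end Columns

/-! ### Discrete random variables -/

/-- A map with countably many values all of whose preimages are measurable. The algorithm's states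
are of this kind, which settles every measurability question about them without a `σ`-algebra on the
type of states. -/
structure DiscreteRV {Ω α : Type*} [MeasurableSpace Ω] (f : Ω → α) : Prop where
  countable_range : (Set.range f).Countable
  measurableSet_preimage : ∀ A : Set α, MeasurableSet (f ⁻¹' A)

namespace DiscreteRV

variable {Ω Ω' α β : Type*} [MeasurableSpace Ω] [MeasurableSpace Ω']

lemma of_fibers {f : Ω → α} (hc : (Set.range f).Countable)
    (h : ∀ a, MeasurableSet {ω | f ω = a}) : DiscreteRV f := by
  refine ⟨hc, fun A => ?_⟩
  have : f ⁻¹' A = ⋃ a ∈ A ∩ Set.range f, {ω | f ω = a} := by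
    ext ω
    simp
  rw [this]
  exact MeasurableSet.biUnion (hc.mono Set.inter_subset_right) fun a _ => h a

lemma of_finite [Finite α] {f : Ω → α} (h : ∀ a, MeasurableSet {ω | f ω = a}) : DiscreteRV f :=
  of_fibers (Set.to_countable _) h

lemma const (a : α) : DiscreteRV fun _ : Ω => a :=
  ⟨(Set.finite_range_const).countable, fun _ => MeasurableSet.const _⟩

/-- A discrete variable may be used as a parameter of another one: no joint measurability is
needed. -/
lemma bind {f : Ω → α} {h : α → Ω → β} (hf : DiscreteRV f) (hh : ∀ a, DiscreteRV (h a)) :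
    DiscreteRV fun ω => h (f ω) ω := by
  refine ⟨?_, fun A => ?_⟩
  · refine (hf.countable_range.biUnion fun a _ => (hh a).countable_range).mono ?_
    rintro _ ⟨ω, rfl⟩
    exact Set.mem_biUnion ⟨ω, rfl⟩ ⟨ω, rfl⟩
  · have : (fun ω => h (f ω) ω) ⁻¹' A = ⋃ a ∈ Set.range f, (f ⁻¹' {a} ∩ h a ⁻¹' A) := by
      ext ω
      simp only [Set.mem_preimage, Set.mem_iUnion, Set.mem_inter_iff, Set.mem_singleton_iff]
      exact ⟨fun h => ⟨f ω, ⟨ω, rfl⟩, rfl, h⟩, fun ⟨a, _, h, h'⟩ => h ▸ h'⟩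
    rw [this]
    exact MeasurableSet.biUnion hf.countable_range fun a _ =>
      (hf.measurableSet_preimage _).inter ((hh a).measurableSet_preimage _)

lemma map {f : Ω → α} (hf : DiscreteRV f) (g : α → β) : DiscreteRV fun ω => g (f ω) :=
  hf.bind (h := fun a _ => g a) fun a => const (g a)

lemma comp_measurable {f : Ω → α} (hf : DiscreteRV f) {g : Ω' → Ω} (hg : Measurable g) :
    DiscreteRV fun ω => f (g ω) :=
  ⟨hf.countable_range.mono (Set.range_comp_subset_range g f),
    fun A => hg (hf.measurableSet_preimage A)⟩

lemma prop_iff {p : Ω → Prop} : DiscreteRV p ↔ MeasurableSet {ω | p ω} := by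
  refine ⟨fun h => by simpa using h.measurableSet_preimage {True}, fun h => of_finite fun a => ?_⟩
  by_cases ha : a
  · simpa only [ha, eq_iff_iff, iff_true] using h
  · simp only [ha, eq_iff_iff, iff_false]
    exact MeasurableSet.compl h

lemma pi {ι : Type*} [Finite ι] {f : ι → Ω → α} (hf : ∀ i, DiscreteRV (f i)) :
    DiscreteRV fun ω i => f i ω := by
  refine of_fibers ?_ fun a => ?_
  · refine (Set.countable_univ_pi fun i => (hf i).countable_range).mono ?_
    rintro _ ⟨ω, rfl⟩ i -
    exact ⟨ω, rfl⟩
  · have : {ω | (fun i => f i ω) = a} = ⋂ i, f i ⁻¹' {a i} := by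
      ext ω
      simp [funext_iff]
    rw [this]
    exact MeasurableSet.iInter fun i => (hf i).measurableSet_preimage _

lemma of_factorsThrough {f : Ω → α} {g : Ω → β} (hf : DiscreteRV f)
    (h : ∀ ω ω', f ω = f ω' → g ω = g ω') : DiscreteRV g := by
  refine ⟨?_, fun A => ?_⟩
  · have hsub : Set.range g ⊆ ⋃ a ∈ Set.range f, g '' (f ⁻¹' {a}) := by
      rintro _ ⟨ω, rfl⟩
      exact Set.mem_biUnion ⟨ω, rfl⟩ ⟨ω, rfl, rfl⟩
    refine (hf.countable_range.biUnion fun a _ => Set.Subsingleton.countable ?_).mono hsub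
    rintro _ ⟨ω, hω, rfl⟩ _ ⟨ω', hω', rfl⟩
    exact h ω ω' (hω.trans hω'.symm)
  · have : g ⁻¹' A = f ⁻¹' (f '' (g ⁻¹' A)) := by
      refine (Set.subset_preimage_image f _).antisymm ?_
      rintro ω ⟨ω', h', hf'⟩
      rw [Set.mem_preimage, ← h _ _ hf']
      exact h'
    rw [this]
    exact hf.measurableSet_preimage _

/-- A random subset of a finite set is discrete as soon as each membership event is measurable. -/
lemma filter {V : Type*} [Finite V] (S : Finset V) {p : Ω → V → Prop} [∀ ω, DecidablePred (p ω)]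
    (hp : ∀ v, MeasurableSet {ω | p ω v}) : DiscreteRV fun ω => {v ∈ S | p ω v} :=
  (pi (f := fun v ω => p ω v) fun v => prop_iff.2 (hp v)).of_factorsThrough fun _ _ h =>
    Finset.filter_congr fun v _ => iff_of_eq (congrFun h v)

end DiscreteRV

/-! ### Closed form of the primal-dual iterations -/

section Growth

variable {V : Type*} {ε : ℝ} {F F' : ℕ → Finset V}

/-- The factor by which the scheme multiplies an edge weight before iteration `t` because `u` stays
active, for the sets `F s` of vertices frozen before iteration `s`: a factor `1 / (1 - ε)` for every
iteration that `u` survives. -/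
noncomputable def growth (ε : ℝ) (F : ℕ → Finset V) : ℕ → V → ℝ
  | 0, _ => 1
  | t + 1, u => if u ∈ F (t + 1) then growth ε F t u else growth ε F t u * (1 - ε)⁻¹

lemma one_le_inv_one_sub (h0 : 0 ≤ ε) (h1 : ε < 1) : 1 ≤ (1 - ε)⁻¹ :=
  (one_le_inv₀ (by linarith)).2 (by linarith)

lemma growth_pos (h1 : ε < 1) (t : ℕ) (u : V) : 0 < growth ε F t u := by
  induction t with
  | zero => exact one_pos
  | succ t ih =>
    rw [growth]
    split_ifs
    · exact ih
    · exact mul_pos ih (inv_pos.2 (by linarith))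

lemma growth_le_succ (h0 : 0 ≤ ε) (h1 : ε < 1) (t : ℕ) (u : V) :
    growth ε F t u ≤ growth ε F (t + 1) u := by
  rw [growth]
  split_ifs
  · exact le_rfl
  · exact le_mul_of_one_le_right (growth_pos h1 t u).le (one_le_inv_one_sub h0 h1)

lemma growth_monotone (h0 : 0 ≤ ε) (h1 : ε < 1) (u : V) : Monotone fun t => growth ε F t u :=
  monotone_nat_of_le_succ fun t => growth_le_succ h0 h1 t u

lemma growth_succ_le (h0 : 0 ≤ ε) (h1 : ε < 1) (t : ℕ) (u : V) :
    growth ε F (t + 1) u ≤ growth ε F t u * (1 - ε)⁻¹ := by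
  rw [growth]
  split_ifs
  · exact le_mul_of_one_le_right (growth_pos h1 t u).le (one_le_inv_one_sub h0 h1)
  · exact le_rfl

lemma growth_le_pow (h0 : 0 ≤ ε) (h1 : ε < 1) (t : ℕ) (u : V) :
    growth ε F t u ≤ (1 - ε)⁻¹ ^ t := by
  induction t with
  | zero => simp [growth]
  | succ t ih =>
    rw [pow_succ]
    exact (growth_succ_le h0 h1 t u).trans
      (mul_le_mul_of_nonneg_right ih (inv_nonneg.2 (by linarith)))

lemma growth_of_notMem (hF : Monotone F) {t : ℕ} {u : V} (hu : u ∉ F t) :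
    growth ε F t u = (1 - ε)⁻¹ ^ t := by
  induction t with
  | zero => simp [growth]
  | succ t ih =>
    rw [growth, if_neg hu, ih fun h => hu (hF (Nat.le_succ t) h), pow_succ]

lemma growth_of_mem (hF : Monotone F) {s t : ℕ} (hst : s ≤ t) {u : V} (hu : u ∈ F (s + 1)) :
    growth ε F t u = growth ε F s u := by
  induction t, hst using Nat.le_induction with
  | base => rfl
  | succ t hst ih => rw [growth, if_pos (hF (by omega) hu), ih]

lemma growth_le_growth (h0 : 0 ≤ ε) (h1 : ε < 1) {t : ℕ} {u : V}
    (h : ∀ s ≤ t, u ∈ F s → u ∈ F' s) : growth ε F' t u ≤ growth ε F t u := by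
  induction t with
  | zero => exact le_rfl
  | succ t ih =>
    have ih' := ih fun s hs => h s (by omega)
    by_cases hu : u ∈ F (t + 1)
    · rw [growth, growth, if_pos hu, if_pos (h _ le_rfl hu)]
      exact ih'
    · rw [growth.eq_2 ε F, if_neg hu]
      exact (growth_succ_le h0 h1 t u).trans
        (mul_le_mul_of_nonneg_right ih' (inv_nonneg.2 (by linarith)))

/-- Two freezing histories give the same growth unless the vertex is at some time frozen by exactly
one of them, here by the faster one `F'`. -/
lemma exists_of_growth_ne (hF : Monotone F) (hF' : Monotone F') (t : ℕ) {u : V}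
    (h : ∀ s ≤ t, u ∈ F s → u ∈ F' s) (hne : growth ε F' t u ≠ growth ε F t u) (h' : u ∉ F' 0) :
    ∃ s < t, u ∉ F' s ∧ u ∈ F' (s + 1) ∧ u ∉ F (s + 1) ∧
      growth ε F' t u = (1 - ε)⁻¹ ^ s := by
  by_cases hu : u ∈ F' t
  · obtain ⟨s, hs, hs'⟩ : ∃ s < t, u ∉ F' s ∧ u ∈ F' (s + 1) := by
      by_contra! hcon
      have : ∀ s ≤ t, u ∉ F' s := by
        intro s
        induction s with
        | zero => exact fun _ => h'
        | succ s ih => exact fun hs => hcon s (by omega) (ih (by omega))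
      exact this t le_rfl hu
    have hg : growth ε F' t u = (1 - ε)⁻¹ ^ s := by
      rw [growth_of_mem hF' hs.le hs'.2, growth_of_notMem hF' hs'.1]
    refine ⟨s, hs, hs'.1, hs'.2, fun hF1 => hne ?_, hg⟩
    rw [hg, growth_of_mem hF hs.le hF1, growth_of_notMem hF fun h2 => hs'.1 (h s hs.le h2)]
  · exact absurd ((growth_of_notMem hF' hu).trans
      (growth_of_notMem hF fun h2 => hu (h t le_rfl h2)).symm) hne

end Growth

section PrimalDual

variable {V : Type*} {G : SimpleGraph V} {S : Finset V} {ε : ℝ} {x₀ : Sym2 V → ℝ}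
  {crit : ℕ → (Sym2 V → ℝ) → V → Prop}

lemma mem_nbrs {u v : V} : u ∈ nbrs G S v ↔ u ∈ S ∧ G.Adj v u := by
  simp [nbrs]

lemma touches_mk {F : Finset V} {u v : V} : Touches F s(u, v) ↔ u ∈ F ∨ v ∈ F := by
  constructor
  · rintro ⟨a, ha, h⟩
    rcases Sym2.mem_iff.1 h with rfl | rfl
    exacts [.inl ha, .inr ha]
  · rintro (h | h)
    exacts [⟨u, h, by simp⟩, ⟨v, h, by simp⟩]

lemma inside_mk {F : Finset V} {u v : V} : Inside F s(u, v) ↔ u ∈ F ∧ v ∈ F := by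
  simp [Inside]

lemma primalDual_frozen_succ (t : ℕ) :
    (primalDual S ε x₀ crit (t + 1)).frozen = (primalDual S ε x₀ crit t).frozen ∪
      {v ∈ S | v ∉ (primalDual S ε x₀ crit t).frozen ∧ crit t (primalDual S ε x₀ crit t).x v} :=
  rfl

lemma primalDual_x_succ (t : ℕ) (e : Sym2 V) :
    (primalDual S ε x₀ crit (t + 1)).x e =
      if Touches (primalDual S ε x₀ crit (t + 1)).frozen e then (primalDual S ε x₀ crit t).x e
      else (primalDual S ε x₀ crit t).x e / (1 - ε) :=
  rfl

lemma primalDual_frozen_monotone : Monotone fun t => (primalDual S ε x₀ crit t).frozen :=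
  monotone_nat_of_le_succ fun _ => Finset.subset_union_left

lemma primalDual_frozen_subset (t : ℕ) : (primalDual S ε x₀ crit t).frozen ⊆ S := by
  induction t with
  | zero => exact Finset.empty_subset _
  | succ t ih => exact Finset.union_subset ih (Finset.filter_subset _ _)

lemma primalDual_x_mk (h0 : 0 ≤ ε) (h1 : ε < 1) (t : ℕ) (u v : V) :
    (primalDual S ε x₀ crit t).x s(u, v) = x₀ s(u, v) *
      min (growth ε (fun t => (primalDual S ε x₀ crit t).frozen) t u)
        (growth ε (fun t => (primalDual S ε x₀ crit t).frozen) t v) := by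
  set F : ℕ → Finset V := fun t => (primalDual S ε x₀ crit t).frozen with hFdef
  have hF : Monotone F := primalDual_frozen_monotone
  induction t with
  | zero => simp [primalDual, growth]
  | succ t ih =>
    rw [primalDual_x_succ, ih, touches_mk]
    rw [show (primalDual S ε x₀ crit (t + 1)).frozen = F (t + 1) from rfl]
    have hmem : ∀ a ∉ F (t + 1), growth ε F t a = (1 - ε)⁻¹ ^ t := fun a ha =>
      growth_of_notMem hF fun h => ha (hF (Nat.le_succ t) h)
    have hle : ∀ a, growth ε F t a ≤ (1 - ε)⁻¹ ^ t := growth_le_pow h0 h1 t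
    have hpow : (1 - ε)⁻¹ ^ t ≤ (1 - ε)⁻¹ ^ t * (1 - ε)⁻¹ :=
      le_mul_of_one_le_right (pow_nonneg (inv_nonneg.2 (by linarith)) _) (one_le_inv_one_sub h0 h1)
    by_cases hu : u ∈ F (t + 1) <;> by_cases hv : v ∈ F (t + 1)
    · simp [growth, hu, hv]
    · simp only [growth, hu, hv, hmem v hv, true_or, if_true, if_false]
      rw [min_eq_left (hle u), min_eq_left ((hle u).trans hpow)]
    · simp only [growth, hu, hv, hmem u hu, or_true, if_true, if_false]
      rw [min_eq_right (hle v), min_eq_right ((hle v).trans hpow)]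
    · simp only [growth, hu, hv, hmem u hu, hmem v hv, or_self, if_false, min_self]
      rw [div_eq_mul_inv, mul_assoc]

lemma load_primalDual_of_notMem (h0 : 0 ≤ ε) (h1 : ε < 1) (S' : Finset V) {t : ℕ} {v : V}
    (hv : v ∉ (primalDual S ε x₀ crit t).frozen) :
    load G S' (primalDual S ε x₀ crit t).x v = ∑ u ∈ nbrs G S' v,
      x₀ s(v, u) * growth ε (fun t => (primalDual S ε x₀ crit t).frozen) t u := by
  refine Finset.sum_congr rfl fun u _ => ?_
  rw [primalDual_x_mk h0 h1, growth_of_notMem (u := v) primalDual_frozen_monotone hv,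
    min_eq_right (growth_le_pow h0 h1 t u)]

lemma primalDual_x_nonneg (h1 : ε < 1) (t : ℕ) {e : Sym2 V} (he : 0 ≤ x₀ e) :
    0 ≤ (primalDual S ε x₀ crit t).x e := by
  induction t with
  | zero => exact he
  | succ t ih =>
    rw [primalDual_x_succ]
    split_ifs
    · exact ih
    · exact div_nonneg ih (by linarith)

lemma load_primalDual_succ_of_mem {t : ℕ} {v : V} (S' : Finset V)
    (hv : v ∈ (primalDual S ε x₀ crit (t + 1)).frozen) :
    load G S' (primalDual S ε x₀ crit (t + 1)).x v = load G S' (primalDual S ε x₀ crit t).x v :=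
  Finset.sum_congr rfl fun u _ => by rw [primalDual_x_succ, if_pos (touches_mk.2 (.inl hv))]

lemma load_primalDual_succ_le (h0 : 0 ≤ ε) (h1 : ε < 1) {t : ℕ} {v : V} (S' : Finset V)
    (hx : ∀ u ∈ nbrs G S' v, 0 ≤ x₀ s(v, u)) :
    load G S' (primalDual S ε x₀ crit (t + 1)).x v ≤
      load G S' (primalDual S ε x₀ crit t).x v / (1 - ε) := by
  rw [load, load, Finset.sum_div]
  refine Finset.sum_le_sum fun u hu => ?_
  have hnn := primalDual_x_nonneg (S := S) (crit := crit) h1 t (hx u hu)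
  rw [primalDual_x_succ]
  split_ifs
  · exact le_div_self hnn (by linarith) (by linarith)
  · exact le_rfl

end PrimalDual

/-! ### The centralized algorithm -/

section Central

variable {V : Type*} {G : SimpleGraph V} {S : Finset V} {W : V → ℝ} {ε : ℝ}
  {x₀ : Sym2 V → ℝ} {T : V → ℕ → ℝ}

/-- The centralized algorithm maintains a fractional matching: an active vertex has load less than
`(1 - 2ε) W v`, so that dividing by `1 - ε` does not violate the constraint. -/
lemma load_centralRun_le (h0 : 0 < ε) (h1 : ε < 1) (hT : ValidThresholds ε T)
    (hx : ∀ v ∈ S, ∀ u ∈ nbrs G S v, 0 ≤ x₀ s(v, u)) (hW : ∀ v ∈ S, 0 ≤ W v)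
    (hl : ∀ v ∈ S, load G S x₀ v ≤ W v) (t : ℕ) {v : V} (hv : v ∈ S) :
    load G S (centralRun G S W ε x₀ T t).x v ≤ W v := by
  induction t with
  | zero => exact hl v hv
  | succ t ih =>
    by_cases hm : v ∈ (centralRun G S W ε x₀ T (t + 1)).frozen
    · exact (load_primalDual_succ_of_mem S hm).trans_le ih
    · refine (load_primalDual_succ_le h0.le h1 S (hx v hv)).trans ?_
      rw [div_le_iff₀ (by linarith)]
      have hlt : load G S (centralRun G S W ε x₀ T t).x v < T v t * W v := by
        by_contra! hcon
        apply hm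
        rw [centralRun, primalDual_frozen_succ]
        by_cases hm' : v ∈ (centralRun G S W ε x₀ T t).frozen
        · exact Finset.mem_union_left _ hm'
        · exact Finset.mem_union_right _ (Finset.mem_filter.2 ⟨hv, hm', hcon⟩)
      have hTv := mul_le_mul_of_nonneg_right (hT v t).2 (hW v hv)
      have := mul_nonneg h0.le (hW v hv)
      refine hlt.le.trans (hTv.trans ?_)
      nlinarith

lemma le_load_centralRun (hT : ValidThresholds ε T) (hW : ∀ v ∈ S, 0 ≤ W v) (t : ℕ) {v : V}
    (hv : v ∈ (centralRun G S W ε x₀ T t).frozen) :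
    (1 - 4 * ε) * W v ≤ load G S (centralRun G S W ε x₀ T t).x v := by
  induction t with
  | zero => exact absurd hv (Finset.notMem_empty v)
  | succ t ih =>
    refine le_of_le_of_eq ?_ (load_primalDual_succ_of_mem S hv).symm
    rw [centralRun, primalDual_frozen_succ] at hv
    rcases Finset.mem_union.1 hv with h | h
    · exact ih h
    · obtain ⟨hS, -, hc⟩ := Finset.mem_filter.1 h
      exact (mul_le_mul_of_nonneg_right (hT v t).1 (hW v hS)).trans hc

variable [Finite V] in
/-- The centralized algorithm terminates, since the weight of an active edge grows
geometrically but is bounded. -/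
lemma exists_centralReturns (h0 : 0 < ε) (h1 : ε < 1) (hT : ValidThresholds ε T)
    (hW : ∀ v ∈ S, 0 ≤ W v) (hx : ValidInit G S W x₀) :
    ∃ C, CentralReturns G S W ε x₀ T C := by
  have hex : ∃ N, ¬ HasActiveEdge G S (centralRun G S W ε x₀ T N).frozen := by
    have hev : ∀ᶠ t : ℕ in Filter.atTop, ∀ p : V × V, p.1 ∈ S → p.2 ∈ S → G.Adj p.1 p.2 →
        W p.1 < x₀ s(p.1, p.2) * (1 - ε)⁻¹ ^ t := by
      refine Filter.eventually_all.2 fun p => ?_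
      by_cases hp : p.1 ∈ S ∧ p.2 ∈ S ∧ G.Adj p.1 p.2
      · have htop := Filter.Tendsto.const_mul_atTop (hx.1 _ hp.1 _ hp.2.1 hp.2.2)
          (tendsto_pow_atTop_atTop_of_one_lt
            ((one_lt_inv₀ (by linarith)).2 (by linarith : 1 - ε < 1)))
        filter_upwards [htop.eventually_gt_atTop (W p.1)] with t ht _ _ _ using ht
      · exact Filter.Eventually.of_forall fun t a b c => absurd ⟨a, b, c⟩ hp
    obtain ⟨N, hN⟩ := hev.exists
    refine ⟨N, ?_⟩
    rintro ⟨u, hu, v, hv, huv, huF, hvF⟩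
    have hpos : ∀ v ∈ S, ∀ u ∈ nbrs G S v, 0 ≤ x₀ s(v, u) := fun v hv u hu =>
      (hx.1 v hv u (mem_nbrs.1 hu).1 (mem_nbrs.1 hu).2).le
    have hle := load_centralRun_le h0 h1 hT hpos hW hx.2 N hu
    rw [centralRun, load_primalDual_of_notMem h0.le h1 S huF] at hle
    have hsingle := Finset.single_le_sum
      (f := fun a => x₀ s(u, a) *
        growth ε (fun t => (centralRun G S W ε x₀ T t).frozen) N a)
      (fun a ha => mul_nonneg (hpos u hu a ha) (growth_pos h1 N a).le) (mem_nbrs.2 ⟨hv, huv⟩)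
    simp only [growth_of_notMem
      (F := fun t => (centralRun G S W ε x₀ T t).frozen) primalDual_frozen_monotone hvF] at hsingle
    exact absurd (hN (u, v) hu hv huv) (not_lt.2 (hsingle.trans hle))
  refine ⟨_, Nat.find hex, fun t ht => ?_, Nat.find_spec hex, rfl⟩
  by_contra h
  exact Nat.find_min hex ht h

end Central

/-! ### Coupling the parallel simulation with the centralized algorithm -/

section Coupling

variable {V : Type*} {G : SimpleGraph V} {S : Finset V} {W : V → ℝ} {ε δ : ℝ} {x₀ : Sym2 V → ℝ}
  {T : V → ℕ → ℝ} {m : ℕ} {p : V → Fin m} {I : ℕ} {C M : ℕ → Finset V}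

/-- The load that the edges from `N` put on `v` at the start of iteration `t`, if `v` is still
active then, for the freezing history `F`. -/
noncomputable def openLoad (x₀ : Sym2 V → ℝ) (ε : ℝ) (F : ℕ → Finset V) (N : Finset V) (t : ℕ)
    (v : V) : ℝ :=
  ∑ u ∈ N, x₀ s(v, u) * growth ε F t u

/-- The neighbours of `v` that are assigned to machine `i`. -/
noncomputable def nbrsOn (G : SimpleGraph V) (S : Finset V) (p : V → Fin m) (i : Fin m) (v : V) :
    Finset V :=
  {u ∈ nbrs G S v | p u = i}

/-- The vertices whose threshold in iteration `t` lies so close above the true load that a machine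
may freeze them although the centralized algorithm does not. -/
noncomputable def risky (G : SimpleGraph V) (S : Finset V) (W : V → ℝ) (ε δ : ℝ) (x₀ : Sym2 V → ℝ)
    (T : V → ℕ → ℝ) (C : ℕ → Finset V) (t : ℕ) : Finset V :=
  {u ∈ S | u ∉ C t ∧ openLoad x₀ ε C (nbrs G S u) t u < T u t * W u ∧
    T u t * W u ≤ openLoad x₀ ε C (nbrs G S u) t u + 4 * δ * 15 ^ t * W u}

/-- If `v` is active in iteration `t`, machine `i` holds a representative sample of its
neighbourhood, with respect to the edge weights of the centralized algorithm. Asking this of all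
machines, and not only of that of `v`, avoids conditioning on the position of `v`. -/
def SamplesWell (G : SimpleGraph V) (S : Finset V) (W : V → ℝ) (ε δ : ℝ) (x₀ : Sym2 V → ℝ)
    (C : ℕ → Finset V) (p : V → Fin m) (v : V) (i : Fin m) (t : ℕ) : Prop :=
  v ∉ C t → |m * openLoad x₀ ε C (nbrsOn G S p i v) t v - openLoad x₀ ε C (nbrs G S v) t v| ≤
    δ * W v

/-- If `v` is active in iteration `t`, it has little weight towards the risky vertices on machine
`i`. -/
def FewRisky (G : SimpleGraph V) (S : Finset V) (W : V → ℝ) (ε δ : ℝ) (x₀ : Sym2 V → ℝ)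
    (T : V → ℕ → ℝ) (C : ℕ → Finset V) (p : V → Fin m) (v : V) (i : Fin m) (t : ℕ) : Prop :=
  v ∉ C t → m * ∑ u ∈ nbrsOn G S p i v with u ∈ risky G S W ε δ x₀ T C t,
    x₀ s(v, u) * (1 - ε)⁻¹ ^ t ≤ 8 / ε * δ * 15 ^ t * W v

/-- Errors accumulate by a factor less than `15` per iteration. -/
lemma sum_pow_sub_one_mul_le (h0 : 0 ≤ ε) (h1 : ε ≤ 1 / 16) (t : ℕ) :
    ∑ s ∈ Finset.range t, ((1 - ε)⁻¹ ^ (t - s) - 1) * 15 ^ s ≤ ε * 15 ^ t / 8 := by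
  have hα : (1 - ε)⁻¹ ≤ 16 / 15 := by
    rw [inv_le_comm₀ (by linarith) (by norm_num)]
    linarith
  have hα' : (1 - ε)⁻¹ - 1 ≤ 16 / 15 * ε := by
    have : (1 - ε)⁻¹ - 1 = (1 - ε)⁻¹ * ε := by
      linear_combination inv_mul_cancel₀ (show (1 - ε) ≠ 0 by linarith)
    rw [this]
    exact mul_le_mul_of_nonneg_right hα h0
  have hα1 : 1 ≤ (1 - ε)⁻¹ := one_le_inv_one_sub h0 (by linarith)
  have hgeom : ∀ t : ℕ, ∑ s ∈ Finset.range t, (15 : ℝ) ^ s ≤ 15 ^ t / 14 := by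
    intro t
    rw [geom_sum_eq (by norm_num)]
    linarith [show (0 : ℝ) ≤ 15 ^ t by positivity]
  induction t with
  | zero => simp; positivity
  | succ t ih =>
    set α := (1 - ε)⁻¹
    have hrec : ∑ s ∈ Finset.range (t + 1), (α ^ (t + 1 - s) - 1) * (15 : ℝ) ^ s =
        α * ∑ s ∈ Finset.range t, (α ^ (t - s) - 1) * (15 : ℝ) ^ s +
          (α - 1) * ∑ s ∈ Finset.range (t + 1), (15 : ℝ) ^ s := by
      have : ∑ s ∈ Finset.range t, (α ^ (t - s) - 1) * (15 : ℝ) ^ s =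
          ∑ s ∈ Finset.range (t + 1), (α ^ (t - s) - 1) * (15 : ℝ) ^ s := by
        rw [Finset.sum_range_succ]
        simp
      rw [this, Finset.mul_sum, Finset.mul_sum, ← Finset.sum_add_distrib]
      refine Finset.sum_congr rfl fun s hs => ?_
      rw [Nat.succ_sub (Nat.lt_succ_iff.1 (Finset.mem_range.1 hs)), pow_succ]
      ring
    rw [hrec]
    have hP : (0 : ℝ) ≤ 15 ^ t := by positivity
    have e1 : α * ∑ s ∈ Finset.range t, (α ^ (t - s) - 1) * (15 : ℝ) ^ s ≤
        16 / 15 * (ε * 15 ^ t / 8) :=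
      (mul_le_mul_of_nonneg_left ih (by linarith)).trans
        (mul_le_mul_of_nonneg_right hα (by positivity))
    have e2 : (α - 1) * ∑ s ∈ Finset.range (t + 1), (15 : ℝ) ^ s ≤
        16 / 15 * ε * (15 ^ (t + 1) / 14) :=
      (mul_le_mul_of_nonneg_left (hgeom _) (by linarith)).trans
        (mul_le_mul_of_nonneg_right hα' (by positivity))
    have hεP := mul_nonneg h0 hP
    rw [pow_succ] at e2 ⊢
    nlinarith

/-- The edge weights of the two runs differ only at vertices that were frozen early by a machine,
each of which then was risky. -/
lemma growth_sub_growth_le (h0 : 0 ≤ ε) (h1 : ε < 1) (hC : Monotone C) (hM : Monotone M)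
    (hM0 : M 0 = ∅) {B : ℕ → Finset V} {t : ℕ} (hCM : ∀ s ≤ t, C s ⊆ M s)
    (hB : ∀ s < t, ∀ u, u ∉ M s → u ∈ M (s + 1) → u ∉ C (s + 1) → u ∈ B s) (u : V) :
    growth ε C t u - growth ε M t u ≤ ∑ s ∈ Finset.range t,
      ((1 - ε)⁻¹ ^ (t - s) - 1) * (if u ∈ B s then (1 - ε)⁻¹ ^ s else 0) := by
  have hα1 : 1 ≤ (1 - ε)⁻¹ := one_le_inv_one_sub h0 h1
  have hnn : ∀ s ∈ Finset.range t,
      0 ≤ ((1 - ε)⁻¹ ^ (t - s) - 1) * (if u ∈ B s then (1 - ε)⁻¹ ^ s else 0) := by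
    intro s _
    refine mul_nonneg (sub_nonneg.2 (one_le_pow₀ hα1)) ?_
    split_ifs
    · exact pow_nonneg (by linarith) _
    · exact le_rfl
  by_cases hne : growth ε M t u = growth ε C t u
  · rw [hne, sub_self]
    exact Finset.sum_nonneg hnn
  · obtain ⟨s, hs, hs1, hs2, hs3, hg⟩ := exists_of_growth_ne hC hM t
      (fun s hs => @hCM s hs u) hne (by simp [hM0])
    refine le_trans ?_ (Finset.single_le_sum hnn (Finset.mem_range.2 hs))
    rw [if_pos (hB s hs u hs1 hs2 hs3), hg, sub_mul, one_mul, ← pow_add,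
      Nat.sub_add_cancel hs.le]
    exact sub_le_sub_right (growth_le_pow h0 h1 t u) _

/-- Hypotheses on one phase under which the machines follow the centralized algorithm: `C` and `M`
are the freezing histories of the centralized algorithm and of the machines. -/
structure CoupledRuns (G : SimpleGraph V) (S : Finset V) (W : V → ℝ) (ε δ : ℝ) (x₀ : Sym2 V → ℝ)
    (T : V → ℕ → ℝ) (p : V → Fin m) (I : ℕ) (C M : ℕ → Finset V) : Prop where
  pos : 0 < ε
  le : ε ≤ 1 / 16
  delta_nonneg : 0 ≤ δ
  monotone_central : Monotone C
  monotone_machine : Monotone M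
  central_zero : C 0 = ∅
  machine_zero : M 0 = ∅
  central_subset : ∀ t, C t ⊆ S
  machine_subset : ∀ t, M t ⊆ S
  central_succ : ∀ t, ∀ v ∈ S, v ∉ C t →
    (v ∈ C (t + 1) ↔ T v t * W v ≤ openLoad x₀ ε C (nbrs G S v) t v)
  machine_succ : ∀ t, ∀ v ∈ S, v ∉ M t →
    (v ∈ M (t + 1) ↔ T v t * W v ≤
      2 * δ * 15 ^ t * W v + m * openLoad x₀ ε M (nbrsOn G S p (p v) v) t v)
  weight_nonneg : ∀ v ∈ S, 0 ≤ W v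
  init_nonneg : ∀ v ∈ S, ∀ u ∈ nbrs G S v, 0 ≤ x₀ s(v, u)
  samplesWell : ∀ t < I, ∀ v ∈ S, ∀ i, SamplesWell G S W ε δ x₀ C p v i t
  fewRisky : ∀ t < I, ∀ v ∈ S, ∀ i, FewRisky G S W ε δ x₀ T C p v i t

namespace CoupledRuns

variable (h : CoupledRuns G S W ε δ x₀ T p I C M)
include h

lemma lt_one : ε < 1 := by linarith [h.le]

/-- The load that machine `i` sees differs little from that given by the edge weights of the
centralized run on the same sample: a vertex that was risky in iteration `s` causes a relative error
of at most `(1 - ε) ^ (s - t) - 1` in iteration `t`. -/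
lemma local_error_le {t : ℕ} (ht : t ≤ I) (hCM : ∀ s ≤ t, C s ⊆ M s)
    (hB : ∀ s < t, ∀ u, u ∉ M s → u ∈ M (s + 1) → u ∉ C (s + 1) →
      u ∈ risky G S W ε δ x₀ T C s) {v : V} (hv : v ∈ S) (hvC : v ∉ C t) (i : Fin m) :
    m * openLoad x₀ ε C (nbrsOn G S p i v) t v - m * openLoad x₀ ε M (nbrsOn G S p i v) t v ≤
      δ * 15 ^ t * W v := by
  have hα1 : 1 ≤ (1 - ε)⁻¹ := one_le_inv_one_sub h.pos.le h.lt_one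
  calc m * openLoad x₀ ε C (nbrsOn G S p i v) t v - m * openLoad x₀ ε M (nbrsOn G S p i v) t v
      = m * ∑ u ∈ nbrsOn G S p i v, x₀ s(v, u) * (growth ε C t u - growth ε M t u) := by
        simp only [openLoad, mul_sub, Finset.sum_sub_distrib]
    _ ≤ m * ∑ u ∈ nbrsOn G S p i v, x₀ s(v, u) * ∑ s ∈ Finset.range t,
          ((1 - ε)⁻¹ ^ (t - s) - 1) *
            (if u ∈ risky G S W ε δ x₀ T C s then (1 - ε)⁻¹ ^ s else 0) := by
        refine mul_le_mul_of_nonneg_left (Finset.sum_le_sum fun u hu => ?_) (Nat.cast_nonneg m)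
        exact mul_le_mul_of_nonneg_left (growth_sub_growth_le h.pos.le h.lt_one h.monotone_central
          h.monotone_machine h.machine_zero hCM hB u)
          (h.init_nonneg v hv u (Finset.mem_filter.1 hu).1)
    _ = ∑ s ∈ Finset.range t, ((1 - ε)⁻¹ ^ (t - s) - 1) *
          (m * ∑ u ∈ nbrsOn G S p i v with u ∈ risky G S W ε δ x₀ T C s,
            x₀ s(v, u) * (1 - ε)⁻¹ ^ s) := by
        simp only [Finset.mul_sum, Finset.sum_filter]
        rw [Finset.sum_comm]
        refine Finset.sum_congr rfl fun s _ => Finset.sum_congr rfl fun u _ => ?_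
        split_ifs <;> ring
    _ ≤ ∑ s ∈ Finset.range t, ((1 - ε)⁻¹ ^ (t - s) - 1) * (8 / ε * δ * 15 ^ s * W v) := by
        refine Finset.sum_le_sum fun s hs => mul_le_mul_of_nonneg_left ?_
          (sub_nonneg.2 (one_le_pow₀ hα1))
        have hs' := Finset.mem_range.1 hs
        exact h.fewRisky s (hs'.trans_le ht) v hv i
          fun hm => hvC (h.monotone_central hs'.le hm)
    _ = 8 / ε * δ * W v * ∑ s ∈ Finset.range t, ((1 - ε)⁻¹ ^ (t - s) - 1) * 15 ^ s := by
        rw [Finset.mul_sum]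
        exact Finset.sum_congr rfl fun s _ => by ring
    _ ≤ 8 / ε * δ * W v * (ε * 15 ^ t / 8) := by
        have := h.pos
        have := h.delta_nonneg
        have := h.weight_nonneg v hv
        exact mul_le_mul_of_nonneg_left (sum_pow_sub_one_mul_le h.pos.le h.le t) (by positivity)
    _ = δ * 15 ^ t * W v := by
        have := h.pos.ne'
        field_simp

lemma openLoad_machine_le {t : ℕ} (hCM : ∀ s ≤ t, C s ⊆ M s) {v : V} (hv : v ∈ S) {N : Finset V}
    (hN : N ⊆ nbrs G S v) : openLoad x₀ ε M N t v ≤ openLoad x₀ ε C N t v :=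
  Finset.sum_le_sum fun u hu => mul_le_mul_of_nonneg_left
    (growth_le_growth h.pos.le h.lt_one fun s hs => @hCM s hs u) (h.init_nonneg v hv u (hN hu))

/-- The estimate of a machine lies above the load in the centralized run, but not far above. -/
lemma estimate_mem_Icc {t : ℕ} (ht : t < I) (hCM : ∀ s ≤ t, C s ⊆ M s)
    (hB : ∀ s < t, ∀ u, u ∉ M s → u ∈ M (s + 1) → u ∉ C (s + 1) →
      u ∈ risky G S W ε δ x₀ T C s) {v : V} (hv : v ∈ S) (hvC : v ∉ C t) (i : Fin m) :
    2 * δ * 15 ^ t * W v + m * openLoad x₀ ε M (nbrsOn G S p i v) t v ∈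
      Set.Icc (openLoad x₀ ε C (nbrs G S v) t v)
        (openLoad x₀ ε C (nbrs G S v) t v + 4 * δ * 15 ^ t * W v) := by
  have e1 := h.local_error_le ht.le hCM hB hv hvC i
  have e2 := abs_le.1 (h.samplesWell t ht v hv i hvC)
  have e3 := mul_le_mul_of_nonneg_left (h.openLoad_machine_le hCM hv
    (N := nbrsOn G S p i v) (Finset.filter_subset _ _)) (Nat.cast_nonneg (α := ℝ) m)
  have e4 : δ * W v ≤ δ * 15 ^ t * W v := by
    refine mul_le_mul_of_nonneg_right ?_ (h.weight_nonneg v hv)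
    exact le_mul_of_one_le_right h.delta_nonneg (one_le_pow₀ (by norm_num))
  constructor <;> linarith [e2.1, e2.2]

/-- The machines never freeze a vertex later than the centralized algorithm, and the vertices
that they freeze earlier are risky. -/
lemma subset_and_risky {t : ℕ} (ht : t ≤ I) :
    (∀ s ≤ t, C s ⊆ M s) ∧ ∀ s < t, ∀ u, u ∉ M s → u ∈ M (s + 1) → u ∉ C (s + 1) →
      u ∈ risky G S W ε δ x₀ T C s := by
  induction t with
  | zero =>
    refine ⟨fun s hs v hv => ?_, fun s hs => absurd hs (Nat.not_lt_zero s)⟩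
    obtain rfl : s = 0 := by omega
    simp [h.central_zero] at hv
  | succ t ih =>
    obtain ⟨hCM, hB⟩ := ih (by omega)
    have hest := fun v hv hvC => h.estimate_mem_Icc (by omega) hCM hB (v := v) hv hvC (p v)
    constructor
    · intro s hs
      rcases hs.lt_or_eq with hs | rfl
      · exact hCM s (by omega)
      · intro v hv
        have hvS := h.central_subset _ hv
        by_contra hvM
        have hvM' : v ∉ M t := fun hm => hvM (h.monotone_machine (Nat.le_succ t) hm)
        have hvC : v ∉ C t := fun hm => hvM' (hCM t le_rfl hm)
        exact hvM ((h.machine_succ t v hvS hvM').2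
          (((h.central_succ t v hvS hvC).1 hv).trans (hest v hvS hvC).1))
    · intro s hs u hu1 hu2 hu3
      rcases (Nat.lt_succ_iff.1 hs).lt_or_eq with hs | rfl
      · exact hB s hs u hu1 hu2 hu3
      · have huS := h.machine_subset _ hu2
        have huC : u ∉ C s := fun hm => hu1 (hCM s le_rfl hm)
        refine Finset.mem_filter.2 ⟨huS, huC, ?_, ?_⟩
        · exact not_le.1 fun hle => hu3 ((h.central_succ s u huS huC).2 hle)
        · exact ((h.machine_succ s u huS hu1).1 hu2).trans (hest u huS huC).2

/-- The weights of the simulation are dominated by those of the centralized run. -/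
lemma sum_min_growth_le {v : V} (hv : v ∈ S) :
    ∑ u ∈ nbrs G S v, x₀ s(v, u) * min (growth ε M I v) (growth ε M I u) ≤
      ∑ u ∈ nbrs G S v, x₀ s(v, u) * min (growth ε C I v) (growth ε C I u) := by
  have hg : ∀ u, growth ε M I u ≤ growth ε C I u := fun u =>
    growth_le_growth h.pos.le h.lt_one fun s hs => @(h.subset_and_risky le_rfl).1 s hs u
  exact Finset.sum_le_sum fun u hu => mul_le_mul_of_nonneg_left (min_le_min (hg v) (hg u))
    (h.init_nonneg v hv u hu)

/-- A vertex frozen by its machine had a large estimate, hence a large load. -/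
lemma le_sum_min_growth (hT : ValidThresholds ε T) (hδ : 5 * δ * 15 ^ I ≤ ε) {v : V}
    (hv : v ∈ M I) :
    (1 - 5 * ε) * W v ≤
      ∑ u ∈ nbrs G S v, x₀ s(v, u) * min (growth ε M I v) (growth ε M I u) := by
  have hvS := h.machine_subset _ hv
  have hW := h.weight_nonneg v hvS
  obtain ⟨t, ht, hv1, hv2⟩ : ∃ t < I, v ∉ M t ∧ v ∈ M (t + 1) := by
    by_contra! hcon
    have : ∀ s ≤ I, v ∉ M s := by
      intro s
      induction s with
      | zero => simp [h.machine_zero]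
      | succ s ih => exact fun hs => hcon s (by omega) (ih (by omega))
    exact this I le_rfl hv
  obtain ⟨hCM, hB⟩ := h.subset_and_risky ht.le
  have hvC : v ∉ C t := fun hm => hv1 (hCM t le_rfl hm)
  have e1 := ((h.machine_succ t v hvS hv1).1 hv2).trans (h.estimate_mem_Icc ht hCM hB hvS hvC _).2
  have e2 := mul_le_mul_of_nonneg_right (hT v t).1 hW
  -- the local errors on the `m` machines add up to `m` times the global error
  have e3 : openLoad x₀ ε C (nbrs G S v) t v - openLoad x₀ ε M (nbrs G S v) t v ≤
      δ * 15 ^ t * W v := by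
    have hsplit : ∀ F : ℕ → Finset V,
        ∑ i : Fin m, openLoad x₀ ε F (nbrsOn G S p i v) t v = openLoad x₀ ε F (nbrs G S v) t v :=
      fun F => Finset.sum_fiberwise _ _ _
    have hsum := Finset.sum_le_sum fun (i : Fin m) (_ : i ∈ Finset.univ) =>
      h.local_error_le ht.le hCM hB hvS hvC i
    rw [Finset.sum_sub_distrib, ← Finset.mul_sum, ← Finset.mul_sum, hsplit, hsplit, ← mul_sub,
      Finset.sum_const, Finset.card_univ, Fintype.card_fin, nsmul_eq_mul] at hsum
    exact le_of_mul_le_mul_left hsum (Nat.cast_pos.2 (Fin.pos (p v)))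
  have e4 : openLoad x₀ ε M (nbrs G S v) t v ≤
      ∑ u ∈ nbrs G S v, x₀ s(v, u) * min (growth ε M I v) (growth ε M I u) := by
    refine Finset.sum_le_sum fun u hu => mul_le_mul_of_nonneg_left (le_min ?_ ?_)
      (h.init_nonneg v hvS u hu)
    · rw [growth_of_mem h.monotone_machine ht.le hv2, growth_of_notMem h.monotone_machine hv1]
      exact growth_le_pow h.pos.le h.lt_one t u
    · exact growth_monotone h.pos.le h.lt_one u ht.le
  have e5 : 5 * δ * 15 ^ t * W v ≤ ε * W v := by
    refine mul_le_mul_of_nonneg_right (le_trans ?_ hδ) hW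
    have := h.delta_nonneg
    exact mul_le_mul_of_nonneg_left (pow_le_pow_right₀ (by norm_num) ht.le) (by positivity)
  linarith

end CoupledRuns

end Coupling

/-! ### Concentration for random subsets -/

section RandomSubset

variable {V Y : Type*} [MeasurableSpace Y] {P : V → Measure Y} [∀ v, IsProbabilityMeasure (P v)]
  {A : V → Set Y} [∀ u y, Decidable (y ∈ A u)] {a : V → ℝ} {s : Finset V} {b t : ℝ}

omit [MeasurableSpace Y] in
lemma sum_filter_eq_sum_indicator (ω : V → Y) :
    ∑ u ∈ s with ω u ∈ A u, a u = ∑ u ∈ s, (A u).indicator (fun _ => a u) (ω u) := by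
  rw [Finset.sum_filter]
  refine Finset.sum_congr rfl fun u _ => ?_
  by_cases h : ω u ∈ A u <;> simp [h]

omit [∀ u y, Decidable (y ∈ A u)] in
lemma integral_indicator_eval (hA : ∀ u, MeasurableSet (A u)) (u : V) :
    ∫ ω, (A u).indicator (fun _ => a u) (ω u) ∂(Measure.infinitePi P) =
      a u * (P u).real (A u) := by
  have h := (measurePreserving_eval_infinitePi P u)
  rw [← integral_map (φ := fun ω : V → Y => ω u) (f := (A u).indicator fun _ => a u)
    h.measurable.aemeasurable
    ((measurable_const.indicator (hA u)).aestronglyMeasurable)]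
  rw [show (Measure.infinitePi P).map (fun ω : V → Y => ω u) = P u from h.map_eq,
    integral_indicator (hA u)]
  simp [mul_comm]

lemma measure_le_sum_filter_le (hA : ∀ u, MeasurableSet (A u)) (h0 : ∀ u ∈ s, 0 ≤ a u)
    (hb : ∀ u ∈ s, a u ≤ b) (hb0 : 0 ≤ b) (ht0 : 0 ≤ t) (ht : t * b ≤ 1) {M : ℝ}
    (hM : ∑ u ∈ s, a u * (P u).real (A u) ≤ M) (r : ℝ) :
    Measure.infinitePi P {ω | r ≤ ∑ u ∈ s with ω u ∈ A u, a u} ≤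
      ENNReal.ofReal (Real.exp (-t * r + (t + t ^ 2 * b) * M)) := by
  simp only [sum_filter_eq_sum_indicator]
  have hX : ∀ u, Measurable ((A u).indicator fun _ => a u) :=
    fun u => measurable_const.indicator (hA u)
  refine chernoff_upper (X := fun u (ω : V → Y) => (A u).indicator (fun _ => a u) (ω u))
    (iIndepFun_infinitePi hX) (fun u => (hX u).comp (measurable_pi_apply u)) ?_ ?_ hb0 ht0 ht ?_ r
  · exact fun u hu ω => Set.indicator_nonneg (fun _ _ => h0 u hu) _
  · exact fun u hu ω => (Set.indicator_le_self' (fun _ _ => h0 u hu) _).trans (hb u hu)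
  · simpa only [integral_indicator_eval hA] using hM

lemma measure_sum_filter_le_le (hA : ∀ u, MeasurableSet (A u)) (h0 : ∀ u ∈ s, 0 ≤ a u)
    (hb : ∀ u ∈ s, a u ≤ b) (ht0 : 0 ≤ t) (ht : t * b ≤ 1) (r : ℝ) :
    Measure.infinitePi P {ω | ∑ u ∈ s with ω u ∈ A u, a u ≤ r} ≤
      ENNReal.ofReal (Real.exp (t * r + (-t + t ^ 2 * b) *
        ∑ u ∈ s, a u * (P u).real (A u))) := by
  simp only [sum_filter_eq_sum_indicator, ← integral_indicator_eval hA]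
  have hX : ∀ u, Measurable ((A u).indicator fun _ => a u) :=
    fun u => measurable_const.indicator (hA u)
  refine chernoff_lower (X := fun u (ω : V → Y) => (A u).indicator (fun _ => a u) (ω u))
    (iIndepFun_infinitePi hX) (fun u => (hX u).comp (measurable_pi_apply u)) ?_ ?_ ht0 ht r
  · exact fun u hu ω => Set.indicator_nonneg (fun _ _ => h0 u hu) _
  · exact fun u hu ω => (Set.indicator_le_self' (fun _ _ => h0 u hu) _).trans (hb u hu)

end RandomSubset

/-! ### The random partition -/

section Partition

variable {V : Type*} {G : SimpleGraph V} {S : Finset V} {W : V → ℝ} {ε r : ℝ}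
  {x₀ : Sym2 V → ℝ} {m : ℕ+} {C : ℕ → Finset V}

/-- The law of a uniformly random assignment of the vertices to `m` machines. -/
noncomputable def partitionLaw (V : Type*) (m : ℕ+) : Measure (V → Fin m) :=
  Measure.infinitePi fun _ : V => uniformOn (Set.univ : Set (Fin m))

instance instIsProbabilityMeasureUniformOnFin (m : ℕ+) :
    IsProbabilityMeasure (uniformOn (Set.univ : Set (Fin m))) :=
  isProbabilityMeasure_uniformOn Set.finite_univ Set.univ_nonempty

lemma uniformOn_real_singleton (m : ℕ+) (i : Fin m) :
    (uniformOn (Set.univ : Set (Fin m))).real {i} = (m : ℝ)⁻¹ := by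
  simp [Measure.real, uniformOn_univ]

/-- For a fixed freezing history, a random part of a neighbourhood carries its fair share of the
load. Each edge carries at most a fraction `r ^ (-4) / m` of the total. -/
lemma partitionLaw_not_samplesWell_le (h0 : 0 ≤ ε) (h1 : ε < 1) (hr : 1 ≤ r) {v : V}
    (hW : 0 < W v) (hx : ∀ u ∈ nbrs G S v, 0 ≤ x₀ s(v, u)) (i : Fin m) (t : ℕ)
    (hxb : ∀ u ∈ nbrs G S v, m * (x₀ s(v, u) * (1 - ε)⁻¹ ^ t) ≤ W v / r ^ 4)
    (hl : openLoad x₀ ε C (nbrs G S v) t v ≤ W v) :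
    partitionLaw V m {p | ¬ SamplesWell G S W ε r⁻¹ x₀ C p v i t} ≤
      2 * ENNReal.ofReal (Real.exp (-(r ^ 2 / 4))) := by
  have hr0 : 0 < r := by linarith
  set a : V → ℝ := fun u => m * (x₀ s(v, u) * growth ε C t u) with ha
  have ha0 : ∀ u ∈ nbrs G S v, 0 ≤ a u := fun u hu =>
    mul_nonneg (Nat.cast_nonneg _) (mul_nonneg (hx u hu) (growth_pos h1 t u).le)
  have hab : ∀ u ∈ nbrs G S v, a u ≤ W v / r ^ 4 := fun u hu =>
    le_trans (mul_le_mul_of_nonneg_left (mul_le_mul_of_nonneg_left (growth_le_pow h0 h1 t u)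
      (hx u hu)) (Nat.cast_nonneg _)) (hxb u hu)
  set y := openLoad x₀ ε C (nbrs G S v) t v with hy
  have hm : (m : ℝ) ≠ 0 := Nat.cast_ne_zero.2 m.ne_zero
  have hmean : ∑ u ∈ nbrs G S v, a u * (uniformOn (Set.univ : Set (Fin m))).real {i} = y := by
    rw [hy, openLoad]
    refine Finset.sum_congr rfl fun u _ => ?_
    rw [uniformOn_real_singleton, ha]
    field_simp
  have hy0 : 0 ≤ y := Finset.sum_nonneg fun u hu =>
    mul_nonneg (hx u hu) (growth_pos h1 t u).le
  have hsum : ∀ p : V → Fin m, m * openLoad x₀ ε C (nbrsOn G S p i v) t v =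
      ∑ u ∈ nbrs G S v with p u ∈ ({i} : Set (Fin m)), a u := by
    intro p
    rw [openLoad, Finset.mul_sum]
    simp only [Set.mem_singleton_iff]
    rfl
  -- the minimizer of the exponent `-θ (W / r) + θ ^ 2 (W / r ^ 4) W`
  set θ : ℝ := r ^ 3 / (2 * W v) with hθ
  have hθ0 : 0 ≤ θ := by positivity
  have hθb : θ * (W v / r ^ 4) ≤ 1 := by
    rw [hθ, show r ^ 3 / (2 * W v) * (W v / r ^ 4) = 1 / (2 * r) by field_simp,
      div_le_one (by positivity)]
    linarith
  have hdev : -θ * (r⁻¹ * W v) + θ ^ 2 * (W v / r ^ 4) * W v = -(r ^ 2 / 4) := by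
    rw [hθ]
    field_simp
    ring
  have hquad : θ ^ 2 * (W v / r ^ 4) * y ≤ θ ^ 2 * (W v / r ^ 4) * W v :=
    mul_le_mul_of_nonneg_left hl (by positivity)
  have hup := measure_le_sum_filter_le (P := fun _ : V => uniformOn (Set.univ : Set (Fin m)))
    (A := fun _ => {i}) (fun _ => MeasurableSet.singleton i) ha0 hab (by positivity) hθ0 hθb
    hmean.le (y + r⁻¹ * W v)
  have hlo := measure_sum_filter_le_le (P := fun _ : V => uniformOn (Set.univ : Set (Fin m)))
    (A := fun _ => {i}) (fun _ => MeasurableSet.singleton i) ha0 hab hθ0 hθb (y - r⁻¹ * W v)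
  rw [hmean] at hlo
  have hsub : {p : V → Fin m | ¬ SamplesWell G S W ε r⁻¹ x₀ C p v i t} ⊆
      {p | y + r⁻¹ * W v ≤ ∑ u ∈ nbrs G S v with p u ∈ ({i} : Set (Fin m)), a u} ∪
      {p | ∑ u ∈ nbrs G S v with p u ∈ ({i} : Set (Fin m)), a u ≤ y - r⁻¹ * W v} := by
    intro p hp
    by_contra hcon
    simp only [Set.mem_union, Set.mem_ofPred_eq, not_or, not_le] at hcon
    refine hp fun _ => ?_
    rw [hsum p, abs_le]
    constructor <;> linarith [hcon.1, hcon.2]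
  refine (measure_mono hsub).trans ((measure_union_le _ _).trans ?_)
  rw [two_mul]
  refine add_le_add (hup.trans (ENNReal.ofReal_le_ofReal (Real.exp_le_exp.2 ?_)))
    (hlo.trans (ENNReal.ofReal_le_ofReal (Real.exp_le_exp.2 ?_))) <;> nlinarith

end Partition

/-! ### The random thresholds -/

section Thresholds

variable {V : Type*} {G : SimpleGraph V} {S : Finset V} {W : V → ℝ} {ε r : ℝ}
  {x₀ : Sym2 V → ℝ} {m : ℕ+}

/-- The law of a threshold. -/
noncomputable def thresholdLaw (ε : ℝ) : Measure ℝ :=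
  (volume : Measure ℝ)[|Set.Icc (1 - 4 * ε) (1 - 2 * ε)]

/-- The law of the thresholds of one phase. -/
noncomputable def thresholdsLaw (V : Type*) (ε : ℝ) : Measure (V → ℕ → ℝ) :=
  Measure.infinitePi fun _ : V => Measure.infinitePi fun _ : ℕ => thresholdLaw ε

lemma isProbabilityMeasure_thresholdLaw (hε : 0 < ε) :
    IsProbabilityMeasure (thresholdLaw ε) := by
  apply cond_isProbabilityMeasure_of_finite
  · rw [Real.volume_Icc, Ne, ENNReal.ofReal_eq_zero]; linarith
  · rw [Real.volume_Icc]; exact ENNReal.ofReal_ne_top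

lemma isProbabilityMeasure_thresholdsLaw (V : Type*) (hε : 0 < ε) :
    IsProbabilityMeasure (thresholdsLaw V ε) := by
  have := isProbabilityMeasure_thresholdLaw hε
  unfold thresholdsLaw
  infer_instance

/-- The uniform threshold has density `1 / (2ε)`. -/
lemma thresholdLaw_real_Ioc_le (hε : 0 < ε) (y : ℝ) {l : ℝ} (hl : 0 ≤ l) :
    (thresholdLaw ε).real (Set.Ioc y (y + l)) ≤ l / (2 * ε) := by
  rw [Measure.real, thresholdLaw, cond_apply measurableSet_Icc, Real.volume_Icc]
  have h1 : volume (Set.Icc (1 - 4 * ε) (1 - 2 * ε) ∩ Set.Ioc y (y + l)) ≤ ENNReal.ofReal l := by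
    refine (measure_mono Set.inter_subset_right).trans ?_
    rw [Real.volume_Ioc]
    simp
  rw [ENNReal.toReal_mul, ENNReal.toReal_inv,
    show 1 - 2 * ε - (1 - 4 * ε) = 2 * ε by ring, ENNReal.toReal_ofReal (by linarith),
    div_eq_inv_mul]
  exact mul_le_mul_of_nonneg_left (ENNReal.toReal_le_of_le_ofReal hl h1) (by positivity)

lemma thresholdsLaw_not_validThresholds [Finite V] (hε : 0 < ε) :
    thresholdsLaw V ε {T | ¬ ValidThresholds ε T} = 0 := by
  have := isProbabilityMeasure_thresholdLaw hε
  have hset : {T : V → ℕ → ℝ | ¬ ValidThresholds ε T} =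
      ⋃ v, ⋃ t, {T | T v t ∈ (Set.Icc (1 - 4 * ε) (1 - 2 * ε))ᶜ} := by
    ext T
    simp [ValidThresholds]
  rw [hset]
  refine measure_iUnion_null fun v => measure_iUnion_null fun t => ?_
  have hmp := (measurePreserving_eval_infinitePi (fun _ : ℕ => thresholdLaw ε) t).comp
    (measurePreserving_eval_infinitePi
      (fun _ : V => Measure.infinitePi fun _ : ℕ => thresholdLaw ε) v)
  have h := hmp.measure_preimage (measurableSet_Icc (a := 1 - 4 * ε)
    (b := 1 - 2 * ε)).compl.nullMeasurableSet
  refine Eq.trans ?_ (h.trans ?_)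
  · rfl
  · rw [thresholdLaw, cond_apply measurableSet_Icc]
    simp

/-- The freezing history of the centralized algorithm. -/
noncomputable def centralFrozen (G : SimpleGraph V) (S : Finset V) (W : V → ℝ) (ε : ℝ)
    (x₀ : Sym2 V → ℝ) (T : V → ℕ → ℝ) (t : ℕ) : Finset V :=
  (centralRun G S W ε x₀ T t).frozen

lemma centralFrozen_monotone (T : V → ℕ → ℝ) : Monotone (centralFrozen G S W ε x₀ T) :=
  primalDual_frozen_monotone

lemma centralRun_congr {T T' : V → ℕ → ℝ} {t : ℕ} (h : ∀ v, ∀ s < t, T v s = T' v s) :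
    centralRun G S W ε x₀ T t = centralRun G S W ε x₀ T' t := by
  induction t with
  | zero => rfl
  | succ t ih =>
    have ih' := ih fun v s hs => h v s (by omega)
    have hF : (centralRun G S W ε x₀ T (t + 1)).frozen =
        (centralRun G S W ε x₀ T' (t + 1)).frozen := by
      rw [centralRun, centralRun, primalDual_frozen_succ, primalDual_frozen_succ]
      rw [centralRun, centralRun] at ih'
      rw [ih']
      simp only [h _ t (Nat.lt_succ_self t)]
    rw [centralRun, centralRun] at *
    have hx : (primalDual S ε x₀ (fun t x v => T v t * W v ≤ load G S x v) (t + 1)).x =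
        (primalDual S ε x₀ (fun t x v => T' v t * W v ≤ load G S x v) (t + 1)).x := by
      funext e
      rw [primalDual_x_succ, primalDual_x_succ, hF, ih']
    exact congrArg₂ RunState.mk hF hx

lemma growth_congr {F F' : ℕ → Finset V} {t : ℕ} {u : V} (h : ∀ s ≤ t, (u ∈ F s ↔ u ∈ F' s)) :
    growth ε F t u = growth ε F' t u := by
  induction t with
  | zero => rfl
  | succ t ih => rw [growth, growth, ih fun s hs => h s (by omega), if_congr (h _ le_rfl) rfl rfl]

lemma openLoad_congr {F F' : ℕ → Finset V} {t : ℕ} (h : ∀ s ≤ t, F s = F' s) (N : Finset V)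
    (v : V) : openLoad x₀ ε F N t v = openLoad x₀ ε F' N t v :=
  Finset.sum_congr rfl fun u _ => by rw [growth_congr fun s hs => by rw [h s hs]]

/-- Given the thresholds of the earlier iterations, the fresh thresholds of iteration `t` make few
neighbours risky, because a threshold lies in a given interval of length `l` with probability at
most `l / (2ε)`. -/
lemma thresholdsLaw_not_fewRisky_le (h0 : 0 < ε) (h1 : ε < 1) (hr : 1 ≤ r)
    (hW : ∀ v ∈ S, 0 < W v) {v : V} (hv : v ∈ S) (hx : ∀ u ∈ nbrs G S v, 0 ≤ x₀ s(v, u))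
    (p : V → Fin m) (i : Fin m) (t : ℕ)
    (hxb : ∀ u ∈ nbrs G S v, m * (x₀ s(v, u) * (1 - ε)⁻¹ ^ t) ≤ W v / r ^ 4) (T : V → ℕ → ℝ) :
    thresholdsLaw V ε {T' | (fun T => openLoad x₀ ε (centralFrozen G S W ε x₀ T) (nbrs G S v) t v ≤
        W v ∧ SamplesWell G S W ε r⁻¹ x₀ (centralFrozen G S W ε x₀ T) p v i t ∧
        ¬ FewRisky G S W ε r⁻¹ x₀ T (centralFrozen G S W ε x₀ T) p v i t)
          (fun v s => if s = t then T' v s else T v s)} ≤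
      ENNReal.ofReal (Real.exp (-(r ^ 2 / 4))) := by
  have := isProbabilityMeasure_thresholdLaw h0
  have hr0 : 0 < r := by linarith
  have hWv := hW v hv
  set C := centralFrozen G S W ε x₀ T with hC
  have hcongr : ∀ T' : V → ℕ → ℝ, ∀ s ≤ t,
      centralFrozen G S W ε x₀ (fun v s => if s = t then T' v s else T v s) s = C s := by
    intro T' s hs
    rw [centralFrozen, centralRun_congr (T' := T)]
    · rfl
    · exact fun v s' hs' => if_neg (by omega)
  -- unless the history is favourable, the event is empty
  by_cases hgood : v ∉ C t ∧ openLoad x₀ ε C (nbrs G S v) t v ≤ W v ∧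
      SamplesWell G S W ε r⁻¹ x₀ C p v i t
  swap
  · refine le_of_eq_of_le (measure_mono_null (t := ∅) ?_ measure_empty) zero_le
    rintro T' ⟨e1, e2, e3⟩
    simp only [FewRisky, SamplesWell, openLoad_congr (hcongr T'), hcongr T' t le_rfl,
      Classical.not_imp] at e1 e2 e3
    exact hgood ⟨e3.1, e1, e2⟩
  obtain ⟨hvC, hl, hsw⟩ := hgood
  set y : V → ℝ := fun u => openLoad x₀ ε C (nbrs G S u) t u with hy
  -- `Q` bounds the probability of being risky; the tail bound is applied at twice the mean
  set Q : ℝ := 2 / ε * r⁻¹ * 15 ^ t with hQ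
  have hQ0 : 0 ≤ Q := by positivity
  set a : V → ℝ := fun u => m * (x₀ s(v, u) * (1 - ε)⁻¹ ^ t) with ha
  set N : Finset V := {u ∈ nbrsOn G S p i v | u ∉ C t} with hN
  have hNsub : ∀ u ∈ N, u ∈ nbrs G S v := fun u hu =>
    (Finset.mem_filter.1 (Finset.mem_filter.1 hu).1).1
  have hα : 0 ≤ (1 - ε)⁻¹ := inv_nonneg.2 (by linarith)
  have ha0 : ∀ u ∈ nbrs G S v, 0 ≤ a u := fun u hu =>
    mul_nonneg (Nat.cast_nonneg _) (mul_nonneg (hx u hu) (pow_nonneg hα t))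
  set A : V → Set (ℕ → ℝ) := fun u =>
    {f | f t ∈ Set.Ioc (y u / W u) (y u / W u + 4 * r⁻¹ * 15 ^ t)} with hA
  have hAm : ∀ u, MeasurableSet (A u) := fun u => (measurable_pi_apply t) measurableSet_Ioc
  have hAp : ∀ u, (Measure.infinitePi fun _ : ℕ => thresholdLaw ε).real (A u) ≤ Q := by
    intro u
    have h2 := (measurePreserving_eval_infinitePi (fun _ : ℕ => thresholdLaw ε) t).measure_preimage
      (measurableSet_Ioc (a := y u / W u) (b := y u / W u + 4 * r⁻¹ * 15 ^ t)).nullMeasurableSet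
    have h3 : (Measure.infinitePi fun _ : ℕ => thresholdLaw ε).real (A u) =
        (thresholdLaw ε).real (Set.Ioc (y u / W u) (y u / W u + 4 * r⁻¹ * 15 ^ t)) := by
      rw [Measure.real, Measure.real, ← h2]
      rfl
    rw [h3]
    refine (thresholdLaw_real_Ioc_le h0 _ (by positivity)).trans (le_of_eq ?_)
    rw [hQ]
    field_simp
    ring
  have hmass : ∑ u ∈ N, a u ≤ 2 * W v := by
    have e1 : ∑ u ∈ N, a u ≤ m * openLoad x₀ ε C (nbrsOn G S p i v) t v := by
      rw [openLoad, Finset.mul_sum]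
      calc ∑ u ∈ N, a u = ∑ u ∈ N, m * (x₀ s(v, u) * growth ε C t u) :=
            Finset.sum_congr rfl fun u hu => by
              rw [ha, growth_of_notMem (centralFrozen_monotone T) (Finset.mem_filter.1 hu).2]
        _ ≤ _ := Finset.sum_le_sum_of_subset_of_nonneg (Finset.filter_subset _ _)
            fun u hu _ => mul_nonneg (Nat.cast_nonneg _)
              (mul_nonneg (hx u (Finset.mem_filter.1 hu).1) (growth_pos h1 t u).le)
    have e2 := (abs_le.1 (hsw hvC)).2
    have e3 : r⁻¹ * W v ≤ W v := mul_le_of_le_one_left hWv.le (inv_le_one_of_one_le₀ hr)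
    linarith
  have hmean : ∑ u ∈ N, a u * (Measure.infinitePi fun _ : ℕ => thresholdLaw ε).real (A u) ≤
      2 * Q * W v := by
    calc _ ≤ ∑ u ∈ N, a u * Q := Finset.sum_le_sum fun u hu =>
          mul_le_mul_of_nonneg_left (hAp u) (ha0 u (hNsub u hu))
      _ = (∑ u ∈ N, a u) * Q := (Finset.sum_mul _ _ _).symm
      _ ≤ 2 * W v * Q := mul_le_mul_of_nonneg_right hmass hQ0
      _ = _ := by ring
  have hch := measure_le_sum_filter_le
    (P := fun _ : V => Measure.infinitePi fun _ : ℕ => thresholdLaw ε) (s := N) (a := a)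
    (b := W v / r ^ 4) (t := r ^ 4 / (2 * W v)) hAm (fun u hu => ha0 u (hNsub u hu))
    (fun u hu => hxb u (hNsub u hu)) (by positivity) (by positivity)
    (by rw [show r ^ 4 / (2 * W v) * (W v / r ^ 4) = 1 / 2 by field_simp]; norm_num)
    hmean (4 * Q * W v)
  have hexp : -(r ^ 4 / (2 * W v)) * (4 * Q * W v) +
      (r ^ 4 / (2 * W v) + (r ^ 4 / (2 * W v)) ^ 2 * (W v / r ^ 4)) * (2 * Q * W v) ≤
      -(r ^ 2 / 4) := by
    have e1 : -(r ^ 4 / (2 * W v)) * (4 * Q * W v) +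
        (r ^ 4 / (2 * W v) + (r ^ 4 / (2 * W v)) ^ 2 * (W v / r ^ 4)) * (2 * Q * W v) =
        -(r ^ 3 / ε * 15 ^ t) := by
      rw [hQ]
      field_simp
      ring
    rw [e1]
    have e2 : r ^ 2 ≤ r ^ 3 := pow_le_pow_right₀ hr (by norm_num)
    have e3 : r ^ 3 ≤ r ^ 3 / ε := by
      rw [le_div_iff₀ h0]
      exact mul_le_of_le_one_right (by positivity) h1.le
    have e4 : r ^ 3 / ε ≤ r ^ 3 / ε * 15 ^ t :=
      le_mul_of_one_le_right (by positivity) (one_le_pow₀ (by norm_num))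
    nlinarith [sq_nonneg r]
  refine le_trans (measure_mono ?_) (hch.trans (ENNReal.ofReal_le_ofReal (Real.exp_le_exp.2 hexp)))
  rintro T' ⟨-, -, e3⟩
  rw [FewRisky, hcongr T' t le_rfl, Classical.not_imp, not_le] at e3
  refine (le_of_eq ?_).trans (e3.2.le.trans (le_of_eq ?_))
  · rw [hQ]; ring
  · rw [Finset.mul_sum, hN, Finset.filter_filter]
    refine Finset.sum_congr ?_ fun _ _ => rfl
    ext u
    rw [Finset.mem_filter, Finset.mem_filter]
    refine and_congr_right fun hu => ?_
    have huS : u ∈ S := (mem_nbrs.1 (Finset.mem_filter.1 hu).1).1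
    have hWu := hW u huS
    rw [risky, Finset.mem_filter, hcongr T' t le_rfl]
    simp only [openLoad_congr (hcongr T'), if_true, huS, true_and, hA, Set.mem_ofPred_eq,
      Set.mem_Ioc]
    refine and_congr Iff.rfl (and_congr (div_lt_iff₀ hWu).symm ?_)
    rw [show y u / W u + 4 * r⁻¹ * 15 ^ t = (y u + 4 * r⁻¹ * 15 ^ t * W u) / W u by field_simp,
      le_div_iff₀ hWu]

end Thresholds

/-! ### Measurability of the runs -/

namespace DiscreteRV

variable {Ω α β : Type*} [MeasurableSpace Ω]

lemma prodMk {f : Ω → α} {g : Ω → β} (hf : DiscreteRV f) (hg : DiscreteRV g) :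
    DiscreteRV fun ω => (f ω, g ω) :=
  hf.bind (h := fun a ω => (a, g ω)) fun a => hg.map (Prod.mk a)

end DiscreteRV

section Measurability

variable {V : Type*} [Finite V] {G : SimpleGraph V} {S : Finset V} {W : V → ℝ} {ε δ : ℝ}
  {x₀ : Sym2 V → ℝ}

omit [Finite V] in
lemma measurableSet_threshold_mul_le (v : V) (t : ℕ) (c y : ℝ) :
    MeasurableSet {T : V → ℕ → ℝ | T v t * c ≤ y} := by
  have : Measurable fun T : V → ℕ → ℝ => T v t * c := by fun_prop
  exact this measurableSet_Iic

lemma discreteRV_primalDual (κ : ℕ → (Sym2 V → ℝ) → V → ℝ) (t : ℕ) :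
    DiscreteRV fun T : V → ℕ → ℝ =>
      primalDual S ε x₀ (fun t x v => T v t * W v ≤ κ t x v) t := by
  induction t with
  | zero => exact DiscreteRV.const _
  | succ t ih =>
    refine ih.bind (h := fun (σ : RunState V) (T : V → ℕ → ℝ) =>
      let F : Finset V := σ.frozen ∪ {v ∈ S | v ∉ σ.frozen ∧ T v t * W v ≤ κ t σ.x v}
      (⟨F, fun e => if Touches F e then σ.x e else σ.x e / (1 - ε)⟩ : RunState V)) fun σ => ?_
    refine (DiscreteRV.filter S (p := fun (T : V → ℕ → ℝ) v =>
      v ∉ σ.frozen ∧ T v t * W v ≤ κ t σ.x v) fun v => ?_).map fun N =>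
        (⟨σ.frozen ∪ N, fun e => if Touches (σ.frozen ∪ N) e then σ.x e else σ.x e / (1 - ε)⟩ :
          RunState V)
    exact (MeasurableSet.const _).inter (measurableSet_threshold_mul_le v t _ _)

lemma discreteRV_centralFrozen (t : ℕ) :
    DiscreteRV fun T => centralFrozen G S W ε x₀ T t :=
  (discreteRV_primalDual (fun _ x v => load G S x v) t).map RunState.frozen

lemma discreteRV_growth_centralFrozen (t : ℕ) :
    DiscreteRV fun T => growth ε (centralFrozen G S W ε x₀ T) t := by
  induction t with
  | zero => exact DiscreteRV.const _
  | succ t ih =>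
    exact (ih.prodMk (discreteRV_centralFrozen (t + 1))).map fun q u =>
      if u ∈ q.2 then q.1 u else q.1 u * (1 - ε)⁻¹

variable {m : ℕ}

/-- The event that `SamplesWell` fails for an active vertex with a feasible load. -/
def BadSample (G : SimpleGraph V) (S : Finset V) (W : V → ℝ) (ε δ : ℝ) (x₀ : Sym2 V → ℝ)
    (v : V) (i : Fin m) (t : ℕ) (p : V → Fin m) (T : V → ℕ → ℝ) : Prop :=
  openLoad x₀ ε (centralFrozen G S W ε x₀ T) (nbrs G S v) t v ≤ W v ∧
    ¬ SamplesWell G S W ε δ x₀ (centralFrozen G S W ε x₀ T) p v i t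

/-- The event that `FewRisky` fails although the sample of the machine is representative. -/
def BadThresholds (G : SimpleGraph V) (S : Finset V) (W : V → ℝ) (ε δ : ℝ) (x₀ : Sym2 V → ℝ)
    (v : V) (i : Fin m) (t : ℕ) (p : V → Fin m) (T : V → ℕ → ℝ) : Prop :=
  openLoad x₀ ε (centralFrozen G S W ε x₀ T) (nbrs G S v) t v ≤ W v ∧
    SamplesWell G S W ε δ x₀ (centralFrozen G S W ε x₀ T) p v i t ∧
    ¬ FewRisky G S W ε δ x₀ T (centralFrozen G S W ε x₀ T) p v i t

lemma measurableSet_badSample (v : V) (i : Fin m) (t : ℕ) (p : V → Fin m) :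
    MeasurableSet {T | BadSample G S W ε δ x₀ v i t p T} := by
  refine DiscreteRV.prop_iff.1 ?_
  exact ((discreteRV_growth_centralFrozen (G := G) (S := S) (W := W) (ε := ε) (x₀ := x₀) t).prodMk
    (discreteRV_centralFrozen t)).map fun q =>
      (∑ u ∈ nbrs G S v, x₀ s(v, u) * q.1 u ≤ W v) ∧
      ¬ (v ∉ q.2 → |m * (∑ u ∈ nbrsOn G S p i v, x₀ s(v, u) * q.1 u) -
        ∑ u ∈ nbrs G S v, x₀ s(v, u) * q.1 u| ≤ δ * W v)

lemma discreteRV_risky (t : ℕ) :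
    DiscreteRV fun T => risky G S W ε δ x₀ T (centralFrozen G S W ε x₀ T) t := by
  refine ((discreteRV_growth_centralFrozen (G := G) (S := S) (W := W) (ε := ε) (x₀ := x₀) t).prodMk
    (discreteRV_centralFrozen t)).bind (h := fun q (T : V → ℕ → ℝ) => {u ∈ S | u ∉ q.2 ∧
      (∑ a ∈ nbrs G S u, x₀ s(u, a) * q.1 a) < T u t * W u ∧
      T u t * W u ≤ (∑ a ∈ nbrs G S u, x₀ s(u, a) * q.1 a) + 4 * δ * 15 ^ t * W u}) fun q => ?_
  refine DiscreteRV.filter S (p := fun (T : V → ℕ → ℝ) u => u ∉ q.2 ∧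
    (∑ a ∈ nbrs G S u, x₀ s(u, a) * q.1 a) < T u t * W u ∧
    T u t * W u ≤ (∑ a ∈ nbrs G S u, x₀ s(u, a) * q.1 a) + 4 * δ * 15 ^ t * W u)
    fun u => (MeasurableSet.const _).inter (MeasurableSet.inter ?_ ?_)
  · have : Measurable fun T : V → ℕ → ℝ => T u t * W u := by fun_prop
    exact this measurableSet_Ioi
  · exact measurableSet_threshold_mul_le u t _ _

lemma measurableSet_badThresholds (v : V) (i : Fin m) (t : ℕ) (p : V → Fin m) :
    MeasurableSet {T | BadThresholds G S W ε δ x₀ v i t p T} := by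
  refine DiscreteRV.prop_iff.1 ?_
  exact (((discreteRV_growth_centralFrozen (G := G) (S := S) (W := W) (ε := ε) (x₀ := x₀) t).prodMk
    (discreteRV_centralFrozen t)).prodMk (discreteRV_risky (δ := δ) t)).map fun q =>
      (∑ u ∈ nbrs G S v, x₀ s(v, u) * q.1.1 u ≤ W v) ∧
      (v ∉ q.1.2 → |m * (∑ u ∈ nbrsOn G S p i v, x₀ s(v, u) * q.1.1 u) -
        ∑ u ∈ nbrs G S v, x₀ s(v, u) * q.1.1 u| ≤ δ * W v) ∧
      ¬ (v ∉ q.1.2 → m * ∑ u ∈ nbrsOn G S p i v with u ∈ q.2,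
        x₀ s(v, u) * (1 - ε)⁻¹ ^ t ≤ 8 / ε * δ * 15 ^ t * W v)

end Measurability

section PhaseMeasurability

variable {V : Type*} [Fintype V] {G : SimpleGraph V} {w : V → ℝ} {ε : ℝ}

lemma discreteRV_localFrozen (σ : RunState V) {m : ℕ+} (p : V → Fin m) (t : ℕ) :
    DiscreteRV fun T => localFrozen G w ε σ p T t := by
  refine (DiscreteRV.pi (f := fun v T => v ∈ (machineRun G w ε σ p T (p v) t).frozen) fun v =>
    (discreteRV_primalDual (fun t x v' => 2 * (m : ℝ) ^ (-0.2 : ℝ) * 15 ^ t * resWeight G w σ v' +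
      (m : ℝ) * load G (part G σ p (p v)) x v') t).map fun τ => v ∈ τ.frozen).of_factorsThrough ?_
  intro T T' h
  exact Finset.filter_congr fun v _ => iff_of_eq (congrFun h v)

lemma discreteRV_phase (σ : RunState V) {m : ℕ+} (p : V → Fin m) :
    DiscreteRV fun T => phase G w ε σ p T := by
  refine (DiscreteRV.pi (f := fun (s : Fin (numIter m + 1)) T => localFrozen G w ε σ p T s)
    fun s => discreteRV_localFrozen σ p s).of_factorsThrough fun T T' h => ?_
  have hF : ∀ s ≤ numIter m, localFrozen G w ε σ p T s = localFrozen G w ε σ p T' s :=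
    fun s hs => congrFun h ⟨s, Nat.lt_succ_iff.2 hs⟩
  have hft : ∀ e, freezeTime G w ε σ p T e = freezeTime G w ε σ p T' e := by
    intro e
    unfold freezeTime
    congr 1
    ext t
    refine or_congr_right (and_congr_right fun ht => ?_)
    rw [hF (t + 1) ht]
  have hpw : phaseWeight G w ε σ p T = phaseWeight G w ε σ p T' := by
    funext e
    rw [phaseWeight, phaseWeight, hft]
  unfold phase
  rw [hF _ le_rfl, hpw]

lemma discreteRV_partition (m : ℕ+) : DiscreteRV fun c : PhaseCoins V => c.2 m := by
  refine DiscreteRV.of_finite fun a => ?_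
  have : Measurable fun c : PhaseCoins V => c.2 m := by fun_prop
  exact this (measurableSet_singleton a)

lemma discreteRV_phase_coins (σ : RunState V) (m : ℕ+) :
    DiscreteRV fun c : PhaseCoins V => phase G w ε σ (c.2 m) c.1 :=
  (discreteRV_partition m).bind (h := fun p (c : PhaseCoins V) => phase G w ε σ p c.1)
    fun p => (discreteRV_phase σ p).comp_measurable measurable_fst

lemma discreteRV_mpcState (k : ℕ) : DiscreteRV fun ω : Coins V => mpcState G w ε ω k := by
  induction k with
  | zero => exact DiscreteRV.const _
  | succ k ih =>
    exact ih.bind (h := fun σ (ω : Coins V) =>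
      phase G w ε σ ((ω k).2 (numMachines G σ)) (ω k).1) fun σ =>
        (discreteRV_phase_coins σ (numMachines G σ)).comp_measurable (measurable_pi_apply k)

end PhaseMeasurability

/-! ### One phase: the coupled runs -/

section Phase

variable {V : Type*} [Fintype V] {G : SimpleGraph V} {w : V → ℝ} {ε : ℝ} {σ : RunState V}

lemma high_subset_alive : high G σ ⊆ alive σ := Finset.filter_subset _ _

lemma deg_pos_of_mem_high (hd : 0 < avgDeg G σ) {v : V} (hv : v ∈ high G σ) :
    (0 : ℝ) < deg G σ v :=
  (Real.rpow_pos_of_pos hd _).trans_le (Finset.mem_filter.1 hv).2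

omit [Fintype V] in
lemma nbrs_mono {S S' : Finset V} (h : S ⊆ S') (v : V) : nbrs G S v ⊆ nbrs G S' v :=
  Finset.filter_subset_filter _ h

lemma initWeight_mk (u v : V) : initWeight G w σ s(u, v) =
    min (resWeight G w σ u / deg G σ u) (resWeight G w σ v / deg G σ v) := rfl

lemma initWeight_pos (hd : 0 < avgDeg G σ) (hW : ∀ v ∈ alive σ, 0 < resWeight G w σ v) {u v : V}
    (hu : u ∈ high G σ) (hv : v ∈ high G σ) : 0 < initWeight G w σ s(u, v) :=
  lt_min (div_pos (hW u (high_subset_alive hu)) (deg_pos_of_mem_high hd hu))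
    (div_pos (hW v (high_subset_alive hv)) (deg_pos_of_mem_high hd hv))

lemma load_initWeight_le (hd : 0 < avgDeg G σ) (hW : ∀ v ∈ alive σ, 0 < resWeight G w σ v) {v : V}
    (hv : v ∈ high G σ) : load G (high G σ) (initWeight G w σ) v ≤ resWeight G w σ v := by
  have hdeg := deg_pos_of_mem_high hd hv
  have hWv := hW v (high_subset_alive hv)
  calc load G (high G σ) (initWeight G w σ) v
      ≤ ∑ _u ∈ nbrs G (high G σ) v, resWeight G w σ v / deg G σ v :=
        Finset.sum_le_sum fun u _ => min_le_left _ _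
    _ = (nbrs G (high G σ) v).card * (resWeight G w σ v / deg G σ v) := by
        rw [Finset.sum_const, nsmul_eq_mul]
    _ ≤ deg G σ v * (resWeight G w σ v / deg G σ v) := by
        refine mul_le_mul_of_nonneg_right ?_ (div_pos hWv hdeg).le
        exact Nat.cast_le.2 (Finset.card_le_card (nbrs_mono high_subset_alive v))
    _ = resWeight G w σ v := mul_div_cancel₀ _ hdeg.ne'

variable {m : ℕ+} {p : V → Fin m} {T : V → ℕ → ℝ}

lemma mem_part {v : V} {i : Fin m} : v ∈ part G σ p i ↔ v ∈ high G σ ∧ p v = i :=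
  Finset.mem_filter

lemma mem_localFrozen {v : V} (t : ℕ) : v ∈ localFrozen G w ε σ p T t ↔
    v ∈ (machineRun G w ε σ p T (p v) t).frozen := by
  refine Finset.mem_filter.trans ⟨fun h => h.2, fun h => ⟨?_, h⟩⟩
  exact (mem_part.1 (primalDual_frozen_subset t h)).1

lemma localFrozen_subset (t : ℕ) : localFrozen G w ε σ p T t ⊆ high G σ :=
  Finset.filter_subset _ _

lemma localFrozen_monotone : Monotone (localFrozen G w ε σ p T) := fun _ _ hst _ hv =>
  (mem_localFrozen _).2 (primalDual_frozen_monotone hst ((mem_localFrozen _).1 hv))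

lemma localFrozen_zero : localFrozen G w ε σ p T 0 = ∅ :=
  Finset.eq_empty_of_forall_notMem fun v hv => Finset.notMem_empty v ((mem_localFrozen 0).1 hv)

lemma mem_localFrozen_succ (h0 : 0 ≤ ε) (h1 : ε < 1) (t : ℕ) {v : V} (hv : v ∈ high G σ)
    (hvF : v ∉ localFrozen G w ε σ p T t) :
    v ∈ localFrozen G w ε σ p T (t + 1) ↔ T v t * resWeight G w σ v ≤
      2 * (m : ℝ) ^ (-0.2 : ℝ) * 15 ^ t * resWeight G w σ v + m *
        openLoad (initWeight G w σ) ε (localFrozen G w ε σ p T)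
          (nbrsOn G (high G σ) p (p v) v) t v := by
  have hvF' : v ∉ (machineRun G w ε σ p T (p v) t).frozen := fun h => hvF ((mem_localFrozen t).2 h)
  have hload : load G (part G σ p (p v)) (machineRun G w ε σ p T (p v) t).x v =
      openLoad (initWeight G w σ) ε (localFrozen G w ε σ p T)
        (nbrsOn G (high G σ) p (p v) v) t v := by
    rw [machineRun, load_primalDual_of_notMem h0 h1 _ hvF', openLoad]
    have hN : nbrs G (part G σ p (p v)) v = nbrsOn G (high G σ) p (p v) v := by
      ext u
      rw [mem_nbrs, mem_part, nbrsOn, Finset.mem_filter, mem_nbrs]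
      tauto
    rw [hN]
    refine Finset.sum_congr rfl fun u hu => ?_
    congr 1
    refine growth_congr fun s _ => ?_
    rw [mem_localFrozen, (Finset.mem_filter.1 hu).2]
    rfl
  rw [mem_localFrozen, ← hload, machineRun, primalDual_frozen_succ, Finset.mem_union,
    Finset.mem_filter]
  rw [machineRun] at hvF'
  simp [hvF', mem_part.2 ⟨hv, rfl⟩]

/-- The weights that the phase assigns are those of the local runs after the last iteration. -/
lemma phaseWeight_mk (h0 : 0 ≤ ε) (h1 : ε < 1) (u v : V) :
    phaseWeight G w ε σ p T s(u, v) = initWeight G w σ s(u, v) *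
      min (growth ε (localFrozen G w ε σ p T) (numIter m) u)
        (growth ε (localFrozen G w ε σ p T) (numIter m) v) := by
  set M := localFrozen G w ε σ p T with hM
  set τ := freezeTime G w ε σ p T s(u, v) with hτ
  have hmem : τ = numIter m ∨ τ < numIter m ∧ Touches (M (τ + 1)) s(u, v) :=
    Nat.sInf_mem (s := {t | t = numIter m ∨ t < numIter m ∧ Touches (M (t + 1)) s(u, v)})
      ⟨_, .inl rfl⟩
  have hle : τ ≤ numIter m := by omega
  have hnot : ∀ a ∈ s(u, v), a ∉ M τ := by
    intro a ha haM
    rcases Nat.eq_zero_or_pos τ with h | h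
    · rw [h, hM, localFrozen_zero] at haM
      exact Finset.notMem_empty a haM
    · refine Nat.notMem_of_lt_sInf (m := τ - 1) (lt_of_lt_of_eq (Nat.sub_lt h one_pos) hτ)
        (.inr ⟨by omega, a, ?_, ha⟩)
      have hτ1 : τ - 1 + 1 = τ := by omega
      rwa [hτ1]
  have hg : ∀ a ∈ s(u, v), growth ε M τ a = (1 - ε)⁻¹ ^ τ := fun a ha =>
    growth_of_notMem localFrozen_monotone (hnot a ha)
  have hge : ∀ a ∈ s(u, v), (1 - ε)⁻¹ ^ τ ≤ growth ε M (numIter m) a := fun a ha =>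
    (hg a ha).ge.trans (growth_monotone h0 h1 a hle)
  have hmin : min (growth ε M (numIter m) u) (growth ε M (numIter m) v) = (1 - ε)⁻¹ ^ τ := by
    refine le_antisymm ?_ (le_min (hge u (by simp)) (hge v (by simp)))
    rcases hmem with h | ⟨hlt, ht⟩
    · rw [← h]
      exact (min_le_left _ _).trans (hg u (by simp)).le
    · rcases touches_mk.1 ht with h | h
      · refine (min_le_left _ _).trans ?_
        rw [growth_of_mem localFrozen_monotone hle h]
        exact (hg u (by simp)).le
      · refine (min_le_right _ _).trans ?_
        rw [growth_of_mem localFrozen_monotone hle h]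
        exact (hg v (by simp)).le
  rw [hmin, phaseWeight, ← hτ, div_eq_mul_inv, inv_pow]

/-- The outcome of a successful phase: the edge weights form a fractional matching for the residual
weights, almost tight at the vertices that were frozen by their machines. -/
def PhaseGood (G : SimpleGraph V) (w : V → ℝ) (ε : ℝ) (σ : RunState V) {m : ℕ+}
    (p : V → Fin m) (T : V → ℕ → ℝ) : Prop :=
  ∀ v ∈ high G σ, load G (high G σ) (phaseWeight G w ε σ p T) v ≤ resWeight G w σ v ∧
    (v ∈ localFrozen G w ε σ p T (numIter m) →
      (1 - 5 * ε) * resWeight G w σ v ≤ load G (high G σ) (phaseWeight G w ε σ p T) v)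

lemma phaseGood_of_concentrated (h0 : 0 < ε) (h1 : ε ≤ 1 / 16) (hd : 0 < avgDeg G σ)
    (hW : ∀ v ∈ alive σ, 0 < resWeight G w σ v) (hT : ValidThresholds ε T)
    (hδ : 5 * (m : ℝ) ^ (-0.2 : ℝ) * 15 ^ numIter m ≤ ε)
    (hs : ∀ t < numIter m, ∀ v ∈ high G σ, ∀ i,
      ¬ BadSample G (high G σ) (resWeight G w σ) ε ((m : ℝ) ^ (-0.2 : ℝ)) (initWeight G w σ)
        v i t p T ∧
      ¬ BadThresholds G (high G σ) (resWeight G w σ) ε ((m : ℝ) ^ (-0.2 : ℝ)) (initWeight G w σ)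
        v i t p T) :
    PhaseGood G w ε σ p T := by
  have hε1 : ε < 1 := by linarith
  set S := high G σ with hS
  set W := resWeight G w σ with hWdef
  set x₀ := initWeight G w σ with hx₀
  set C := centralFrozen G S W ε x₀ T with hC
  have hx : ∀ v ∈ S, ∀ u ∈ nbrs G S v, 0 ≤ x₀ s(v, u) := fun v hv u hu =>
    (initWeight_pos hd hW hv (mem_nbrs.1 hu).1).le
  have hWS : ∀ v ∈ S, 0 ≤ W v := fun v hv => (hW v (high_subset_alive hv)).le
  have hcl : ∀ t, ∀ v ∈ S, load G S (centralRun G S W ε x₀ T t).x v ≤ W v := fun t v hv =>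
    load_centralRun_le h0 hε1 hT hx hWS (fun _ hv => load_initWeight_le hd hW hv) t hv
  have hopen : ∀ t v, v ∉ C t →
      load G S (centralRun G S W ε x₀ T t).x v = openLoad x₀ ε C (nbrs G S v) t v :=
    fun t v hvC => load_primalDual_of_notMem h0.le hε1 S hvC
  have hsw : ∀ t < numIter m, ∀ v ∈ S, ∀ i,
      SamplesWell G S W ε ((m : ℝ) ^ (-0.2 : ℝ)) x₀ C p v i t := by
    intro t ht v hv i hvC
    by_contra hcon
    exact (hs t ht v hv i).1 ⟨(hopen t v hvC).symm.trans_le (hcl t v hv), fun h => hcon (h hvC)⟩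
  have hcr : CoupledRuns G S W ε ((m : ℝ) ^ (-0.2 : ℝ)) x₀ T p (numIter m) C
      (localFrozen G w ε σ p T) :=
    { pos := h0
      le := h1
      delta_nonneg := Real.rpow_nonneg (Nat.cast_nonneg _) _
      monotone_central := centralFrozen_monotone T
      monotone_machine := localFrozen_monotone
      central_zero := rfl
      machine_zero := localFrozen_zero
      central_subset := fun t => primalDual_frozen_subset t
      machine_subset := localFrozen_subset
      central_succ := by
        intro t v hv hvC
        rw [← hopen t v hvC, hC, centralFrozen, centralRun, primalDual_frozen_succ,
          Finset.mem_union, Finset.mem_filter]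
        have hvC' : v ∉ (primalDual S ε x₀ (fun t x v => T v t * W v ≤ load G S x v) t).frozen :=
          hvC
        simp only [hvC', hv, not_false_eq_true, true_and, false_or]
      machine_succ := fun t v hv hvM => mem_localFrozen_succ h0.le hε1 t hv hvM
      weight_nonneg := hWS
      init_nonneg := hx
      samplesWell := hsw
      fewRisky := by
        intro t ht v hv i hvC
        by_contra hcon
        exact (hs t ht v hv i).2 ⟨(hopen t v hvC).symm.trans_le (hcl t v hv),
          hsw t ht v hv i, fun h => hcon (h hvC)⟩ }
  have hload : ∀ v, load G S (phaseWeight G w ε σ p T) v = ∑ u ∈ nbrs G S v, x₀ s(v, u) *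
      min (growth ε (localFrozen G w ε σ p T) (numIter m) v)
        (growth ε (localFrozen G w ε σ p T) (numIter m) u) := fun v =>
    Finset.sum_congr rfl fun u _ => phaseWeight_mk h0.le hε1 v u
  intro v hv
  rw [hload]
  refine ⟨(hcr.sum_min_growth_le hv).trans (le_of_eq_of_le ?_ (hcl (numIter m) v hv)),
    hcr.le_sum_min_growth hT hδ⟩
  exact Finset.sum_congr rfl fun u _ => (primalDual_x_mk h0.le hε1 (numIter m) v u).symm

end Phase

/-! ### One phase: probability of failure -/

section Numerics

lemma pow_numIter_le (m : ℕ+) : (15 : ℝ) ^ numIter m ≤ (m : ℝ) ^ (0.1 : ℝ) := by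
  have hm : (0 : ℝ) < m := Nat.cast_pos.2 m.pos
  have hm1 : (1 : ℝ) ≤ m := Nat.one_le_cast.2 m.pos
  have hl : 0 < Real.log 15 := Real.log_pos (by norm_num)
  have h1 : (numIter m : ℝ) ≤ Real.log m / (10 * Real.log 15) :=
    Nat.floor_le (div_nonneg (Real.log_nonneg hm1) (by positivity))
  rw [le_div_iff₀ (by positivity)] at h1
  rw [← Real.rpow_natCast, Real.rpow_def_of_pos (by norm_num), Real.rpow_def_of_pos hm]
  refine Real.exp_le_exp.2 ?_
  linarith

lemma numIter_le (m : ℕ+) : numIter m ≤ m := by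
  have hm1 : (1 : ℝ) ≤ m := Nat.one_le_cast.2 m.pos
  have hl : 1 ≤ 10 * Real.log 15 := by
    have : Real.log 15 ≥ 1 := by
      rw [ge_iff_le, Real.le_log_iff_exp_le (by norm_num)]
      linarith [Real.exp_one_lt_d9]
    linarith
  refine Nat.floor_le_of_le ?_
  refine (div_le_self (Real.log_nonneg hm1) hl).trans ?_
  linarith [Real.log_le_sub_one_of_pos (show (0 : ℝ) < m by linarith)]

end Numerics

section PhaseProbability

variable {V : Type*} [Fintype V] {G : SimpleGraph V} {w : V → ℝ} {ε : ℝ}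

/-- The law of the random choices of one phase. -/
noncomputable def phaseLaw (V : Type*) (ε : ℝ) : Measure (PhaseCoins V) :=
  (thresholdsLaw V ε).prod (Measure.infinitePi fun m : ℕ+ => partitionLaw V m)

instance instIsProbabilityMeasurePartitionLaw (V : Type*) (m : ℕ+) :
    IsProbabilityMeasure (partitionLaw V m) := by
  unfold partitionLaw
  infer_instance

lemma isProbabilityMeasure_phaseLaw (V : Type*) (hε : 0 < ε) :
    IsProbabilityMeasure (phaseLaw V ε) := by
  have := isProbabilityMeasure_thresholdsLaw V hε
  unfold phaseLaw
  infer_instance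

lemma coinMeasure_eq (V : Type*) (ε : ℝ) :
    coinMeasure V ε = Measure.infinitePi fun _ : ℕ => phaseLaw V ε := rfl

section Abstract

variable {S : Finset V} {W : V → ℝ} {x₀ : Sym2 V → ℝ} {m : ℕ+} {r : ℝ}

lemma measurableSet_coins {q : (V → Fin m) → (V → ℕ → ℝ) → Prop}
    (hq : ∀ p, MeasurableSet {T | q p T}) : MeasurableSet {c : PhaseCoins V | q (c.2 m) c.1} :=
  DiscreteRV.prop_iff.1 ((discreteRV_partition m).bind
    (h := fun p (c : PhaseCoins V) => q p c.1)
    fun p => (DiscreteRV.prop_iff.2 (hq p)).comp_measurable measurable_fst)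

lemma phaseLaw_badSample_le (h0 : 0 < ε) (h1 : ε < 1) (hr : 1 ≤ r) {v : V}
    (hW : 0 < W v) (hx : ∀ u ∈ nbrs G S v, 0 ≤ x₀ s(v, u)) (i : Fin m) (t : ℕ)
    (hxb : ∀ u ∈ nbrs G S v, m * (x₀ s(v, u) * (1 - ε)⁻¹ ^ t) ≤ W v / r ^ 4) :
    phaseLaw V ε {c | BadSample G S W ε r⁻¹ x₀ v i t (c.2 m) c.1} ≤
      2 * ENNReal.ofReal (Real.exp (-(r ^ 2 / 4))) := by
  have := isProbabilityMeasure_thresholdsLaw V h0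
  refine measure_le_of_measurePreserving_prod (MeasurePreserving.id _)
    (measurableSet_coins fun p => measurableSet_badSample v i t p) fun T => ?_
  have hmp := measurePreserving_eval_infinitePi (fun m : ℕ+ => partitionLaw V m) m
  have hpre := hmp.measure_preimage
    (s := {p | BadSample G S W ε r⁻¹ x₀ v i t p T}) (Set.toFinite _).measurableSet.nullMeasurableSet
  refine (le_of_eq hpre).trans ?_
  by_cases hl : openLoad x₀ ε (centralFrozen G S W ε x₀ T) (nbrs G S v) t v ≤ W v
  · exact (measure_mono fun p hp => hp.2).trans
      (partitionLaw_not_samplesWell_le h0.le h1 hr hW hx i t hxb hl)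
  · exact le_of_eq_of_le (measure_mono_null (t := ∅) (fun p hp => hl hp.1) measure_empty) zero_le

lemma phaseLaw_badThresholds_le (h0 : 0 < ε) (h1 : ε < 1) (hr : 1 ≤ r)
    (hW : ∀ v ∈ S, 0 < W v) {v : V} (hv : v ∈ S) (hx : ∀ u ∈ nbrs G S v, 0 ≤ x₀ s(v, u))
    (i : Fin m) (t : ℕ)
    (hxb : ∀ u ∈ nbrs G S v, m * (x₀ s(v, u) * (1 - ε)⁻¹ ^ t) ≤ W v / r ^ 4) :
    phaseLaw V ε {c | BadThresholds G S W ε r⁻¹ x₀ v i t (c.2 m) c.1} ≤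
      ENNReal.ofReal (Real.exp (-(r ^ 2 / 4))) := by
  have := isProbabilityMeasure_thresholdsLaw V h0
  have := isProbabilityMeasure_thresholdLaw h0
  refine measure_le_of_measurePreserving_prod Measure.measurePreserving_swap
    (measurableSet_coins fun p => measurableSet_badThresholds v i t p) fun P => ?_
  exact measure_le_of_measurePreserving_prod (measurePreserving_resample_column t)
    (measurableSet_badThresholds v i t (P m)) fun T =>
      thresholdsLaw_not_fewRisky_le h0 h1 hr hW hv hx (P m) i t hxb T

end Abstract

/-- The failure probability of one phase. An edge of `G[V^high]` carries at most the fraction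
`d ^ (-0.95)` of the residual weight of either endpoint, which is much less than `1 / m`, so that
the loads of the machines concentrate. -/
lemma phaseLaw_not_phaseGood_le {σ : RunState V} {m : ℕ+} (h0 : 0 < ε) (h1 : ε ≤ 1 / 16)
    (hW : ∀ v ∈ alive σ, 0 < resWeight G w σ v) (hmd : (m : ℝ) ^ 2 ≤ avgDeg G σ)
    (hmε : 5 / ε ≤ (m : ℝ) ^ (0.1 : ℝ)) :
    phaseLaw V ε {c | ¬ PhaseGood G w ε σ (c.2 m) c.1} ≤
      Fintype.card V * m * numIter m *
        (3 * ENNReal.ofReal (Real.exp (-((m : ℝ) ^ (0.4 : ℝ) / 4)))) := by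
  have hε1 : ε < 1 := by linarith
  have := isProbabilityMeasure_thresholdsLaw V h0
  have hm : (0 : ℝ) < m := Nat.cast_pos.2 m.pos
  have hm1 : (1 : ℝ) ≤ m := Nat.one_le_cast.2 m.pos
  have hd : 0 < avgDeg G σ := (pow_pos hm 2).trans_le hmd
  set r : ℝ := (m : ℝ) ^ (0.2 : ℝ) with hr
  have hr1 : 1 ≤ r := Real.one_le_rpow hm1 (by norm_num)
  have hr2 : r ^ 2 = (m : ℝ) ^ (0.4 : ℝ) := by
    rw [hr, ← Real.rpow_natCast, ← Real.rpow_mul hm.le]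
    norm_num
  have hrinv : (m : ℝ) ^ (-0.2 : ℝ) = r⁻¹ := by
    rw [hr, ← Real.rpow_neg hm.le]
  have hδ : 5 * (m : ℝ) ^ (-0.2 : ℝ) * 15 ^ numIter m ≤ ε := by
    have e1 : (m : ℝ) ^ (-0.2 : ℝ) * (m : ℝ) ^ (0.1 : ℝ) * (m : ℝ) ^ (0.1 : ℝ) = 1 := by
      rw [← Real.rpow_add hm, ← Real.rpow_add hm]
      norm_num
    have e2 : 5 ≤ ε * (m : ℝ) ^ (0.1 : ℝ) := by
      rw [div_le_iff₀ h0] at hmε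
      linarith
    have e3 := pow_numIter_le m
    have e4 : (0 : ℝ) < (m : ℝ) ^ (-0.2 : ℝ) := Real.rpow_pos_of_pos hm _
    calc 5 * (m : ℝ) ^ (-0.2 : ℝ) * 15 ^ numIter m
        ≤ (ε * (m : ℝ) ^ (0.1 : ℝ)) * (m : ℝ) ^ (-0.2 : ℝ) * (m : ℝ) ^ (0.1 : ℝ) := by gcongr
      _ = ε * ((m : ℝ) ^ (-0.2 : ℝ) * (m : ℝ) ^ (0.1 : ℝ) * (m : ℝ) ^ (0.1 : ℝ)) := by ring
      _ = ε := by rw [e1, mul_one]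
  have hα : (1 - ε)⁻¹ ≤ 15 := by
    rw [inv_le_comm₀ (by linarith) (by norm_num)]
    linarith
  have hα0 : 0 ≤ (1 - ε)⁻¹ := inv_nonneg.2 (by linarith)
  have hx : ∀ v ∈ high G σ, ∀ u ∈ nbrs G (high G σ) v, 0 ≤ initWeight G w σ s(v, u) :=
    fun v hv u hu => (initWeight_pos hd hW hv (mem_nbrs.1 hu).1).le
  have hxb : ∀ t < numIter m, ∀ v ∈ high G σ, ∀ u ∈ nbrs G (high G σ) v,
      m * (initWeight G w σ s(v, u) * (1 - ε)⁻¹ ^ t) ≤ resWeight G w σ v / r ^ 4 := by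
    intro t ht v hv u hu
    have hWv := hW v (high_subset_alive hv)
    have hdeg := deg_pos_of_mem_high hd hv
    have e1 : (1 - ε)⁻¹ ^ t ≤ (m : ℝ) ^ (0.1 : ℝ) :=
      (pow_le_pow_left₀ hα0 hα t).trans
        ((pow_le_pow_right₀ (by norm_num) ht.le).trans (pow_numIter_le m))
    have e2 : initWeight G w σ s(v, u) ≤ resWeight G w σ v / deg G σ v := min_le_left _ _
    have e3 : m * (m : ℝ) ^ (0.1 : ℝ) * r ^ 4 ≤ deg G σ v := by
      have e4 : m * (m : ℝ) ^ (0.1 : ℝ) * r ^ 4 = (m : ℝ) ^ (1.9 : ℝ) := by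
        rw [hr, ← Real.rpow_natCast, ← Real.rpow_mul hm.le,
          ← Real.rpow_one_add' hm.le (by norm_num), ← Real.rpow_add hm]
        norm_num
      have e5 : (m : ℝ) ^ (1.9 : ℝ) = ((m : ℝ) ^ 2) ^ (0.95 : ℝ) := by
        rw [← Real.rpow_natCast, ← Real.rpow_mul hm.le]
        norm_num
      rw [e4, e5]
      exact (Real.rpow_le_rpow (by positivity) hmd (by norm_num)).trans
        (Finset.mem_filter.1 hv).2
    calc m * (initWeight G w σ s(v, u) * (1 - ε)⁻¹ ^ t)
        ≤ m * (resWeight G w σ v / deg G σ v * (m : ℝ) ^ (0.1 : ℝ)) := by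
          refine mul_le_mul_of_nonneg_left ?_ hm.le
          exact mul_le_mul e2 e1 (pow_nonneg hα0 t) (by positivity)
      _ = resWeight G w σ v / r ^ 4 * ((m * (m : ℝ) ^ (0.1 : ℝ) * r ^ 4) / deg G σ v) := by
          field_simp
      _ ≤ resWeight G w σ v / r ^ 4 :=
          mul_le_of_le_one_right (by positivity) ((div_le_one hdeg).2 e3)
  -- outside of the failure events of the individual vertices, machines and iterations, and of the
  -- null event that some threshold lies outside of its range, the phase succeeds
  set Bad : V × Fin m × ℕ → Set (PhaseCoins V) := fun j =>
    {c | j.1 ∈ high G σ ∧ (BadSample G (high G σ) (resWeight G w σ) ε r⁻¹ (initWeight G w σ)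
      j.1 j.2.1 j.2.2 (c.2 m) c.1 ∨ BadThresholds G (high G σ) (resWeight G w σ) ε r⁻¹
        (initWeight G w σ) j.1 j.2.1 j.2.2 (c.2 m) c.1)} with hBad
  set J : Finset (V × Fin m × ℕ) :=
    Finset.univ ×ˢ Finset.univ ×ˢ Finset.range (numIter m) with hJ
  have hsub : {c : PhaseCoins V | ¬ PhaseGood G w ε σ (c.2 m) c.1} ⊆
      ({T | ¬ ValidThresholds ε T} ×ˢ Set.univ) ∪ ⋃ j ∈ J, Bad j := by
    intro c hc
    by_contra hcon
    rw [Set.mem_union, not_or] at hcon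
    obtain ⟨hT, hB⟩ := hcon
    have hT' : ValidThresholds ε c.1 := by
      by_contra h
      exact hT ⟨h, trivial⟩
    refine hc (phaseGood_of_concentrated h0 h1 hd hW hT' hδ fun t ht v hv i => ?_)
    rw [hrinv, ← not_or]
    intro h
    refine hB (Set.mem_biUnion (x := (v, i, t)) ?_ ⟨hv, h⟩)
    simp [hJ, ht]
  have hnull : phaseLaw V ε ({T | ¬ ValidThresholds ε T} ×ˢ Set.univ) = 0 := by
    rw [phaseLaw, Measure.prod_prod, thresholdsLaw_not_validThresholds h0, zero_mul]
  have hB : ∀ j ∈ J, phaseLaw V ε (Bad j) ≤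
      3 * ENNReal.ofReal (Real.exp (-((m : ℝ) ^ (0.4 : ℝ) / 4))) := by
    rintro ⟨v, i, t⟩ hj
    have ht : t < numIter m := by simpa [hJ] using hj
    by_cases hv : v ∈ high G σ
    swap
    · exact le_of_eq_of_le (measure_mono_null (t := ∅) (fun p hp => hv hp.1) measure_empty) zero_le
    have hWS : ∀ v ∈ high G σ, 0 < resWeight G w σ v := fun v hv => hW v (high_subset_alive hv)
    refine (measure_mono fun c hc => hc.2).trans ((measure_union_le _ _).trans ?_)
    rw [← hr2, show (3 : ENNReal) = 2 + 1 by norm_num, add_mul, one_mul]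
    exact add_le_add
      (phaseLaw_badSample_le h0 hε1 hr1 (hWS v hv) (hx v hv) i t (hxb t ht v hv))
      (phaseLaw_badThresholds_le h0 hε1 hr1 hWS hv (hx v hv) i t (hxb t ht v hv))
  calc phaseLaw V ε {c | ¬ PhaseGood G w ε σ (c.2 m) c.1}
      ≤ phaseLaw V ε ({T | ¬ ValidThresholds ε T} ×ˢ Set.univ) +
          phaseLaw V ε (⋃ j ∈ J, Bad j) := (measure_mono hsub).trans (measure_union_le _ _)
    _ = phaseLaw V ε (⋃ j ∈ J, Bad j) := by rw [hnull, zero_add]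
    _ ≤ ∑ j ∈ J, phaseLaw V ε (Bad j) := measure_biUnion_finset_le _ _
    _ ≤ ∑ _j ∈ J, 3 * ENNReal.ofReal (Real.exp (-((m : ℝ) ^ (0.4 : ℝ) / 4))) :=
        Finset.sum_le_sum hB
    _ = _ := by
        rw [Finset.sum_const, nsmul_eq_mul, hJ, Finset.card_product, Finset.card_product,
          Finset.card_univ, Finset.card_univ, Fintype.card_fin, Finset.card_range]
        push_cast
        ring

end PhaseProbability

/-! ### Weak duality -/

section Duality

variable {V : Type*} [Fintype V] {G : SimpleGraph V} {w : V → ℝ} {ε : ℝ}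

omit [Fintype V] in
lemma load_eq_sum_ite (S : Finset V) (x : Sym2 V → ℝ) (v : V) :
    load G S x v = ∑ u ∈ S, if G.Adj v u then x s(v, u) else 0 := by
  rw [load, nbrs, Finset.sum_filter]

/-- Complementary slackness up to a factor: a set of vertices that are almost tight for a fractional
matching weighs at most about twice as much as any vertex cover. -/
lemma weight_le_of_fractional_matching (h0 : 0 < ε) (h1 : ε < 1 / 16) {x : Sym2 V → ℝ}
    (hx : ∀ u v, G.Adj u v → 0 ≤ x s(u, v)) (hle : ∀ v, load G Finset.univ x v ≤ w v)
    (C : Finset V) (hC : ∀ v ∈ C, (1 - 5 * ε) * w v ≤ load G Finset.univ x v) :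
    weight w C ≤ (2 + 30 * ε) * OPT G w := by
  obtain ⟨D, hD, hopt⟩ := (isLeast_OPT G w).1
  rw [hopt]
  set g : V → V → ℝ := fun v u => if G.Adj v u then x s(v, u) else 0 with hg
  have hg0 : ∀ v u, 0 ≤ g v u := by
    intro v u
    simp only [hg]
    split_ifs with h
    · exact hx v u h
    · exact le_rfl
  have hgs : ∀ v u, g v u = g u v := fun v u => by simp only [hg, G.adj_comm v u, Sym2.eq_swap]
  have hl : ∀ v, load G Finset.univ x v = ∑ u, g v u := load_eq_sum_ite _ x
  have hcover : ∀ v u, g v u ≤ (if v ∈ D then g v u else 0) + (if u ∈ D then g u v else 0) := by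
    intro v u
    have a := hg0 v u
    by_cases h : G.Adj v u
    · rcases hD h with hv | hv
      · rw [if_pos (Finset.mem_coe.1 hv)]
        have : 0 ≤ if u ∈ D then g u v else 0 := by split_ifs <;> [exact hg0 u v; exact le_rfl]
        linarith
      · rw [if_pos (Finset.mem_coe.1 hv), hgs u v]
        have : 0 ≤ if v ∈ D then g v u else 0 := by split_ifs <;> [exact hg0 v u; exact le_rfl]
        linarith
    · have hz : g v u = 0 := if_neg h
      rw [hgs u v, hz]
      simp
  have hsum : ∑ v, ∑ u, g v u ≤ 2 * ∑ v ∈ D, ∑ u, g v u := by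
    have hD' : ∑ v, ∑ u, (if v ∈ D then g v u else 0) = ∑ v ∈ D, ∑ u, g v u := by
      rw [← Finset.sum_filter_add_sum_filter_not Finset.univ (· ∈ D)]
      rw [Finset.sum_eq_zero (s := Finset.univ.filter (· ∉ D))]
      · rw [add_zero, Finset.filter_univ_mem]
        exact Finset.sum_congr rfl fun v hv => Finset.sum_congr rfl fun u _ => if_pos hv
      · exact fun v hv => Finset.sum_eq_zero fun u _ => if_neg (Finset.mem_filter.1 hv).2
    calc ∑ v, ∑ u, g v u
        ≤ ∑ v, ∑ u, ((if v ∈ D then g v u else 0) + (if u ∈ D then g u v else 0)) :=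
          Finset.sum_le_sum fun v _ => Finset.sum_le_sum fun u _ => hcover v u
      _ = 2 * ∑ v ∈ D, ∑ u, g v u := by
          simp only [Finset.sum_add_distrib]
          rw [Finset.sum_comm (f := fun v u => if u ∈ D then g u v else 0), hD', two_mul]
  have hC' : (1 - 5 * ε) * weight w C ≤ 2 * weight w D := by
    calc (1 - 5 * ε) * weight w C = ∑ v ∈ C, (1 - 5 * ε) * w v := Finset.mul_sum _ _ _
      _ ≤ ∑ v ∈ C, ∑ u, g v u := Finset.sum_le_sum fun v hv => (hC v hv).trans_eq (hl v)
      _ ≤ ∑ v, ∑ u, g v u := Finset.sum_le_sum_of_subset_of_nonneg (Finset.subset_univ C)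
          fun v _ _ => Finset.sum_nonneg fun u _ => hg0 v u
      _ ≤ 2 * ∑ v ∈ D, ∑ u, g v u := hsum
      _ ≤ 2 * weight w D := by
          refine mul_le_mul_of_nonneg_left ?_ zero_le_two
          exact Finset.sum_le_sum fun v _ => (hl v).symm.trans_le (hle v)
  have hD0 : 0 ≤ weight w D := Finset.sum_nonneg fun v _ =>
    (Finset.sum_nonneg fun u _ => hg0 v u).trans ((hl v).symm.trans_le (hle v))
  have hq : 2 * weight w D ≤ (1 - 5 * ε) * ((2 + 30 * ε) * weight w D) := by
    have : (1 - 5 * ε) * ((2 + 30 * ε) * weight w D) - 2 * weight w D =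
        10 * ε * (2 - 15 * ε) * weight w D := by ring
    have : 0 ≤ 10 * ε * (2 - 15 * ε) * weight w D :=
      mul_nonneg (mul_nonneg (by linarith) (by linarith)) hD0
    linarith
  exact le_of_mul_le_mul_left (hC'.trans hq) (by linarith)

end Duality

/-! ### Invariants of the loop -/

section Invariants

variable {V : Type*} [Fintype V] {G : SimpleGraph V} {w : V → ℝ} {ε : ℝ} {σ : RunState V}

/-- Frozen edges have nonnegative weight, and nonfrozen vertices have positive residual weight. This
holds throughout every run. -/
structure Feasible (G : SimpleGraph V) (w : V → ℝ) (σ : RunState V) : Prop where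
  nonneg : ∀ u v, G.Adj u v → Touches σ.frozen s(u, v) → 0 ≤ σ.x s(u, v)
  resWeight_pos : ∀ v ∈ alive σ, 0 < resWeight G w σ v

/-- The constraints of the frozen vertices are satisfied and almost tight. This holds as long as the
phases succeed. -/
def AlmostTight (G : SimpleGraph V) (w : V → ℝ) (ε : ℝ) (σ : RunState V) : Prop :=
  ∀ v ∈ σ.frozen, 0 ≤ resWeight G w σ v ∧ resWeight G w σ v ≤ 5 * ε * w v

lemma mem_alive {v : V} : v ∈ alive σ ↔ v ∉ σ.frozen := by simp [alive]

lemma mem_inactive_iff {v : V} : v ∈ inactive G σ ↔ v ∈ alive σ ∧ v ∉ high G σ := by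
  simp only [inactive, high, Finset.mem_filter, not_and, not_le]
  tauto

lemma feasible_init (hw : ∀ v, 0 < w v) : Feasible G w (⟨∅, 0⟩ : RunState V) :=
  ⟨fun _ _ _ _ => le_rfl, fun v _ => by simpa [resWeight] using hw v⟩

lemma almostTight_init : AlmostTight G w ε (⟨∅, 0⟩ : RunState V) :=
  fun v hv => absurd hv (Finset.notMem_empty v)

lemma Feasible.resWeight_le (hσ : Feasible G w σ) (v : V) : resWeight G w σ v ≤ w v := by
  refine sub_le_self _ (Finset.sum_nonneg fun u hu => ?_)
  rw [Finset.mem_filter, mem_nbrs] at hu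
  exact hσ.nonneg v u hu.1.2 hu.2

lemma resWeight_of_mem_frozen {v : V} (hv : v ∈ σ.frozen) :
    resWeight G w σ v = w v - load G Finset.univ σ.x v := by
  rw [resWeight, load, Finset.filter_true_of_mem fun u _ => touches_mk.2 (.inl hv)]

variable {m : ℕ+} {p : V → Fin m} {T : V → ℕ → ℝ}

lemma mem_phase_frozen {v : V} : v ∈ (phase G w ε σ p T).frozen ↔ v ∈ σ.frozen ∨
    v ∈ localFrozen G w ε σ p T (numIter m) ∨ v ∈ high G σ ∧
      v ∉ localFrozen G w ε σ p T (numIter m) ∧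
      resWeight G w σ v ≤ load G (high G σ) (phaseWeight G w ε σ p T) v := by
  simp only [phase, Finset.mem_union, Finset.mem_filter, or_assoc]

lemma mem_high_of_mem_phase_frozen {v : V} (hv : v ∈ alive σ)
    (hv' : v ∈ (phase G w ε σ p T).frozen) : v ∈ high G σ := by
  rcases mem_phase_frozen.1 hv' with h | h | h
  · exact absurd h (mem_alive.1 hv)
  · exact localFrozen_subset _ h
  · exact h.1

lemma alive_phase_subset : alive (phase G w ε σ p T) ⊆ alive σ := fun _ hv =>
  mem_alive.2 fun h => mem_alive.1 hv (mem_phase_frozen.2 (.inl h))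

lemma phase_x_of_mem_frozen {u v : V} (hu : u ∈ σ.frozen) :
    (phase G w ε σ p T).x s(v, u) = σ.x s(v, u) := by
  have hu1 : u ∉ high G σ := fun h => mem_alive.1 (high_subset_alive h) hu
  have hu2 : u ∉ inactive G σ := fun h => mem_alive.1 (mem_inactive_iff.1 h).1 hu
  have e : ¬ (Touches (high G σ) s(v, u) ∧ Touches (inactive G σ) s(v, u)) := by
    rw [touches_mk, touches_mk, mem_inactive_iff]
    tauto
  simp only [phase]
  rw [if_neg (by rw [inside_mk]; tauto), if_neg e]

lemma phase_x_of_mem_high {u v : V} (hu : u ∈ high G σ) (hv : v ∈ high G σ) :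
    (phase G w ε σ p T).x s(v, u) = phaseWeight G w ε σ p T s(v, u) := by
  simp only [phase]
  rw [if_pos (inside_mk.2 ⟨hv, hu⟩)]

lemma phase_x_of_mem_inactive {u v : V} (hu : u ∈ inactive G σ) (hv : v ∈ high G σ) :
    (phase G w ε σ p T).x s(v, u) = 0 := by
  have hu1 := (mem_inactive_iff.1 hu).2
  simp only [phase]
  rw [if_neg (by rw [inside_mk]; tauto),
    if_pos ⟨touches_mk.2 (.inl hv), touches_mk.2 (.inr hu)⟩]

/-- The residual weight of a nonfrozen vertex decreases by the weight of the edges that are frozen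
in the phase. -/
lemma resWeight_phase {v : V} (hv : v ∈ alive σ) :
    resWeight G w (phase G w ε σ p T) v = resWeight G w σ v -
      ∑ u ∈ nbrs G (alive σ) v with Touches (phase G w ε σ p T).frozen s(v, u),
        (phase G w ε σ p T).x s(v, u) := by
  set σ' := phase G w ε σ p T with hσ'
  have hsplit := Finset.sum_filter_add_sum_filter_not
    {u ∈ nbrs G Finset.univ v | Touches σ'.frozen s(v, u)} (· ∈ σ.frozen) fun u => σ'.x s(v, u)
  have e1 : ∑ u ∈ {u ∈ nbrs G Finset.univ v | Touches σ'.frozen s(v, u)} with u ∈ σ.frozen,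
      σ'.x s(v, u) = ∑ u ∈ nbrs G Finset.univ v with Touches σ.frozen s(v, u), σ.x s(v, u) := by
    refine Finset.sum_congr ?_ fun u hu => ?_
    · ext u
      have h1 : u ∈ σ.frozen → u ∈ σ'.frozen := fun h => mem_phase_frozen.2 (.inl h)
      have h2 := mem_alive.1 hv
      simp only [Finset.mem_filter, touches_mk]
      tauto
    · have h2 := mem_alive.1 hv
      simp only [Finset.mem_filter, touches_mk, h2, false_or] at hu
      exact phase_x_of_mem_frozen hu.2
  have e2 : ∑ u ∈ {u ∈ nbrs G Finset.univ v | Touches σ'.frozen s(v, u)} with u ∉ σ.frozen,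
      σ'.x s(v, u) = ∑ u ∈ nbrs G (alive σ) v with Touches σ'.frozen s(v, u), σ'.x s(v, u) := by
    refine Finset.sum_congr ?_ fun u hu => rfl
    ext u
    simp only [Finset.mem_filter, mem_nbrs, mem_alive, Finset.mem_univ, true_and]
    tauto
  rw [resWeight, resWeight, ← hsplit, e1, e2]
  ring

lemma resWeight_phase_of_mem_frozen {v : V} (hv : v ∈ σ.frozen) :
    resWeight G w (phase G w ε σ p T) v = resWeight G w σ v := by
  rw [resWeight_of_mem_frozen hv, resWeight_of_mem_frozen (mem_phase_frozen.2 (.inl hv))]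
  congr 1
  refine Finset.sum_congr rfl fun u _ => ?_
  rw [Sym2.eq_swap, phase_x_of_mem_frozen hv]

lemma resWeight_phase_of_newly_frozen {v : V} (hv : v ∈ alive σ)
    (hv' : v ∈ (phase G w ε σ p T).frozen) : resWeight G w (phase G w ε σ p T) v =
      resWeight G w σ v - load G (high G σ) (phaseWeight G w ε σ p T) v := by
  have hvh := mem_high_of_mem_phase_frozen hv hv'
  rw [resWeight_phase hv, Finset.filter_true_of_mem fun u _ => touches_mk.2 (.inl hv')]
  congr 1
  refine (Finset.sum_subset_zero_on_sdiff (nbrs_mono high_subset_alive v) (fun u hu => ?_)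
    fun u hu => ?_).symm
  · rw [Finset.mem_sdiff, mem_nbrs, mem_nbrs] at hu
    exact phase_x_of_mem_inactive (mem_inactive_iff.2 ⟨hu.1.1, fun h => hu.2 ⟨h, hu.1.2⟩⟩) hvh
  · exact (phase_x_of_mem_high (mem_nbrs.1 hu).1 hvh).symm

lemma phaseWeight_nonneg (h1 : ε < 1) (hd : 0 < avgDeg G σ) (hσ : Feasible G w σ) {u v : V}
    (hu : u ∈ high G σ) (hv : v ∈ high G σ) : 0 ≤ phaseWeight G w ε σ p T s(u, v) :=
  div_nonneg (initWeight_pos hd hσ.resWeight_pos hu hv).le (pow_nonneg (by linarith) _)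

lemma load_phaseWeight_lt {v : V} (hv : v ∈ high G σ)
    (hv' : v ∈ alive (phase G w ε σ p T)) :
    load G (high G σ) (phaseWeight G w ε σ p T) v < resWeight G w σ v := by
  by_contra! h
  refine mem_alive.1 hv' (mem_phase_frozen.2 (.inr ?_))
  by_cases hF : v ∈ localFrozen G w ε σ p T (numIter m)
  · exact .inl hF
  · exact .inr ⟨hv, hF, h⟩

lemma Feasible.phase (h1 : ε < 1) (hd : 0 < avgDeg G σ) (hσ : Feasible G w σ) :
    Feasible G w (phase G w ε σ p T) := by
  constructor
  · intro u v huv ht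
    by_cases hold : Touches σ.frozen s(u, v)
    · rcases touches_mk.1 hold with h | h
      · rw [Sym2.eq_swap, phase_x_of_mem_frozen h, Sym2.eq_swap]
        exact hσ.nonneg u v huv hold
      · rw [phase_x_of_mem_frozen h]
        exact hσ.nonneg u v huv hold
    · rw [touches_mk, not_or, ← mem_alive, ← mem_alive] at hold
      have key : ∀ a b : V, a ∈ alive σ → b ∈ alive σ → a ∈ (MWVC.phase G w ε σ p T).frozen →
          0 ≤ (MWVC.phase G w ε σ p T).x s(a, b) := by
        intro a b ha hb haF
        have hah := mem_high_of_mem_phase_frozen ha haF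
        by_cases hbh : b ∈ high G σ
        · rw [phase_x_of_mem_high hbh hah]
          exact phaseWeight_nonneg h1 hd hσ hah hbh
        · rw [phase_x_of_mem_inactive (mem_inactive_iff.2 ⟨hb, hbh⟩) hah]
      rcases touches_mk.1 ht with h | h
      · exact key u v hold.1 hold.2 h
      · rw [Sym2.eq_swap]
        exact key v u hold.2 hold.1 h
  · intro v hv
    have hva := alive_phase_subset hv
    rw [resWeight_phase hva, sub_pos]
    have hvF := mem_alive.1 hv
    by_cases hvh : v ∈ high G σ
    · refine lt_of_le_of_lt ?_ (load_phaseWeight_lt hvh hv)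
      have hsub : {u ∈ nbrs G (alive σ) v | Touches (MWVC.phase G w ε σ p T).frozen s(v, u)} ⊆
          nbrs G (high G σ) v := by
        intro u hu
        rw [Finset.mem_filter, mem_nbrs, touches_mk] at hu
        exact mem_nbrs.2 ⟨mem_high_of_mem_phase_frozen hu.1.1 (hu.2.resolve_left hvF), hu.1.2⟩
      calc _ = ∑ u ∈ nbrs G (alive σ) v with Touches (MWVC.phase G w ε σ p T).frozen s(v, u),
              phaseWeight G w ε σ p T s(v, u) := Finset.sum_congr rfl fun u hu =>
            phase_x_of_mem_high (mem_nbrs.1 (hsub hu)).1 hvh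
        _ ≤ _ := Finset.sum_le_sum_of_subset_of_nonneg hsub fun u hu _ =>
            phaseWeight_nonneg h1 hd hσ hvh (mem_nbrs.1 hu).1
    · refine lt_of_eq_of_lt (Finset.sum_eq_zero fun u hu => ?_) (hσ.resWeight_pos v hva)
      rw [Finset.mem_filter, mem_nbrs, touches_mk] at hu
      rw [Sym2.eq_swap]
      exact phase_x_of_mem_inactive (mem_inactive_iff.2 ⟨hva, hvh⟩)
        (mem_high_of_mem_phase_frozen hu.1.1 (hu.2.resolve_left hvF))

lemma AlmostTight.phase (h0 : 0 < ε) (hw : ∀ v, 0 < w v) (hσ : Feasible G w σ)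
    (ht : AlmostTight G w ε σ) (hg : PhaseGood G w ε σ p T) :
    AlmostTight G w ε (phase G w ε σ p T) := by
  intro v hv'
  by_cases hv : v ∈ σ.frozen
  · rw [resWeight_phase_of_mem_frozen hv]
    exact ht v hv
  · have hva := mem_alive.2 hv
    rw [resWeight_phase_of_newly_frozen hva hv']
    obtain ⟨g1, g2⟩ := hg v (mem_high_of_mem_phase_frozen hva hv')
    refine ⟨sub_nonneg.2 g1, ?_⟩
    have hle : 5 * ε * resWeight G w σ v ≤ 5 * ε * w v :=
      mul_le_mul_of_nonneg_left (hσ.resWeight_le v) (by linarith)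
    rcases mem_phase_frozen.1 hv' with h | h | h
    · exact absurd h hv
    · linarith [g2 h]
    · have := mul_pos (show 0 < 5 * ε by linarith) (hw v)
      linarith [h.2.2]

end Invariants

/-! ### The final run -/

section Final

variable {V : Type*} [Fintype V] {G : SimpleGraph V} {w : V → ℝ} {ε : ℝ} {σ : RunState V}

/-- The weights of the loop on the frozen edges and those of the final run on the other edges form a
fractional matching of the whole graph. -/
lemma exists_finishReturns (h0 : 0 < ε) (h1 : ε < 1 / 16) (hw : ∀ v, 0 < w v)
    (hσ : Feasible G w σ) (ht : AlmostTight G w ε σ) {x₀ : Sym2 V → ℝ} {T : V → ℕ → ℝ}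
    (hx : ValidInit G (alive σ) (resWeight G w σ) x₀) (hT : ValidThresholds ε T) :
    ∃ C : Finset V, FinishReturns G w ε σ x₀ T C ∧ G.IsVertexCover (C : Set V) ∧
      weight w C ≤ (2 + 30 * ε) * OPT G w := by
  have hε1 : ε < 1 := by linarith
  have hW : ∀ v ∈ alive σ, 0 ≤ resWeight G w σ v := fun v hv => (hσ.resWeight_pos v hv).le
  obtain ⟨C', hC'⟩ := exists_centralReturns h0 hε1 hT hW hx
  refine ⟨σ.frozen ∪ C', ⟨C', hC', rfl⟩, ?_, ?_⟩
  · obtain ⟨N, -, hN, rfl⟩ := hC'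
    intro u v huv
    by_contra! hcon
    simp only [Finset.coe_union, Set.mem_union, Finset.mem_coe, not_or] at hcon
    exact hN ⟨u, mem_alive.2 hcon.1.1, v, mem_alive.2 hcon.2.1, huv, hcon.1.2, hcon.2.2⟩
  · obtain ⟨N, -, -, rfl⟩ := hC'
    set ρ := centralRun G (alive σ) (resWeight G w σ) ε x₀ T N with hρ
    have hx0 : ∀ v ∈ alive σ, ∀ u ∈ nbrs G (alive σ) v, 0 ≤ x₀ s(v, u) := fun v hv u hu =>
      (hx.1 v hv u (mem_nbrs.1 hu).1 (mem_nbrs.1 hu).2).le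
    set x : Sym2 V → ℝ := fun e => if Touches σ.frozen e then σ.x e else ρ.x e with hxdef
    have hfro : ∀ v ∈ σ.frozen, load G Finset.univ x v = w v - resWeight G w σ v := by
      intro v hv
      rw [resWeight_of_mem_frozen hv, sub_sub_cancel]
      exact Finset.sum_congr rfl fun u _ => if_pos (touches_mk.2 (.inl hv))
    have hali : ∀ v ∈ alive σ, load G Finset.univ x v =
        w v - resWeight G w σ v + load G (alive σ) ρ.x v := by
      intro v hv
      have hv' := mem_alive.1 hv
      rw [resWeight, sub_sub_cancel, load,
        ← Finset.sum_filter_add_sum_filter_not _ fun u => Touches σ.frozen s(v, u)]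
      congr 1
      · exact Finset.sum_congr rfl fun u hu => if_pos (Finset.mem_filter.1 hu).2
      · refine Finset.sum_congr ?_ fun u hu => if_neg ?_
        · ext u
          simp only [Finset.mem_filter, mem_nbrs, touches_mk, mem_alive, Finset.mem_univ, true_and]
          tauto
        · rw [mem_nbrs, mem_alive] at hu
          rw [touches_mk]
          tauto
    have hcl : ∀ v ∈ alive σ, load G (alive σ) ρ.x v ≤ resWeight G w σ v := fun v hv =>
      load_centralRun_le h0 hε1 hT hx0 hW hx.2 N hv
    refine weight_le_of_fractional_matching h0 h1 (x := x) (fun u v huv => ?_) (fun v => ?_) _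
      fun v hv => ?_
    · simp only [hxdef]
      split_ifs with h
      · exact hσ.nonneg u v huv h
      · rw [touches_mk, not_or, ← mem_alive, ← mem_alive] at h
        exact primalDual_x_nonneg hε1 N (hx0 u h.1 v (mem_nbrs.2 ⟨h.2, huv⟩))
    · by_cases hv : v ∈ σ.frozen
      · rw [hfro v hv]
        linarith [(ht v hv).1]
      · rw [hali v (mem_alive.2 hv)]
        linarith [hcl v (mem_alive.2 hv)]
    · by_cases hvF : v ∈ σ.frozen
      · rw [hfro v hvF]
        linarith [(ht v hvF).2]
      · have hva := mem_alive.2 hvF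
        have hvC := (Finset.mem_union.1 hv).resolve_left hvF
        have e1 := le_load_centralRun hT hW N hvC
        have e2 := mul_le_mul_of_nonneg_left (hσ.resWeight_le v) h0.le
        have e3 := mul_pos h0 (hw v)
        rw [hali v hva]
        linarith

end Final

/-! ### Progress of the loop -/

section Progress

variable {V : Type*} [Fintype V] {G : SimpleGraph V} {w : V → ℝ} {ε : ℝ} {σ : RunState V}
  {m : ℕ+} {p : V → Fin m} {T : V → ℕ → ℝ}

/-- Orient each surviving edge of `G[V^high]` away from the endpoint that determines its initial
weight. Since the weight of the edge grew in all iterations, few edges can leave a vertex without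
violating its constraint. -/
lemma card_out_le (h0 : 0 < ε) (h1 : ε < 1) (hd : 0 < avgDeg G σ) (hσ : Feasible G w σ) {v : V}
    (hv : v ∈ high G σ) (hv' : v ∈ alive (phase G w ε σ p T)) :
    (({u ∈ nbrs G (high G σ) v | u ∈ alive (phase G w ε σ p T) ∧
      resWeight G w σ v / deg G σ v ≤ resWeight G w σ u / deg G σ u} : Finset V).card : ℝ) ≤
      deg G σ v * (1 - ε) ^ numIter m := by
  set N : Finset V := {u ∈ nbrs G (high G σ) v | u ∈ alive (phase G w ε σ p T) ∧
      resWeight G w σ v / deg G σ v ≤ resWeight G w σ u / deg G σ u} with hN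
  have hWv := hσ.resWeight_pos v (high_subset_alive hv)
  have hdeg := deg_pos_of_mem_high hd hv
  have hnot : ∀ u ∈ alive (phase G w ε σ p T), u ∉ localFrozen G w ε σ p T (numIter m) :=
    fun u hu h => mem_alive.1 hu (mem_phase_frozen.2 (.inr (.inl h)))
  have hw : ∀ u ∈ N, phaseWeight G w ε σ p T s(v, u) =
      resWeight G w σ v / deg G σ v * (1 - ε)⁻¹ ^ numIter m := by
    intro u hu
    have hu' := (Finset.mem_filter.1 hu).2
    rw [phaseWeight_mk h0.le h1, growth_of_notMem localFrozen_monotone (hnot v hv'),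
      growth_of_notMem localFrozen_monotone (hnot u hu'.1), min_self, initWeight_mk,
      min_eq_left hu'.2]
  have hsum : ∑ u ∈ N, phaseWeight G w ε σ p T s(v, u) ≤
      load G (high G σ) (phaseWeight G w ε σ p T) v :=
    Finset.sum_le_sum_of_subset_of_nonneg (Finset.filter_subset _ _) fun u hu _ =>
      phaseWeight_nonneg h1 hd hσ hv (mem_nbrs.1 hu).1
  rw [Finset.sum_congr rfl hw, Finset.sum_const, nsmul_eq_mul] at hsum
  have hlt := hsum.trans (load_phaseWeight_lt hv hv').le
  have hpow : (0 : ℝ) < (1 - ε) ^ numIter m := pow_pos (by linarith) _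
  rw [inv_pow] at hlt
  have : (N.card : ℝ) * (resWeight G w σ v / deg G σ v * ((1 - ε) ^ numIter m)⁻¹) =
      (N.card : ℝ) / (deg G σ v * (1 - ε) ^ numIter m) * resWeight G w σ v := by
    field_simp
  rw [this] at hlt
  have hone := le_of_mul_le_mul_right (hlt.trans_eq (one_mul _).symm) hWv
  rwa [div_le_one (by positivity)] at hone

lemma sum_deg_eq_sum_ite (σ : RunState V) :
    ∑ v ∈ alive σ, (deg G σ v : ℝ) =
      ∑ v ∈ alive σ, ∑ u ∈ alive σ, if G.Adj v u then (1 : ℝ) else 0 := by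
  refine Finset.sum_congr rfl fun v _ => ?_
  rw [deg, nbrs, Finset.sum_boole]

lemma avgDeg_phase_le (h0 : 0 < ε) (h1 : ε < 1) (hd : 0 < avgDeg G σ) (hσ : Feasible G w σ) :
    avgDeg G (phase G w ε σ p T) ≤
      2 * avgDeg G σ ^ (0.95 : ℝ) + 2 * (1 - ε) ^ numIter m * avgDeg G σ := by
  set σ' := phase G w ε σ p T with hσ'
  set f : V → ℝ := fun v => resWeight G w σ v / deg G σ v with hf
  have hn : (0 : ℝ) < Fintype.card V := by
    by_contra h
    have : (Fintype.card V : ℝ) = 0 := le_antisymm (not_lt.1 h) (Nat.cast_nonneg _)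
    rw [avgDeg, this, div_zero] at hd
    exact lt_irrefl _ hd
  -- an edge is charged to an inactive endpoint, or else to the tail of its orientation
  set b : V → V → ℝ := fun v u =>
    if G.Adj v u ∧ (v ∈ inactive G σ ∨ v ∈ high G σ ∧ u ∈ high G σ ∧ f v ≤ f u) then 1 else 0
    with hb
  have hb0 : ∀ v u, 0 ≤ b v u := fun v u => by
    simp only [hb]
    split_ifs <;> norm_num
  have hab : ∀ v ∈ alive σ', ∀ u ∈ alive σ',
      (if G.Adj v u then (1 : ℝ) else 0) ≤ b v u + b u v := by
    intro v hv u hu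
    by_cases h : G.Adj v u
    swap
    · rw [if_neg h]
      exact add_nonneg (hb0 _ _) (hb0 _ _)
    rw [if_pos h]
    have hone : ∀ {a c : V}, G.Adj a c ∧ (a ∈ inactive G σ ∨
        a ∈ high G σ ∧ c ∈ high G σ ∧ f a ≤ f c) → b a c = 1 := fun h => if_pos h
    have hva := alive_phase_subset hv
    have hua := alive_phase_subset hu
    by_cases hvi : v ∈ inactive G σ
    · linarith [hone ⟨h, .inl hvi⟩, hb0 u v]
    by_cases hui : u ∈ inactive G σ
    · linarith [hone ⟨h.symm, .inl hui⟩, hb0 v u]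
    rw [mem_inactive_iff, not_and, not_not] at hvi hui
    rcases le_total (f v) (f u) with hle | hle
    · linarith [hone ⟨h, .inr ⟨hvi hva, hui hua, hle⟩⟩, hb0 u v]
    · linarith [hone ⟨h.symm, .inr ⟨hui hua, hvi hva, hle⟩⟩, hb0 v u]
  have hout : ∀ v ∈ alive σ', ∑ u ∈ alive σ', b v u ≤
      avgDeg G σ ^ (0.95 : ℝ) + (1 - ε) ^ numIter m * deg G σ v := by
    intro v hv
    have hva := alive_phase_subset hv
    have hpow : (0 : ℝ) ≤ (1 - ε) ^ numIter m := pow_nonneg (by linarith) _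
    rw [hb, Finset.sum_boole]
    by_cases hvh : v ∈ high G σ
    · have hvi : v ∉ inactive G σ := fun h => (mem_inactive_iff.1 h).2 hvh
      refine le_trans ?_ ((card_out_le (p := p) (T := T) h0 h1 hd hσ hvh hv).trans ?_)
      · refine Nat.cast_le.2 (Finset.card_le_card fun u hu => ?_)
        simp only [Finset.mem_filter, hvi, false_or] at hu
        exact Finset.mem_filter.2 ⟨mem_nbrs.2 ⟨hu.2.2.2.1, hu.2.1⟩, hu.1, hu.2.2.2.2⟩
      · have : 0 ≤ avgDeg G σ ^ (0.95 : ℝ) := Real.rpow_nonneg hd.le _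
        linarith [mul_comm ((1 - ε) ^ numIter m) (deg G σ v : ℝ)]
    · have hvi := (Finset.mem_filter.1 (mem_inactive_iff.2 ⟨hva, hvh⟩)).2
      have : ((Finset.filter (fun u => G.Adj v u ∧ (v ∈ inactive G σ ∨
          v ∈ high G σ ∧ u ∈ high G σ ∧ f v ≤ f u)) (alive σ')).card : ℝ) ≤ deg G σ v := by
        refine Nat.cast_le.2 (Finset.card_le_card fun u hu => ?_)
        rw [Finset.mem_filter] at hu
        exact mem_nbrs.2 ⟨alive_phase_subset hu.1, hu.2.1⟩
      have h3 : 0 ≤ (1 - ε) ^ numIter m * (deg G σ v : ℝ) := mul_nonneg hpow (Nat.cast_nonneg _)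
      linarith
  have hsum : ∑ v ∈ alive σ', (deg G σ' v : ℝ) ≤
      2 * ∑ v ∈ alive σ', (avgDeg G σ ^ (0.95 : ℝ) + (1 - ε) ^ numIter m * deg G σ v) := by
    calc ∑ v ∈ alive σ', (deg G σ' v : ℝ)
        ≤ ∑ v ∈ alive σ', ∑ u ∈ alive σ', (b v u + b u v) := by
          rw [sum_deg_eq_sum_ite]
          exact Finset.sum_le_sum fun v hv => Finset.sum_le_sum fun u hu => hab v hv u hu
      _ = 2 * ∑ v ∈ alive σ', ∑ u ∈ alive σ', b v u := by
          simp only [Finset.sum_add_distrib]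
          rw [Finset.sum_comm (f := fun v u => b u v), two_mul]
      _ ≤ _ := mul_le_mul_of_nonneg_left (Finset.sum_le_sum hout) zero_le_two
  have hbound : ∑ v ∈ alive σ', (avgDeg G σ ^ (0.95 : ℝ) + (1 - ε) ^ numIter m * deg G σ v) ≤
      Fintype.card V * avgDeg G σ ^ (0.95 : ℝ) +
        (1 - ε) ^ numIter m * (avgDeg G σ * Fintype.card V) := by
    have e1 : avgDeg G σ * Fintype.card V = ∑ v ∈ alive σ, (deg G σ v : ℝ) := by
      rw [avgDeg, div_mul_cancel₀ _ hn.ne']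
    rw [Finset.sum_add_distrib, ← Finset.mul_sum, Finset.sum_const, nsmul_eq_mul, e1]
    refine add_le_add ?_ (mul_le_mul_of_nonneg_left ?_ (pow_nonneg (by linarith) _))
    · exact mul_le_mul_of_nonneg_right (Nat.cast_le.2 (Finset.card_le_univ _))
        (Real.rpow_nonneg hd.le _)
    · exact Finset.sum_le_sum_of_subset_of_nonneg alive_phase_subset
        fun v _ _ => Nat.cast_nonneg _
  rw [avgDeg, div_le_iff₀ hn]
  linarith

end Progress

/-! ### Choice of the size threshold -/

section Asymptotics

/-- What the analysis needs to know about the size of the input, as a lower bound on `log n`. -/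
structure LargeEnough (ε c L : ℝ) : Prop where
  two_le : 2 ≤ L
  deg_large : 8 ^ 20 ≤ L
  exponent_large : 4 * (c + 6) ≤ L
  accuracy : ∀ m : ℕ+, L ≤ m → 5 / ε ≤ (m : ℝ) ^ (0.1 : ℝ)
  iterations : ∀ m : ℕ+, L ≤ m → (1 - ε) ^ numIter m ≤ 1 / 8

lemma exists_largeEnough {ε : ℝ} (h0 : 0 < ε) (h1 : ε < 1) (c : ℝ) :
    ∃ L₀ : ℝ, ∀ L, L₀ ≤ L → LargeEnough ε c L := by
  obtain ⟨k, hk⟩ := exists_pow_lt_of_lt_one (show (0 : ℝ) < 1 / 8 by norm_num)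
    (show 1 - ε < 1 by linarith)
  refine ⟨max (max 2 (8 ^ 20)) (max (4 * (c + 6))
    (max ((5 / ε) ^ 10) (Real.exp (k * (10 * Real.log 15))))), fun L hL => ?_⟩
  simp only [max_le_iff] at hL
  obtain ⟨⟨a1, a2⟩, a3, a4, a5⟩ := hL
  refine ⟨a1, a2, a3, fun m hm => ?_, fun m hm => ?_⟩
  · have h5 : 0 ≤ 5 / ε := by positivity
    have : ((5 / ε) ^ 10) ^ (0.1 : ℝ) = 5 / ε := by
      rw [← Real.rpow_natCast, ← Real.rpow_mul h5]
      norm_num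
    rw [← this]
    exact Real.rpow_le_rpow (by positivity) (a4.trans hm) (by norm_num)
  · have hm0 : (0 : ℝ) < m := Nat.cast_pos.2 m.pos
    have hl : 0 < Real.log 15 := Real.log_pos (by norm_num)
    have hI : k ≤ numIter m := by
      refine Nat.le_floor ?_
      rw [le_div_iff₀ (by positivity), Real.le_log_iff_exp_le hm0]
      exact a5.trans hm
    exact (pow_le_pow_of_le_one (by linarith) (by linarith) hI).trans hk.le

end Asymptotics

section Sizes

variable {V : Type*} [Fintype V] {G : SimpleGraph V} {w : V → ℝ} {ε c : ℝ} {σ : RunState V}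

lemma avgDeg_le_card (G : SimpleGraph V) (σ : RunState V) : avgDeg G σ ≤ Fintype.card V := by
  refine div_le_of_le_mul₀ (Nat.cast_nonneg _) (Nat.cast_nonneg _) ?_
  calc ∑ v ∈ alive σ, (deg G σ v : ℝ) ≤ ∑ _v ∈ alive σ, (Fintype.card V : ℝ) :=
        Finset.sum_le_sum fun v _ => Nat.cast_le.2 (Finset.card_le_univ _)
    _ ≤ Fintype.card V * Fintype.card V := by
        rw [Finset.sum_const, nsmul_eq_mul]
        exact mul_le_mul_of_nonneg_right (Nat.cast_le.2 (Finset.card_le_univ _))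
          (Nat.cast_nonneg _)

lemma coe_numMachines (hd : 1 ≤ avgDeg G σ) : (numMachines G σ : ℕ) = ⌊√(avgDeg G σ)⌋₊ := by
  have : 0 < ⌊√(avgDeg G σ)⌋₊ := Nat.floor_pos.2 (Real.one_le_sqrt.2 hd)
  rw [numMachines, Nat.toPNat'_coe, if_pos this]

lemma sq_numMachines_le (hd : 1 ≤ avgDeg G σ) : (numMachines G σ : ℝ) ^ 2 ≤ avgDeg G σ := by
  rw [coe_numMachines hd]
  have h := Nat.floor_le (Real.sqrt_nonneg (avgDeg G σ))
  calc _ ≤ √(avgDeg G σ) ^ 2 := pow_le_pow_left₀ (Nat.cast_nonneg _) h 2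
    _ = avgDeg G σ := Real.sq_sqrt (by linarith)

lemma numMachines_le_card (hd : 1 ≤ avgDeg G σ) : (numMachines G σ : ℝ) ≤ Fintype.card V := by
  have h1 : (1 : ℝ) ≤ numMachines G σ := Nat.one_le_cast.2 (numMachines G σ).pos
  have h2 := sq_numMachines_le hd
  have h3 := avgDeg_le_card G σ
  nlinarith

variable (hL : LargeEnough ε c (Real.log (Fintype.card V))) (hloop : LoopCond G σ)
include hL hloop

lemma le_avgDeg : Real.log (Fintype.card V) ≤ avgDeg G σ :=
  (le_self_pow₀ (by linarith [hL.two_le]) (by norm_num)).trans (le_of_lt hloop)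

lemma one_le_avgDeg : 1 ≤ avgDeg G σ := by linarith [le_avgDeg hL hloop, hL.two_le]

lemma pow_le_numMachines : Real.log (Fintype.card V) ^ 14 ≤ numMachines G σ := by
  set L := Real.log (Fintype.card V)
  have h2 := hL.two_le
  rw [coe_numMachines (one_le_avgDeg hL hloop)]
  have h3 : L ^ 15 ≤ √(avgDeg G σ) := by
    refine Real.le_sqrt_of_sq_le ?_
    rw [← pow_mul]
    exact le_of_lt hloop
  have h4 := Nat.lt_floor_add_one √(avgDeg G σ)
  have h5 : 1 ≤ L ^ 14 := one_le_pow₀ (by linarith)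
  have h6 : 2 * L ^ 14 ≤ L ^ 15 := by
    rw [pow_succ L 14, mul_comm]
    exact mul_le_mul_of_nonneg_left h2 (by positivity)
  linarith

lemma le_numMachines : Real.log (Fintype.card V) ≤ numMachines G σ :=
  (le_self_pow₀ (by linarith [hL.two_le]) (by norm_num)).trans (pow_le_numMachines hL hloop)

lemma avgDeg_phase_le_half (h0 : 0 < ε) (h1 : ε < 1) (hσ : Feasible G w σ)
    {p : V → Fin (numMachines G σ)} {T : V → ℕ → ℝ} :
    avgDeg G (phase G w ε σ p T) ≤ avgDeg G σ / 2 := by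
  have hd1 := one_le_avgDeg hL hloop
  have hd : 0 < avgDeg G σ := by linarith
  have hle := avgDeg_phase_le (p := p) (T := T) h0 h1 hd hσ
  have hI := mul_le_mul_of_nonneg_right
    (hL.iterations (numMachines G σ) (le_numMachines hL hloop)) hd.le
  have h8 : 8 ≤ avgDeg G σ ^ (0.05 : ℝ) := by
    have e : ((8 : ℝ) ^ 20) ^ (0.05 : ℝ) = 8 := by
      rw [← Real.rpow_natCast, ← Real.rpow_mul (by norm_num)]
      norm_num
    calc (8 : ℝ) = ((8 : ℝ) ^ 20) ^ (0.05 : ℝ) := e.symm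
      _ ≤ _ := Real.rpow_le_rpow (by norm_num) (hL.deg_large.trans (le_avgDeg hL hloop))
        (by norm_num)
  have hsplit : avgDeg G σ ^ (0.95 : ℝ) * avgDeg G σ ^ (0.05 : ℝ) = avgDeg G σ := by
    rw [← Real.rpow_add hd]
    norm_num
  have hnn : 0 ≤ avgDeg G σ ^ (0.95 : ℝ) := Real.rpow_nonneg hd.le _
  have := mul_le_mul_of_nonneg_left h8 hnn
  linarith

/-- The failure probability of a phase is so small that the union bound over `n` phases leaves
`n ^ (-c)`. -/
lemma phaseLaw_not_phaseGood_le_rpow (h0 : 0 < ε) (h1 : ε ≤ 1 / 16)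
    (hσ : Feasible G w σ) :
    phaseLaw V ε {x | ¬ PhaseGood G w ε σ (x.2 (numMachines G σ)) x.1} ≤
      ENNReal.ofReal (1 / ((Fintype.card V : ℝ) ^ c * Fintype.card V)) := by
  set m := numMachines G σ
  set n := Fintype.card V
  set L := Real.log n with hLdef
  have h2 := hL.two_le
  have hn : (0 : ℝ) < n := by
    rcases Nat.eq_zero_or_pos n with h | h
    · rw [hLdef, h] at h2
      norm_num at h2
    · exact Nat.cast_pos.2 h
  have hd1 := one_le_avgDeg hL hloop
  have hmn := numMachines_le_card hd1
  have hIn : (numIter m : ℝ) ≤ n := (Nat.cast_le.2 (numIter_le m)).trans hmn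
  have hn3 : (n : ENNReal) * m * numIter m * 3 ≤ ENNReal.ofReal (3 * n ^ 3) := by
    have hreal : (n : ℝ) * m * numIter m * 3 ≤ 3 * n ^ 3 := by
      calc (n : ℝ) * m * numIter m * 3 ≤ n * n * n * 3 := by gcongr
        _ = 3 * n ^ 3 := by ring
    refine le_of_eq_of_le ?_ (ENNReal.ofReal_le_ofReal hreal)
    rw [ENNReal.ofReal_mul (by positivity), ENNReal.ofReal_mul (by positivity),
      ENNReal.ofReal_mul (by positivity), ENNReal.ofReal_natCast, ENNReal.ofReal_natCast,
      ENNReal.ofReal_natCast]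
    norm_num
  have hexp : Real.exp (-((m : ℝ) ^ (0.4 : ℝ) / 4)) ≤ Real.exp (-((c + 6) * L)) := by
    refine Real.exp_le_exp.2 (neg_le_neg ?_)
    have e1 : L ^ 2 ≤ (m : ℝ) ^ (0.4 : ℝ) := by
      calc L ^ 2 = L ^ (2 : ℝ) := (Real.rpow_two L).symm
        _ ≤ L ^ (5.6 : ℝ) := Real.rpow_le_rpow_of_exponent_le (by linarith) (by norm_num)
        _ = (L ^ 14) ^ (0.4 : ℝ) := by
            rw [← Real.rpow_natCast, ← Real.rpow_mul (by linarith)]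
            norm_num
        _ ≤ _ := Real.rpow_le_rpow (by positivity) (pow_le_numMachines hL hloop) (by norm_num)
    have e2 := mul_le_mul_of_nonneg_right hL.exponent_large (show 0 ≤ L by linarith)
    nlinarith
  have hnL : (n : ℝ) = Real.exp L := (Real.exp_log hn).symm
  have hfinal : 3 * (n : ℝ) ^ 3 * Real.exp (-((m : ℝ) ^ (0.4 : ℝ) / 4)) ≤
      1 / ((n : ℝ) ^ c * n) := by
    have e3 : (3 : ℝ) ≤ Real.exp L := by linarith [Real.add_one_le_exp L]
    calc 3 * (n : ℝ) ^ 3 * Real.exp (-((m : ℝ) ^ (0.4 : ℝ) / 4))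
        ≤ Real.exp L * (n : ℝ) ^ 3 * Real.exp (-((c + 6) * L)) := by gcongr
      _ = Real.exp (-((c + 2) * L)) := by
          rw [hnL, ← Real.exp_nat_mul, ← Real.exp_add, ← Real.exp_add]
          congr 1
          push_cast
          ring
      _ ≤ Real.exp (-(L * c + L)) := Real.exp_le_exp.2 (by nlinarith)
      _ = 1 / ((n : ℝ) ^ c * n) := by
          rw [Real.rpow_def_of_pos hn, ← hLdef, Real.exp_neg, Real.exp_add, ← hnL, one_div]
  calc phaseLaw V ε {x | ¬ PhaseGood G w ε σ (x.2 m) x.1}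
      ≤ n * m * numIter m * (3 * ENNReal.ofReal (Real.exp (-((m : ℝ) ^ (0.4 : ℝ) / 4)))) :=
        phaseLaw_not_phaseGood_le h0 h1 hσ.resWeight_pos (sq_numMachines_le hd1)
          (hL.accuracy m (le_numMachines hL hloop))
    _ = n * m * numIter m * 3 * ENNReal.ofReal (Real.exp (-((m : ℝ) ^ (0.4 : ℝ) / 4))) := by
        ring
    _ ≤ ENNReal.ofReal (3 * n ^ 3) *
        ENNReal.ofReal (Real.exp (-((m : ℝ) ^ (0.4 : ℝ) / 4))) := by gcongr
    _ = ENNReal.ofReal (3 * n ^ 3 * Real.exp (-((m : ℝ) ^ (0.4 : ℝ) / 4))) :=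
        (ENNReal.ofReal_mul (by positivity)).symm
    _ ≤ _ := ENNReal.ofReal_le_ofReal hfinal

end Sizes

/-! ### The whole simulation -/

section Simulation

variable {V : Type*} [Fintype V] {G : SimpleGraph V} {w : V → ℝ} {ε c : ℝ}

lemma mpcState_congr {ω ω' : Coins V} {k : ℕ} (h : ∀ j < k, ω j = ω' j) :
    mpcState G w ε ω k = mpcState G w ε ω' k := by
  induction k with
  | zero => rfl
  | succ k ih =>
    simp only [mpcState]
    rw [ih fun j hj => h j (by omega), h k (Nat.lt_succ_self k)]

/-- The event that phase `k` is performed and fails. -/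
def PhaseFails (G : SimpleGraph V) (w : V → ℝ) (ε : ℝ) (ω : Coins V) (k : ℕ) : Prop :=
  LoopCond G (mpcState G w ε ω k) ∧ Feasible G w (mpcState G w ε ω k) ∧
    ¬ PhaseGood G w ε (mpcState G w ε ω k)
      ((ω k).2 (numMachines G (mpcState G w ε ω k))) (ω k).1

/-- The coins of phase `k` are independent of the state at its start. -/
lemma coinMeasure_phaseFails_le (h0 : 0 < ε) (h1 : ε ≤ 1 / 16)
    (hL : LargeEnough ε c (Real.log (Fintype.card V))) (k : ℕ) :
    coinMeasure V ε {ω | PhaseFails G w ε ω k} ≤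
      ENNReal.ofReal (1 / ((Fintype.card V : ℝ) ^ c * Fintype.card V)) := by
  have := isProbabilityMeasure_phaseLaw V h0
  -- measurable hulls make the event measurable without a look at `PhaseGood`
  set B : RunState V → Set (PhaseCoins V) := fun σ => toMeasurable (phaseLaw V ε)
    {x | ¬ PhaseGood G w ε σ (x.2 (numMachines G σ)) x.1} with hB
  set E : Set (Coins V) := {ω | (LoopCond G (mpcState G w ε ω k) ∧
    Feasible G w (mpcState G w ε ω k)) ∧ ω k ∈ B (mpcState G w ε ω k)} with hE
  have hEm : MeasurableSet E := by
    refine DiscreteRV.prop_iff.1 ((discreteRV_mpcState k).bind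
      (h := fun σ (ω : Coins V) => (LoopCond G σ ∧ Feasible G w σ) ∧ ω k ∈ B σ) fun σ => ?_)
    refine DiscreteRV.prop_iff.2 ((MeasurableSet.const _).inter ?_)
    exact measurable_pi_apply k (measurableSet_toMeasurable _ _)
  refine (measure_mono (t := E) fun ω hω =>
    ⟨⟨hω.1, hω.2.1⟩, subset_toMeasurable _ _ hω.2.2⟩).trans ?_
  rw [coinMeasure_eq]
  refine measure_le_of_measurePreserving_prod
    (measurePreserving_resample (fun _ : ℕ => phaseLaw V ε) {k}) hEm fun a => ?_
  set σ := mpcState G w ε a k with hσ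
  have hstate : ∀ b : Coins V,
      mpcState G w ε (fun j => if j = k then b j else a j) k = σ := fun b =>
    mpcState_congr fun j hj => if_neg (Nat.ne_of_lt hj)
  have hset : {b : Coins V | (fun j => if j ∈ ({k} : Set ℕ) then b j else a j) ∈ E} ⊆
      {b | (LoopCond G σ ∧ Feasible G w σ) ∧ b k ∈ B σ} := by
    intro b hb
    simpa only [hE, Set.mem_ofPred_eq, hstate, Set.mem_singleton_iff, if_true] using hb
  refine le_trans (measure_mono hset) ?_
  by_cases hcond : LoopCond G σ ∧ Feasible G w σ
  · have hpre := (measurePreserving_eval_infinitePi (fun _ : ℕ => phaseLaw V ε) k).measure_preimage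
      (measurableSet_toMeasurable (phaseLaw V ε)
        {x | ¬ PhaseGood G w ε σ (x.2 (numMachines G σ)) x.1}).nullMeasurableSet
    refine (measure_mono fun b hb => hb.2).trans ((le_of_eq hpre).trans ?_)
    rw [measure_toMeasurable]
    exact phaseLaw_not_phaseGood_le_rpow hL hcond.1 h0 h1 hcond.2
  · exact le_of_eq_of_le (measure_mono_null (t := ∅) (fun b hb => hcond hb.1) measure_empty)
      zero_le

lemma feasible_mpcState (h0 : 0 < ε) (h1 : ε < 1) (hw : ∀ v, 0 < w v)
    (hL : LargeEnough ε c (Real.log (Fintype.card V))) {ω : Coins V} {k : ℕ}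
    (hk : ∀ j < k, LoopCond G (mpcState G w ε ω j)) :
    Feasible G w (mpcState G w ε ω k) ∧
      avgDeg G (mpcState G w ε ω k) ≤ Fintype.card V / 2 ^ k := by
  induction k with
  | zero => exact ⟨feasible_init hw, by simpa using avgDeg_le_card G _⟩
  | succ k ih =>
    obtain ⟨hf, hd⟩ := ih fun j hj => hk j (by omega)
    have hloop := hk k (Nat.lt_succ_self k)
    refine ⟨hf.phase h1 (by linarith [one_le_avgDeg hL hloop]), ?_⟩
    refine (avgDeg_phase_le_half hL hloop h0 h1 hf).trans ?_
    rw [pow_succ, ← div_div]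
    linarith

/-- The average degree at least halves in every phase, so that the loop ends after at most `n`
phases. -/
lemma exists_not_loopCond (h0 : 0 < ε) (h1 : ε < 1) (hw : ∀ v, 0 < w v)
    (hL : LargeEnough ε c (Real.log (Fintype.card V))) (ω : Coins V) :
    ∃ K ≤ Fintype.card V, ¬ LoopCond G (mpcState G w ε ω K) := by
  by_contra! hcon
  have h := (feasible_mpcState h0 h1 hw hL fun j hj => hcon j (le_of_lt hj)).2
  have h2 := one_le_avgDeg hL (hcon _ le_rfl)
  have h3 : (Fintype.card V : ℝ) < 2 ^ Fintype.card V := by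
    exact_mod_cast Nat.lt_two_pow_self
  have h4 : (Fintype.card V : ℝ) / 2 ^ Fintype.card V < 1 := (div_lt_one (by positivity)).2 h3
  linarith

lemma succeeds_of_not_phaseFails (h0 : 0 < ε) (h1 : ε < 1 / 16) (hw : ∀ v, 0 < w v)
    (hL : LargeEnough ε c (Real.log (Fintype.card V))) {ω : Coins V}
    (hω : ∀ k < Fintype.card V, ¬ PhaseFails G w ε ω k) : Succeeds G w ε ω := by
  have hε1 : ε < 1 := by linarith
  obtain ⟨K', hK', hK'2⟩ := exists_not_loopCond (G := G) h0 hε1 hw hL ω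
  have hex : ∃ K, ¬ LoopCond G (mpcState G w ε ω K) := ⟨K', hK'2⟩
  have hloop : ∀ k < Nat.find hex, LoopCond G (mpcState G w ε ω k) := fun k hk =>
    not_not.1 (Nat.find_min hex hk)
  have hle : Nat.find hex ≤ Fintype.card V := (Nat.find_min' hex hK'2).trans hK'
  have hfeas : ∀ k ≤ Nat.find hex, Feasible G w (mpcState G w ε ω k) := fun k hk =>
    (feasible_mpcState h0 hε1 hw hL fun j hj => hloop j (by omega)).1
  have htight : ∀ k ≤ Nat.find hex, AlmostTight G w ε (mpcState G w ε ω k) := by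
    intro k
    induction k with
    | zero => exact fun _ => almostTight_init
    | succ k ih =>
      intro hk
      have hf := hfeas k (by omega)
      refine (ih (by omega)).phase h0 hw hf ?_
      by_contra hg
      exact hω k (by omega) ⟨hloop k (by omega), hf, hg⟩
  exact ⟨Nat.find hex, _, ⟨hloop, Nat.find_spec hex, rfl⟩, fun x₀ T hx hT =>
    exists_finishReturns h0 h1 hw (hfeas _ le_rfl) (htight _ le_rfl) hx hT⟩

end Simulation

end MWVC

theorem mainTheorem2 (ε : ℝ) (hε : 0 < ε) (hε' : ε < 1 / 16) (c : ℝ) (hc : 0 < c) :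
    ∃ n₀ : ℕ, ∀ (V : Type*) [Fintype V] (G : SimpleGraph V) (w : V → ℝ),
      n₀ ≤ Fintype.card V → (∀ v, 0 < w v) →
      MWVC.coinMeasure V ε {ω | ¬ MWVC.Succeeds G w ε ω} ≤
        ENNReal.ofReal (1 / (Fintype.card V : ℝ) ^ c) := by
  obtain ⟨L₀, hL₀⟩ := MWVC.exists_largeEnough hε (by linarith) c
  refine ⟨⌈Real.exp L₀⌉₊, fun V _ G w hn hw => ?_⟩
  have hn' : Real.exp L₀ ≤ Fintype.card V := (Nat.le_ceil _).trans (Nat.cast_le.2 hn)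
  have hpos : (0 : ℝ) < Fintype.card V := (Real.exp_pos _).trans_le hn'
  have hL := hL₀ _ ((Real.le_log_iff_exp_le hpos).2 hn')
  have hsub : {ω | ¬ MWVC.Succeeds G w ε ω} ⊆
      ⋃ k ∈ Finset.range (Fintype.card V), {ω | MWVC.PhaseFails G w ε ω k} := by
    intro ω hω
    by_contra hcon
    refine hω (MWVC.succeeds_of_not_phaseFails hε hε' hw hL fun k hk hf => hcon ?_)
    exact Set.mem_biUnion (Finset.mem_coe.2 (Finset.mem_range.2 hk)) hf
  calc MWVC.coinMeasure V ε {ω | ¬ MWVC.Succeeds G w ε ω}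
      ≤ ∑ k ∈ Finset.range (Fintype.card V), MWVC.coinMeasure V ε {ω | MWVC.PhaseFails G w ε ω k} :=
        (MeasureTheory.measure_mono hsub).trans (MeasureTheory.measure_biUnion_finset_le _ _)
    _ ≤ ∑ _k ∈ Finset.range (Fintype.card V),
          ENNReal.ofReal (1 / ((Fintype.card V : ℝ) ^ c * Fintype.card V)) :=
        Finset.sum_le_sum fun k _ => MWVC.coinMeasure_phaseFails_le hε hε'.le hL k
    _ = ENNReal.ofReal (1 / (Fintype.card V : ℝ) ^ c) := by
        rw [Finset.sum_const, Finset.card_range, nsmul_eq_mul, ← ENNReal.ofReal_natCast,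
          ← ENNReal.ofReal_mul hpos.le]
        congr 1
        have := (Real.rpow_pos_of_pos hpos c).ne'
        field_simp
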